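/- Let $p$ be a prime, $F/\mathbb{Q}_p$ a finite extension with ring of integers $\mathcal{O}_F$, uniformizer $\varpi$ and residue field $k_F$ of cardinality $q=p^f$, and let $|\cdot|$ be the absolute value of $F$ with $|\varpi|=q^{-1}$. Let $F_0=W(k_F)[1/p]$, with Witt vector Frobenius $\varphi_0$. Let $E/\mathbb{Q}_p$ be a finite extension that contains the image of an embedding $\sigma:F_0\hookrightarrow E$ and a square root of $q$, which is fixed and used to define half-integral powers of $|\cdot|$. Let $G=GL_n(F)$, $K=GL_n(\mathcal{O}_F)$, and let $I\subset K$ be the Iwahori subgroup of matrices that are upper triangular modulo $\varpi$. Let $D$ be a $(\varphi,N)$-module of rank $n$ with coefficients in $E$: a free $F_0\otimes_{\mathbb{Q}_p}E$-module of rank $n$ with a bijective, $\varphi_0\otimes 1$-semilinear map $\phi:D\to D$ and an $F_0\otimes E$-linear endomorphism $N$ with $N\phi=p\phi N$. (The case of interest is $D=D_x=D_{\mathrm{st}}(V_x)$, $\phi=\phi_x$, for an $E$-valued point $x$ of the generic fibre of a lifting ring of semi-stable representations of $\mathrm{Gal}(\overline F/F)$ with fixed Hodge–Tate weights.) Let $WD(D)$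 be the Weil–Deligne representation attached to $D$ by Fontaine's recipe: the component $D_\sigma=\{d\in D: (a\otimes 1)d=(1\otimes\sigma(a))d\ \ \forall a\in F_0\}$ with its endomorphism $N$, on which inertia acts trivially and geometric Frobenius elements act by $\phi^f$. Let $\pi$ be a smooth $E$-representation of $G$ with $\pi^I\neq 0$ such that, over $\overline E$, $\pi$ is irreducible and generic (it has a Whittaker model) and corresponds to the Frobenius semi-simplification of $WD(D)$ under the local Langlands correspondence, normalized so that for $n=1$ uniformizers correspond to geometric Frobenius elements. Explicitly: over $\overline E$, $WD(D)^{F\text{-ss}}\simeq\bigoplus_{i=1}^t \mathrm{Sp}(\chi_i,k_i)$ with $\chi_i$ unramified characters of $F^\times$, where $\mathrm{Sp}(\chi,k)$ has a basis $e_0,\dots,e_{k-1}$ on which geometric Frobenius acts by $e_j\mapsto \chi(\varpi)q^{-j}e_j$ and $N e_j=e_{j+1}$, $N e_{k-1}=0$; and $\pi$ is the Langlands quotient of the normalized parabolic induction $Q(\Delta_1)\times\cdots\times Q(\Delta_t)$, where $\Delta_i=(\chi_i,\chi_i|\cdot|,\dots,\chi_i|\cdot|^{k_i-1})$, $Q(\Delta_i)$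 is the irreducible quotient of $\chi_i\times\chi_i|\cdot|\times\cdots\times\chi_i|\cdot|^{k_i-1}$, and the segments are ordered so that no $\Delta_i$ precedes a later one. Let $\mathfrak{Z}$ be the centre of the Bernstein component $[T,1]_G$, that is, of the category of smooth $E$-representations of $G$ generated by their $I$-fixed vectors. It acts on $\mathrm{c\text{-}Ind}_K^G 1$ through $\mathrm{End}_G(\mathrm{c\text{-}Ind}_K^G 1)=\mathcal{H}(G,K)$, and on $\pi$ through a character $\chi_\pi:\mathfrak{Z}\to E$; put $\eta=\mathrm{c\text{-}Ind}_K^G 1\otimes_{\mathfrak{Z},\chi_\pi}E$. For $1\le r\le n$ let $\theta_r\in\mathcal{H}(G,K)$ be the double coset operator $\left[K\begin{pmatrix}\varpi I_r&0\\0&I_{n-r}\end{pmatrix}K\right]$. Then $q^{r(1-r)/2}\,\mathrm{Tr}_{F_0\otimes E}(\bigwedge^r\phi^f)$ lies in $E$, and $\theta_r$, regarded as an element of $\mathfrak{Z}$ (that is, an element $z\in\mathfrak{Z}$ that acts on $\mathrm{c\text{-}Ind}_K^G1$ as $\theta_r$), acts on $\eta\otimes|\det|^{(n-1)/2}$, and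 likewise on $\pi\otimes|\det|^{(n-1)/2}$, as multiplication by $$q^{\frac{r(1-r)}{2}}\,\mathrm{Tr}\Big(\bigwedge\nolimits^r\phi^f\Big).$$ -/

import Mathlib

open CategoryTheory ValuativeRel Module
open scoped TensorProduct Matrix

universe u

set_option linter.unusedSectionVars false

noncomputable section

namespace IwahoriLL

/-! ### The field `F`: normalized valuation, residue cardinality, unramified characters -/

section LocalField

variable (F : Type u) [Field F] [ValuativeRel F] [TopologicalSpace F]
  [IsNonarchimedeanLocalField F]

/-- The cardinality `q` of the residue field of `F`. -/
def resCard : ℕ := Nat.card 𝓀[F]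

variable {F}

/-- The normalized additive valuation `Fˣ → ℤ`, with value `1` on uniformizers. -/
def ord (x : Fˣ) : ℤ :=
  -WithZero.log (IsNonarchimedeanLocalField.valueGroupWithZeroIsoInt F (valuation F (x : F)))

theorem ord_mul (x y : Fˣ) : ord (x * y) = ord x + ord y := by
  have h : ∀ z : Fˣ,
      IsNonarchimedeanLocalField.valueGroupWithZeroIsoInt F (valuation F (z : F)) ≠ 0 := by
    intro z
    rw [map_ne_zero, map_ne_zero]
    exact z.ne_zero
  simp only [ord, Units.val_mul, map_mul]
  rw [WithZero.log_mul (h x) (h y)]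
  ring

theorem ord_one : ord (1 : Fˣ) = 0 := by
  simp [ord]

variable {C : Type u} [Field C]

/-- The unramified character `x ↦ a ^ ord x` of `Fˣ`; it takes the value `a` on uniformizers. -/
def unramChar (a : Cˣ) : Fˣ →* Cˣ where
  toFun x := a ^ ord x
  map_one' := by simp [ord_one]
  map_mul' x y := by rw [ord_mul, zpow_add]

/-- For `s` with `s ^ 2 = q`, the character `|·|^{1/2}` of `Fˣ`, with `|ϖ| = q⁻¹`. -/
abbrev sqrtAbs (s : Cˣ) : Fˣ →* Cˣ := unramChar s⁻¹

end LocalField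

/-! ### Smooth representations and smooth induction for a topological group -/

section Smooth

variable {C G M : Type*} [Field C] [Group G] [TopologicalSpace G] [AddCommGroup M] [Module C M]

/-- Every vector is fixed by an open subgroup. -/
def IsSmooth (ρ : Representation C G M) : Prop :=
  ∀ v : M, ∃ U : Subgroup G, IsOpen (U : Set G) ∧ ∀ g ∈ U, ρ g v = v

/-- The space of functions `f : G → M`, right invariant under some open subgroup, with
`f (x g) = A (f g)` for all `g` whenever `(x, A) ∈ T`. Taking for `T` the graph of a representation
of a subgroup `P` one obtains the smooth induction from `P` to `G`. -/
def smoothInd (T : Set (G × Module.End C M)) : Submodule C (G → M) where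
  carrier := {f | (∀ x A, (x, A) ∈ T → ∀ g, f (x * g) = A (f g)) ∧
    ∃ U : Subgroup G, IsOpen (U : Set G) ∧ ∀ g, ∀ u ∈ U, f (g * u) = f g}
  zero_mem' := ⟨by simp, ⊤, isOpen_univ, by simp⟩
  add_mem' := by
    rintro f f' ⟨hf, U, hU, hfU⟩ ⟨hf', U', hU', hfU'⟩
    refine ⟨fun x A h g => by simp [hf x A h, hf' x A h], U ⊓ U', hU.inter hU', ?_⟩
    rintro g u ⟨hu, hu'⟩
    simp [hfU g u hu, hfU' g u hu']
  smul_mem' := by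
    rintro c f ⟨hf, U, hU, hfU⟩
    exact ⟨fun x A h g => by simp [hf x A h], U, hU, fun g u hu => by simp [hfU g u hu]⟩

variable [IsTopologicalGroup G]

theorem smoothInd_translate {T : Set (G × Module.End C M)} {f : G → M} (h : G)
    (hf : f ∈ smoothInd T) : (fun g => f (g * h)) ∈ smoothInd T := by
  obtain ⟨hf, U, hU, hfU⟩ := hf
  refine ⟨fun x A hx g => by simp [mul_assoc, hf x A hx],
    U.comap (MulAut.conj h⁻¹).toMonoidHom, ?_, ?_⟩
  · refine hU.preimage ?_
    change Continuous fun g => h⁻¹ * g * (h⁻¹)⁻¹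
    fun_prop
  · intro g u hu
    have hu' : h⁻¹ * u * (h⁻¹)⁻¹ ∈ U := hu
    have := hfU (g * h) _ hu'
    simpa [mul_assoc] using this

/-- The action of `G` on `smoothInd T` by right translation. -/
def smoothIndRep (T : Set (G × Module.End C M)) : Representation C G (smoothInd T) where
  toFun h :=
    { toFun := fun f => ⟨fun g => f.1 (g * h), smoothInd_translate h f.2⟩
      map_add' := fun _ _ => rfl
      map_smul' := fun _ _ => rfl }
  map_one' := by ext; simp
  map_mul' x y := by ext; simp [mul_assoc]

end Smooth

/-- `σ` is isomorphic to a quotient of `ρ`. -/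
def IsQuotientOf {C G V W : Type*} [Field C] [Group G] [AddCommGroup V] [Module C V]
    [AddCommGroup W] [Module C W] (σ : Representation C G W) (ρ : Representation C G V) : Prop :=
  ∃ f : ρ.IntertwiningMap σ, Function.Surjective f

/-- Extension of scalars of a representation. -/
def extendScalars {E : Type*} (C : Type*) {G V : Type*} [Field E] [Field C] [Algebra E C] [Group G]
    [AddCommGroup V] [Module E V] (ρ : Representation E G V) : Representation C G (C ⊗[E] V) where
  toFun g := (ρ g).baseChange C
  map_one' := by
    rw [map_one]
    exact LinearMap.baseChange_id
  map_mul' x y := by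
    rw [map_mul]
    exact LinearMap.baseChange_comp _ _

/-- The twist `ρ ⊗ χ` of a representation by a character. -/
def twist {C G V : Type*} [Field C] [Group G] [AddCommGroup V] [Module C V]
    (ρ : Representation C G V) (χ : G →* Cˣ) : Representation C G V where
  toFun g := (χ g : C) • ρ g
  map_one' := by simp
  map_mul' x y := by
    rw [map_mul, map_mul, Units.val_mul, smul_mul_smul_comm]

/-! ### Representations of `GL_n(F)` -/

section GLn

variable {F : Type u} [Field F] [ValuativeRel F] [TopologicalSpace F]
  [IsNonarchimedeanLocalField F] {C : Type u} [Field C]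

/-- The normalized principal series `i_B^G(ψ_1 ⊗ ⋯ ⊗ ψ_n)` from the upper triangular Borel subgroup;
`δ_B^{1/2}(b) = ∏ |b_ii|^{(n + 1 - 2 i) / 2}`, written here for an arbitrary finite linearly ordered
set of indices. -/
def principalSeries (s : Cˣ) {ι : Type} [Fintype ι] [LinearOrder ι] (ψ : ι → (Fˣ →* Cˣ)) :
    Representation C (GL ι F)
      (smoothInd (C := C) (G := GL ι F) (M := C) {y | (y.1 : Matrix ι ι F).IsUpperTriangular ∧
        ∃ t : ι → Fˣ, (∀ i, (y.1 : Matrix ι ι F) i i = t i) ∧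
          y.2 = ((∏ i, sqrtAbs s (t i) ^
            ((Fintype.card {j // i < j} : ℤ) - Fintype.card {j // j < i}) * ψ i (t i) : Cˣ) : C) •
              (1 : Module.End C C)}) :=
  smoothIndRep _

/-- The normalized parabolic induction `τ_1 × ⋯ × τ_t`. The monotone map `b : Fin n → Fin t`
encodes the standard block upper triangular parabolic subgroup, whose `i`-th diagonal block has
the fibre `b⁻¹(i)` as its set of indices; `δ_P^{1/2}` is
`∏_{i < l} |det m_i|^{k_l / 2} |det m_l|^{-k_i / 2}` with `k_i` the size of the `i`-th block. -/
def parabolicInd (s : Cˣ) {n t : ℕ} (b : Fin n → Fin t)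
    (τ : ∀ i : Fin t, Rep.{u} C (GL {j // b j = i} F)) :
    Representation C (GL (Fin n) F)
      (smoothInd (C := C) (G := GL (Fin n) F) (M := ⨂[C] i, (τ i).V)
        {y | (y.1 : Matrix (Fin n) (Fin n) F).BlockTriangular b ∧
          ∃ m : ∀ i : Fin t, GL {j // b j = i} F,
            (∀ i, (y.1 : Matrix (Fin n) (Fin n) F).toSquareBlock b i = m i) ∧
            y.2 = ((∏ i, sqrtAbs s (Matrix.GeneralLinearGroup.det (m i)) ^
              ((Fintype.card {j // i < b j} : ℤ) - Fintype.card {j // b j < i}) : Cˣ) : C) •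
                PiTensorProduct.map fun i => (τ i).ρ (m i)}) :=
  smoothIndRep _

/-- The unramified characters `χ, χ|·|, …, χ|·|^{k-1}` of a segment, where `χ(ϖ) = a` and
`s ^ 2 = q`, as a function on a linearly ordered set of `k` indices. -/
def segmentChar (s a : Cˣ) {ι : Type} [Fintype ι] [LinearOrder ι] (j : ι) : Fˣ →* Cˣ :=
  unramChar (a * (s ^ 2)⁻¹ ^ Fintype.card {j' // j' < j})

/-- `τ` is `Q(Δ)`: the irreducible quotient of `χ × χ|·| × ⋯ × χ|·|^{k-1}`, where `χ(ϖ) = a`. -/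
def IsSegmentQuotient (s a : Cˣ) {ι : Type} [Fintype ι] [LinearOrder ι] {V : Type u}
    [AddCommGroup V] [Module C V] (τ : Representation C (GL ι F) V) : Prop :=
  τ.IsIrreducible ∧ IsQuotientOf τ (principalSeries s (segmentChar (F := F) (ι := ι) s a))

/-- The segment `(χ, …, χ|·|^{k-1})` precedes `(χ', …, χ'|·|^{k'-1})`, where `χ(ϖ) = a` and
`χ'(ϖ) = a'`: the two are linked and `χ' = χ|·|^m` with `m > 0`. -/
def Precedes (s a : Cˣ) (k : ℕ) (a' : Cˣ) (k' : ℕ) : Prop :=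
  ∃ m : ℕ, 1 ≤ m ∧ m ≤ k ∧ k < m + k' ∧ a' = a * (s ^ 2)⁻¹ ^ m

/-- The local Langlands correspondence for `GL_n(F)`, normalized so that for `n = 1` uniformizers
correspond to geometric Frobenius elements, on Weil–Deligne representations trivial on inertia.
Such a Weil–Deligne representation is a vector space `W` with the automorphism `Φ` by which
geometric Frobenius elements act and the monodromy `N`. The correspondence attaches to it the
irreducible representation `π` with
`(W, Φ^ss, N) ≅ Sp(χ_1, k_1) ⊕ ⋯ ⊕ Sp(χ_t, k_t)`, `π = Langlands quotient of Q(Δ_1) × ⋯ × Q(Δ_t)`,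
where `Δ_i = (χ_i, …, χ_i|·|^{k_i - 1})` and no `Δ_i` precedes a later `Δ_l`; here
`Sp(χ, k)` has a basis `e_0, …, e_{k-1}` with `Φ e_j = χ(ϖ) q^{-j} e_j`, `N e_j = e_{j+1}` and
`N e_{k-1} = 0`. As in `parabolicInd`, `b` encodes the sizes `k_i`, and `a i = χ_i(ϖ)`. -/
def LocalLanglands (s : Cˣ) {n : ℕ} {W : Type*} [AddCommGroup W] [Module C W]
    (Φ N : Module.End C W) {V : Type u} [AddCommGroup V] [Module C V]
    (π : Representation C (GL (Fin n) F) V) : Prop :=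
  ∃ (t : ℕ) (b : Fin n → Fin t) (a : Fin t → Cˣ),
    Monotone b ∧ Function.Surjective b ∧
    (∀ i l, i < l → ¬ Precedes s (a i) (Fintype.card {j // b j = i})
      (a l) (Fintype.card {j // b j = l})) ∧
    (∃ (S : Module.End C W) (e : Basis (Fin n) C W),
      Commute S Φ ∧ IsNilpotent (Φ - S) ∧
      (∀ j, S (e j) =
        ((a (b j) * (s ^ 2)⁻¹ ^ Fintype.card {j' // j' < j ∧ b j' = b j} : Cˣ) : C) • e j) ∧
      (∀ j j' : Fin n, (j' : ℕ) = j + 1 → b j' = b j → N (e j) = e j') ∧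
      (∀ j : Fin n, (∀ j' : Fin n, (j' : ℕ) = j + 1 → b j' ≠ b j) → N (e j) = 0)) ∧
    ∃ τ : ∀ i : Fin t, Rep.{u} C (GL {j // b j = i} F),
      (∀ i, IsSegmentQuotient s (a i) (τ i).ρ) ∧
      π.IsIrreducible ∧ IsQuotientOf π (parabolicInd s b τ)

/-- `π` has a Whittaker functional: a nonzero linear form on which the group of unipotent upper
triangular matrices acts through a smooth nondegenerate character. -/
def HasWhittakerFunctional {n : ℕ} {V : Type*} [AddCommGroup V] [Module C V]
    (π : Representation C (GL (Fin n) F) V) : Prop :=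
  ∃ (Ψ : AddChar F C) (l : V →ₗ[C] C), Ψ ≠ 1 ∧ IsOpen {x | Ψ x = 1} ∧ l ≠ 0 ∧
    ∀ (x : GL (Fin n) F) (v : V), (x : Matrix (Fin n) (Fin n) F).IsUpperTriangular →
      (∀ i, (x : Matrix (Fin n) (Fin n) F) i i = 1) →
      l (π x v) = Ψ (∑ i : Fin n, ∑ j : Fin n,
        if (j : ℕ) = i + 1 then (x : Matrix (Fin n) (Fin n) F) i j else 0) * l v

variable (F) in
/-- `K = GL_n(𝒪_F)`. -/
def maxCompact (n : ℕ) : Subgroup (GL (Fin n) F) :=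
  (Matrix.GeneralLinearGroup.map (algebraMap 𝒪[F] F)).range

/-- The subgroup of upper triangular matrices. -/
def borel (k : Type*) [Field k] (n : ℕ) : Subgroup (GL (Fin n) k) where
  carrier := {x | (x : Matrix (Fin n) (Fin n) k).IsUpperTriangular}
  one_mem' := Matrix.blockTriangular_one
  mul_mem' hx hy := by
    simp only [Set.mem_ofPred_eq, Units.val_mul] at *
    exact hx.mul hy
  inv_mem' {x} hx := by
    simp only [Set.mem_ofPred_eq] at *
    rw [Matrix.coe_units_inv]
    let := x.invertible
    exact Matrix.blockTriangular_inv_of_blockTriangular hx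

variable (F) in
/-- The Iwahori subgroup: matrices in `GL_n(𝒪_F)` that are upper triangular modulo `𝔭_F`. -/
def iwahori (n : ℕ) : Subgroup (GL (Fin n) F) :=
  ((borel 𝓀[F] n).comap (Matrix.GeneralLinearGroup.map (IsLocalRing.residue 𝒪[F]))).map
    (Matrix.GeneralLinearGroup.map (algebraMap 𝒪[F] F))

/-- The matrix `diag(ϖ I_r, I_{n-r})`. -/
def heckeElement (n r : ℕ) (ϖ : Fˣ) : GL (Fin n) F :=
  Units.map (Matrix.diagonalRingHom (Fin n) F).toMonoidHom
    (MulEquiv.piUnits.symm fun i : Fin n => if (i : ℕ) < r then ϖ else 1)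

end GLn

/-! ### The Bernstein component of the Iwahori subgroup and its centre -/

section Bernstein

variable (F : Type u) [Field F] [ValuativeRel F] [TopologicalSpace F]
  [IsNonarchimedeanLocalField F] (E : Type u) [Field E] (n : ℕ)

/-- The Bernstein component `[T, 1]_G`, with type `(I, 1)`: the smooth representations
generated by their vectors fixed by the Iwahori subgroup `I`. -/
def iwahoriBlock : ObjectProperty (Rep.{u} E (GL (Fin n) F)) := fun V =>
  IsSmooth V.ρ ∧
    Submodule.span E {w : V | ∃ (g : GL (Fin n) F) (v : V),
      (∀ x ∈ iwahori F n, V.ρ x v = v) ∧ w = V.ρ g v} = ⊤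

/-- The centre of the Bernstein component `[T, 1]_G`. -/
abbrev BernsteinCentre : Type _ := CatCenter (iwahoriBlock F E n).FullSubcategory

/-- The permutation representation of `G = GL_n(F)` on `E[G/K]`. -/
def cosetRep : Representation E (GL (Fin n) F) ((GL (Fin n) F ⧸ maxCompact F n) →₀ E) where
  toFun g := Finsupp.lmapDomain E E (g • ·)
  map_one' := by ext; simp
  map_mul' x y := by ext; simp [mul_smul]

/-- `c-Ind_K^G 1`, realized as `E[G/K]`: the coset `g K` is the indicator function of `K g⁻¹`. -/
def cInd : Rep.{u} E (GL (Fin n) F) := Rep.of (cosetRep F E n)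

variable {F E n}

/-- The action of an element of the Bernstein centre on an object. -/
def centreAct (z : BernsteinCentre F E n) (V : Rep.{u} E (GL (Fin n) F))
    (hV : iwahoriBlock F E n V) : V →ₗ[E] V :=
  (z.app ⟨V, hV⟩).hom.hom.toLinearMap

/-- `z` acts on `V`, an object of the component, as multiplication by `c`. -/
def ActsByScalar (z : BernsteinCentre F E n) (V : Rep.{u} E (GL (Fin n) F)) (c : E) : Prop :=
  ∃ hV : iwahoriBlock F E n V, ∀ v : V, centreAct z V hV v = c • v

theorem cosetRep_single (g : GL (Fin n) F) (x : GL (Fin n) F ⧸ maxCompact F n) (c : E) :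
    cosetRep F E n g (Finsupp.single x c) = Finsupp.single (g • x) c := by
  simp [cosetRep]

theorem isOpen_maxCompact : IsOpen (maxCompact F n : Set (GL (Fin n) F)) := by
  have hO : IsOpen {x : F | valuation F x ≤ 1} := (valuation F).isOpen_integer
  have h : (maxCompact F n : Set (GL (Fin n) F)) =
      (⋂ i, ⋂ j, {g : GL (Fin n) F | valuation F ((g : Matrix (Fin n) (Fin n) F) i j) ≤ 1}) ∩
      ⋂ i, ⋂ j, {g : GL (Fin n) F |
        valuation F (((g⁻¹ : GL (Fin n) F) : Matrix (Fin n) (Fin n) F) i j) ≤ 1} := by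
    ext g
    simp only [Set.mem_inter_iff, Set.mem_iInter, Set.mem_ofPred_eq, SetLike.mem_coe]
    constructor
    · rintro ⟨x, rfl⟩
      refine ⟨fun i j => (x.val i j).2, fun i j => ?_⟩
      rw [← map_inv]
      exact (x⁻¹.val i j).2
    · rintro ⟨h1, h2⟩
      have hinj : Function.Injective
          (fun A : Matrix (Fin n) (Fin n) 𝒪[F] => A.map (algebraMap 𝒪[F] F)) :=
        Matrix.map_injective Subtype.val_injective
      let A : Matrix (Fin n) (Fin n) 𝒪[F] := Matrix.of fun i j => ⟨_, h1 i j⟩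
      let B : Matrix (Fin n) (Fin n) 𝒪[F] := Matrix.of fun i j => ⟨_, h2 i j⟩
      have hA : A.map (algebraMap 𝒪[F] F) = g.val := rfl
      have hB : B.map (algebraMap 𝒪[F] F) = (g⁻¹).val := rfl
      refine ⟨⟨A, B, hinj ?_, hinj ?_⟩, Units.ext hA⟩
      · simp only [Matrix.map_mul, hA, hB]
        simp
      · simp only [Matrix.map_mul, hA, hB]
        simp
  rw [h]
  refine IsOpen.inter ?_ ?_ <;>
    refine isOpen_iInter_of_finite fun i => isOpen_iInter_of_finite fun j => hO.preimage ?_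
  · exact (Units.continuous_val).matrix_elem i j
  · exact (Units.continuous_val.comp continuous_inv).matrix_elem i j

theorem cInd_mem : iwahoriBlock F E n (cInd F E n) := by
  constructor
  · intro v
    change (GL (Fin n) F ⧸ maxCompact F n) →₀ E at v
    change ∃ U : Subgroup (GL (Fin n) F), IsOpen (U : Set (GL (Fin n) F)) ∧ ∀ g ∈ U,
      cosetRep F E n g v = v
    induction v using Finsupp.induction_linear with
    | zero => exact ⟨⊤, isOpen_univ, by simp⟩
    | add v w hv hw =>
      obtain ⟨U, hU, h⟩ := hv
      obtain ⟨U', hU', h'⟩ := hw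
      refine ⟨U ⊓ U', hU.inter hU', ?_⟩
      rintro g ⟨hg, hg'⟩
      rw [map_add, h g hg, h' g hg']
    | single x c =>
      induction x using QuotientGroup.induction_on with
      | H x =>
        refine ⟨(maxCompact F n).comap (MulAut.conj x⁻¹).toMonoidHom, ?_, ?_⟩
        · refine isOpen_maxCompact.preimage ?_
          change Continuous fun g => x⁻¹ * g * (x⁻¹)⁻¹
          fun_prop
        · intro g hg
          have hg' : x⁻¹ * g * (x⁻¹)⁻¹ ∈ maxCompact F n := hg
          rw [cosetRep_single]
          congr 1
          change ((g * x : GL (Fin n) F) : GL (Fin n) F ⧸ maxCompact F n) = x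
          refine (QuotientGroup.eq.mpr ?_).symm
          simpa [mul_assoc] using hg'
  · rw [eq_top_iff]
    intro v _
    change (GL (Fin n) F ⧸ maxCompact F n) →₀ E at v
    induction v using Finsupp.induction_linear with
    | zero => exact Submodule.zero_mem _
    | add v w hv hw => exact Submodule.add_mem _ (hv trivial) (hw trivial)
    | single x c =>
      induction x using QuotientGroup.induction_on with
      | H x =>
        refine Submodule.subset_span ⟨x, (Finsupp.single
          ((1 : GL (Fin n) F) : GL (Fin n) F ⧸ maxCompact F n) c), ?_, ?_⟩
        · intro g hg
          have hgK : g ∈ maxCompact F n := by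
            obtain ⟨y, -, rfl⟩ := hg
            exact ⟨y, rfl⟩
          refine (cosetRep_single _ _ _).trans ?_
          congr 1
          change ((g * 1 : GL (Fin n) F) : GL (Fin n) F ⧸ maxCompact F n) = (1 : GL (Fin n) F)
          refine (QuotientGroup.eq.mpr ?_).symm
          simpa using hgK
        · refine ((cosetRep_single _ _ _).trans ?_).symm
          congr 1
          change ((x * 1 : GL (Fin n) F) : GL (Fin n) F ⧸ maxCompact F n) = x
          rw [mul_one]

/-- The double coset operator `[K g K]`: the endomorphism of `c-Ind_K^G 1 = E[G/K]` that sends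
`x K` to the sum of the `x β K`, where `K g K` is the disjoint union of the finitely many `β K`. -/
def doubleCosetOp (g : GL (Fin n) F) : cInd F E n →ₗ[E] cInd F E n :=
  Finsupp.lsum E (M := E) (R := E) (N := cInd F E n)
    fun x : GL (Fin n) F ⧸ maxCompact F n => LinearMap.toSpanSingleton E (cInd F E n)
      ((cInd F E n).ρ x.out (∑ᶠ y ∈ MulAction.orbit (maxCompact F n)
        (g : GL (Fin n) F ⧸ maxCompact F n),
          (Finsupp.single y (1 : E) : (GL (Fin n) F ⧸ maxCompact F n) →₀ E)))

/-- The kernel of the projection of `c-Ind_K^G 1` onto `c-Ind_K^G 1 ⊗_{Z, χ_π} E`, where `Z` is the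
Bernstein centre and `χ_π : Z → E` gives its action on `π`: it is spanned by the elements
`z f - χ_π(z) f`. -/
def etaKer (π : Rep.{u} E (GL (Fin n) F)) : Submodule E (cInd F E n) :=
  Submodule.span E {w | ∃ (z : BernsteinCentre F E n) (c : E) (f : cInd F E n),
    ActsByScalar z π c ∧ w = centreAct z (cInd F E n) cInd_mem f - c • f}

theorem etaKer_le (π : Rep.{u} E (GL (Fin n) F)) (g : GL (Fin n) F) :
    etaKer π ≤ (etaKer π).comap ((cInd F E n).ρ g) := by
  refine Submodule.span_le.mpr ?_
  rintro w ⟨z, c, f, hz, rfl⟩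
  refine Submodule.subset_span ⟨z, c, (cInd F E n).ρ g f, hz, ?_⟩
  rw [map_sub, map_smul]
  congr 1
  exact (Rep.hom_comm_apply (z.app ⟨cInd F E n, cInd_mem⟩).hom g f).symm

/-- `η = c-Ind_K^G 1 ⊗_{Z, χ_π} E`. -/
def eta (π : Rep.{u} E (GL (Fin n) F)) : Rep.{u} E (GL (Fin n) F) :=
  Rep.of ((cInd F E n).ρ.quotient (etaKer π) (etaKer_le π))

/-- The twist `π ⊗ |det|^{(n-1)/2}`, where `s ^ 2 = q`. -/
def twistDet (s : Eˣ) (π : Rep.{u} E (GL (Fin n) F)) : Rep.{u} E (GL (Fin n) F) :=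
  Rep.of (twist π.ρ (((sqrtAbs s).comp Matrix.GeneralLinearGroup.det) ^ (n - 1)))

end Bernstein

/-! ### `(φ, N)`-modules over `F₀ ⊗ E` -/

section PhiN

variable (p : ℕ) [Fact p.Prime] (k : Type u) [Field k] [CharP k p]

/-- The field `F₀ = W(k)[1/p]`. -/
def WittField : Type u := FractionRing (WittVector p k)

instance : Field (WittField p k) := inferInstanceAs (Field (FractionRing (WittVector p k)))

instance : Algebra (WittVector p k) (WittField p k) :=
  inferInstanceAs (Algebra (WittVector p k) (FractionRing (WittVector p k)))

instance : IsFractionRing (WittVector p k) (WittField p k) :=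
  inferInstanceAs (IsFractionRing (WittVector p k) (FractionRing (WittVector p k)))

/-- The embedding of `ℤ_p = W(𝔽_p)` into `W(k)[1/p]`. -/
def padicIntToWittField : ℤ_[p] →+* WittField p k :=
  ((algebraMap (WittVector p k) (WittField p k)).comp
    (WittVector.map (ZMod.castHom dvd_rfl k))).comp (WittVector.equiv p).symm.toRingHom

theorem padicIntToWittField_injective : Function.Injective (padicIntToWittField p k) := by
  refine ((IsFractionRing.injective (WittVector p k) (WittField p k)).comp
    (WittVector.map_injective _ (RingHom.injective _))).comp (WittVector.equiv p).symm.injective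

instance : Algebra ℚ_[p] (WittField p k) :=
  (IsFractionRing.lift (padicIntToWittField_injective p k)).toAlgebra

variable [PerfectRing k p]

/-- The Frobenius automorphism `φ₀` of `F₀`, induced by the Witt vector Frobenius. -/
def wittFrobenius : WittField p k ≃+* WittField p k :=
  IsFractionRing.ringEquivOfRingEquiv (WittVector.frobeniusEquiv p k)

variable (E : Type u) [Field E] [Algebra ℚ_[p] E]

/-- A `(φ, N)`-module structure on the `E ⊗ F₀`-module `D`: a bijective `φ₀`-semilinear and
`E`-linear `φ`, where `φ₀` is the Witt vector Frobenius of `F₀`, and a linear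
`N` with `N φ = p φ N`. -/
structure PhiNModule (D : Type*) [AddCommGroup D] [Module (E ⊗[ℚ_[p]] WittField p k) D] where
  phi : D ≃+ D
  phi_smul : ∀ (e : E) (a : WittField p k) (d : D),
    phi ((e ⊗ₜ[ℚ_[p]] a) • d) =
      (e ⊗ₜ[ℚ_[p]] (wittFrobenius p k a)) • phi d
  N : D →ₗ[E ⊗[ℚ_[p]] WittField p k] D
  N_phi : ∀ d, N (phi d) = p • phi (N d)

variable {p k E}

theorem frobenius_iterate {f : ℕ} [Finite k] (hf : Nat.card k = p ^ f) (a : WittField p k) :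
    (wittFrobenius p k)^[f] a = a := by
  have hW : ∀ w : WittVector p k, (WittVector.frobenius)^[f] w = w := by
    intro w
    have key : ∀ (m : ℕ) (i : ℕ),
        ((WittVector.frobenius)^[m] w).coeff i = w.coeff i ^ p ^ m := by
      intro m
      induction m with
      | zero => simp
      | succ m ih =>
        intro i
        rw [Function.iterate_succ_apply', WittVector.coeff_frobenius_charP, ih, ← pow_mul, pow_succ]
    ext i
    have := Fintype.ofFinite k
    rw [key, ← hf, Nat.card_eq_fintype_card, FiniteField.pow_card]
  have hmap : ∀ (m : ℕ) (w : WittVector p k),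
      (wittFrobenius p k)^[m] (algebraMap _ (WittField p k) w) =
        algebraMap _ (WittField p k) ((WittVector.frobenius)^[m] w) := by
    intro m w
    induction m with
    | zero => rfl
    | succ m ih =>
      rw [Function.iterate_succ_apply', Function.iterate_succ_apply', ih]
      exact IsFractionRing.ringEquivOfRingEquiv_algebraMap _ _
  have hpow : ∀ x, (wittFrobenius p k)^[f] x =
      ((wittFrobenius p k : WittField p k →+* WittField p k) ^ f) x := by
    intro x
    rw [RingHom.coe_pow]
    rfl
  obtain ⟨x, y, -, rfl⟩ := IsFractionRing.div_surjective (A := WittVector p k) a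
  rw [hpow, map_div₀, ← hpow, ← hpow, hmap, hmap, hW, hW]

namespace PhiNModule

variable {D : Type*} [AddCommGroup D] [Module (E ⊗[ℚ_[p]] WittField p k) D]
  (M : PhiNModule p k E D)

/-- The linear endomorphism `φ^f` of `D`, where `p ^ f` is the cardinality of `k`. -/
def phiPow {f : ℕ} [Finite k] (hf : Nat.card k = p ^ f) : D →ₗ[E ⊗[ℚ_[p]] WittField p k] D where
  toFun := M.phi^[f]
  map_add' := iterate_map_add M.phi f
  map_smul' r d := by
    have key : ∀ (m : ℕ) (e : E) (a : WittField p k) (d : D),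
        M.phi^[m] ((e ⊗ₜ[ℚ_[p]] a) • d) =
          (e ⊗ₜ[ℚ_[p]] ((wittFrobenius p k)^[m] a)) • M.phi^[m] d := by
      intro m e a d
      induction m with
      | zero => rfl
      | succ m ih => simp only [Function.iterate_succ_apply', ih, M.phi_smul]
    rw [RingHom.id_apply]
    induction r using TensorProduct.induction_on with
    | zero => rw [zero_smul, zero_smul, iterate_map_zero]
    | tmul e a => rw [key, frobenius_iterate hf]
    | add x y hx hy => rw [add_smul, iterate_map_add, hx, hy, add_smul]

variable [Module E D] [IsScalarTower E (E ⊗[ℚ_[p]] WittField p k) D]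

variable (D) in
/-- The component `D_σ` of `D` at an embedding `σ : F₀ → E`, on which `F₀` acts through `σ`. -/
def component (σ : WittField p k →ₐ[ℚ_[p]] E) : Submodule E D where
  carrier := {d | ∀ a : WittField p k, ((1 : E) ⊗ₜ[ℚ_[p]] a) • d = σ a • d}
  zero_mem' := by simp
  add_mem' hx hy a := by rw [smul_add, smul_add, hx a, hy a]
  smul_mem' c d hd a := by
    rw [← algebraMap_smul (E ⊗[ℚ_[p]] WittField p k) c d, smul_smul, mul_comm, ← smul_smul, hd a,
      algebraMap_smul, algebraMap_smul, smul_comm]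

/-- The endomorphism of `D_σ` induced by a linear endomorphism of `D`. -/
def onComponent (σ : WittField p k →ₐ[ℚ_[p]] E) (A : D →ₗ[E ⊗[ℚ_[p]] WittField p k] D) :
    Module.End E (component D σ) :=
  (A.restrictScalars E).restrict (p := component D σ) (q := component D σ) <| by
    intro d hd a
    have h := hd a
    rw [LinearMap.restrictScalars_apply, ← map_smul, h]
    exact (A.restrictScalars E).map_smul (σ a) d

end PhiNModule

end PhiN

end IwahoriLL

end

/-! A central element is determined, on the Iwahori fixed vectors of every object of the block, by
one element `heckeCoeff z` of `E[G/I]`, namely its value at the generator of `c-Ind_I^G 1`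
(`centreAct_eq_sum`). If `z` acts on `c-Ind_K^G 1` as `θ_r`, the image of this element in `E[G/K]`
is the indicator of `K diag(ϖ I_r, 1) K / K`. Hence `z` multiplies the spherical vector of the
unramified principal series with parameters `X` by the Satake value `satake r ϖ X` (`hecke_sph`).

The representation `π` need not have a vector fixed by `K`, so this scalar has to be carried over to
all Iwahori fixed vectors of all unramified principal series. For rational parameters that grow fast
enough, the translates of the spherical vector span the Iwahori fixed vectors: a matrix of values of
an averaged spherical vector is diagonally dominant (`mem_span_sph`). Since `z` commutes with `G`,
it acts by the Satake value there. A function on `K` extends to a vector of the principal series for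
each choice of parameters, and with the restriction to `K` kept fixed both sides of the eigenvalue
identity are Laurent polynomials in the parameters. They agree on a Zariski dense set, hence
everywhere (`laurent_ext`, `hecke_eigen`).

Over the algebraic closure `π` is a quotient of a representation induced from quotients of principal
series. Averaging over compact groups lifts Iwahori fixed vectors through these surjections, and
evaluation at `1` in the blocks lands in a principal series of `G`, so the scalar reaches `π`
(`hecke_eigen_parabolic`).

The Satake value is found by counting. The double coset splits into cells indexed by the subsets `J`
of size `r`, each with a power of `q` many cosets (`satake_eq_sum`); after the twist by
`|det|^{(n-1)/2}` the result is `q^{r(1-r)/2}` times the elementary symmetric function of the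
numbers `χ_i(ϖ) q^{-j}` (`satake_segParam`). These numbers are the eigenvalues of `φ^f` on `D_σ`.
The trace of `⋀^r φ^f` is a sum of principal minors, is fixed by Frobenius and therefore lies in
`E`, and projects along `σ` to that symmetric function (`PhiNModule.exists_trace_eq_esymm`). For `η`
the scalar is the one on `π` by construction, and the twist changes it by an `r`-th power because
every coset in the double coset has determinant of valuation `r` (`actsByScalar_twistDet_eta`). -/

namespace IwahoriLL

/-! ### The normalized valuation -/

section Valuation

variable {F : Type u} [Field F] [ValuativeRel F] [TopologicalSpace F]
  [IsNonarchimedeanLocalField F]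

/-- The normalized additive valuation as a function on `F`, with value `0` at `0`. -/
noncomputable def vord (x : F) : ℤ :=
  -WithZero.log (IsNonarchimedeanLocalField.valueGroupWithZeroIsoInt F (valuation F x))

theorem ord_eq_vord (x : Fˣ) : ord x = vord (x : F) := rfl

theorem iso_valuation_ne_zero {x : F} (hx : x ≠ 0) :
    IsNonarchimedeanLocalField.valueGroupWithZeroIsoInt F (valuation F x) ≠ 0 := by
  rwa [map_ne_zero, map_ne_zero]

theorem vord_mul {x y : F} (hx : x ≠ 0) (hy : y ≠ 0) : vord (x * y) = vord x + vord y := by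
  simp only [vord, map_mul]
  rw [WithZero.log_mul (iso_valuation_ne_zero hx) (iso_valuation_ne_zero hy)]
  ring

@[simp] theorem vord_one : vord (1 : F) = 0 := by simp [vord]

theorem vord_prod {ι : Type*} (s : Finset ι) (f : ι → F) (h : ∀ i ∈ s, f i ≠ 0) :
    vord (∏ i ∈ s, f i) = ∑ i ∈ s, vord (f i) := by
  classical
  induction s using Finset.induction_on with
  | empty => simp
  | insert a s ha ih =>
    rw [Finset.prod_insert ha, Finset.sum_insert ha, vord_mul (h a (by simp))
      (Finset.prod_ne_zero_iff.mpr fun i hi => h i (by simp [hi])),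
      ih fun i hi => h i (by simp [hi])]

theorem vord_le_vord {x y : F} (hx : x ≠ 0) (hy : y ≠ 0) :
    vord x ≤ vord y ↔ valuation F y ≤ valuation F x := by
  rw [vord, vord, neg_le_neg_iff, WithZero.log_le_log (iso_valuation_ne_zero hy)
    (iso_valuation_ne_zero hx)]
  exact (IsNonarchimedeanLocalField.valueGroupWithZeroIsoInt F).map_le_map_iff'

theorem vord_nonneg {x : F} (hx : x ≠ 0) : 0 ≤ vord x ↔ valuation F x ≤ 1 := by
  rw [← vord_one (F := F), vord_le_vord one_ne_zero hx, map_one]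

theorem vord_eq_zero {x : F} (hx : x ≠ 0) : vord x = 0 ↔ valuation F x = 1 := by
  rw [← vord_one (F := F), le_antisymm_iff, vord_le_vord one_ne_zero hx,
    vord_le_vord hx one_ne_zero, map_one, ← le_antisymm_iff, eq_comm]

theorem vord_pos {x : F} (hx : x ≠ 0) : 0 < vord x ↔ valuation F x < 1 := by
  rw [lt_iff_le_and_ne, vord_nonneg hx, lt_iff_le_and_ne, ne_comm, Ne, vord_eq_zero hx]

theorem vord_inv {x : F} (hx : x ≠ 0) : vord x⁻¹ = -vord x := by
  have := vord_mul hx (inv_ne_zero hx)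
  rw [mul_inv_cancel₀ hx, vord_one] at this
  linarith

theorem vord_pow {x : F} (hx : x ≠ 0) (m : ℕ) : vord (x ^ m) = m * vord x := by
  rw [← Fin.prod_const, vord_prod _ _ fun _ _ => hx]
  simp

/-- An element of positive valuation is divisible by a uniformizer. -/
theorem dvd_of_valuation_lt_one {ϖ x : F} (hϖ0 : ϖ ≠ 0) (hϖ : vord ϖ = 1)
    (hx : valuation F x < 1) : valuation F (ϖ⁻¹ * x) ≤ 1 := by
  by_cases h0 : x = 0
  · simp [h0]
  rw [← vord_nonneg (mul_ne_zero (inv_ne_zero hϖ0) h0), vord_mul (inv_ne_zero hϖ0) h0,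
    vord_inv hϖ0, hϖ]
  have := (vord_pos h0).mpr hx
  linarith

theorem residue_eq_zero_iff_valuation (x : 𝒪[F]) :
    IsLocalRing.residue 𝒪[F] x = 0 ↔ valuation F (x : F) < 1 := by
  rw [IsLocalRing.residue_eq_zero_iff]
  exact (Valuation.mem_maximalIdeal_iff (v := valuation F) ..)

theorem isUnit_iff_valuation (x : 𝒪[F]) : IsUnit x ↔ valuation F (x : F) = 1 := by
  rw [← not_iff_not, ← mem_nonunits_iff, ← IsLocalRing.mem_maximalIdeal,
    ← IsLocalRing.residue_eq_zero_iff, residue_eq_zero_iff_valuation]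
  exact ⟨fun h => h.ne, fun h => lt_of_le_of_ne x.2 h⟩

end Valuation

/-! ### Integral matrices and the Iwahori subgroup -/

section IntegralGroup

variable (F : Type u) [Field F] [ValuativeRel F] [TopologicalSpace F]
  [IsNonarchimedeanLocalField F] (ι : Type) [Fintype ι] [DecidableEq ι]

/-- The group `GL(𝒪_F)` for an arbitrary finite set of indices. -/
noncomputable def intGL : Subgroup (GL ι F) :=
  (Matrix.GeneralLinearGroup.map (algebraMap 𝒪[F] F)).range

variable {F ι}

theorem mem_intGL_of_eq {g : GL ι F} (A : Matrix ι ι 𝒪[F]) (hA : IsUnit A.det)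
    (h : (g : Matrix ι ι F) = A.map (algebraMap 𝒪[F] F)) : g ∈ intGL F ι := by
  refine ⟨Matrix.nonsingInvUnit A hA, Units.ext ?_⟩
  rw [h]
  rfl

/-- By Cramer's rule a unit determinant makes the inverse integral, so no condition on the entries
of `g⁻¹` has to be checked. -/
theorem mem_intGL_iff {g : GL ι F} : g ∈ intGL F ι ↔
    (∀ i j, valuation F ((g : Matrix ι ι F) i j) ≤ 1) ∧
      valuation F (g : Matrix ι ι F).det = 1 := by
  constructor
  · rintro ⟨x, rfl⟩
    refine ⟨fun i j => (x.val i j).2, ?_⟩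
    have h : ((Matrix.GeneralLinearGroup.map (algebraMap 𝒪[F] F) x : GL ι F) :
        Matrix ι ι F).det = ((x.val.det : 𝒪[F]) : F) :=
      ((algebraMap 𝒪[F] F).map_det x.val).symm
    rw [h]
    exact (isUnit_iff_valuation _).mp ((Matrix.isUnit_iff_isUnit_det _).mp x.isUnit)
  · rintro ⟨h, hd⟩
    let A : Matrix ι ι 𝒪[F] := Matrix.of fun i j => ⟨_, h i j⟩
    have hA : A.map (algebraMap 𝒪[F] F) = g.val := rfl
    refine mem_intGL_of_eq A ?_ hA.symm
    rw [isUnit_iff_valuation, ← hd, ← hA]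
    exact congrArg (valuation F) ((algebraMap 𝒪[F] F).map_det A)

theorem t2Space : T2Space F := by
  let := IsTopologicalAddGroup.rightUniformSpace F
  have := isUniformAddGroup_of_addCommGroup (G := F)
  infer_instance

theorem isCompact_intGL : IsCompact (intGL F ι : Set (GL ι F)) := by
  have hc : Continuous (Matrix.GeneralLinearGroup.map (n := ι) (algebraMap 𝒪[F] F)) := by
    refine Continuous.units_map _ ?_
    exact continuous_id.matrix_map continuous_subtype_val
  have : T2Space F := t2Space
  have : CompactSpace (Matrix ι ι 𝒪[F]) := inferInstanceAs (CompactSpace (ι → ι → 𝒪[F]))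
  have : T1Space (Matrix ι ι 𝒪[F]) := inferInstanceAs (T1Space (ι → ι → 𝒪[F]))
  have : CompactSpace (GL ι 𝒪[F]) := inferInstanceAs (CompactSpace (Matrix ι ι 𝒪[F])ˣ)
  rw [intGL, MonoidHom.coe_range]
  exact isCompact_range hc

theorem mem_iwahori_iff {n : ℕ} {g : GL (Fin n) F} : g ∈ iwahori F n ↔
    g ∈ maxCompact F n ∧ ∀ i j, j < i → valuation F ((g : Matrix (Fin n) (Fin n) F) i j) < 1 := by
  constructor
  · rintro ⟨x, hx, rfl⟩
    refine ⟨⟨x, rfl⟩, fun i j hij => ?_⟩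
    exact (residue_eq_zero_iff_valuation (x.val i j)).mp (hx hij)
  · rintro ⟨⟨x, rfl⟩, h⟩
    exact ⟨x, fun i j hij => (residue_eq_zero_iff_valuation (x.val i j)).mpr (h i j hij), rfl⟩

theorem iwahori_le_maxCompact {n : ℕ} : iwahori F n ≤ maxCompact F n :=
  fun _ hg => (mem_iwahori_iff.mp hg).1

theorem isOpen_iwahori {n : ℕ} : IsOpen (iwahori F n : Set (GL (Fin n) F)) := by
  have h : (iwahori F n : Set (GL (Fin n) F)) = (maxCompact F n : Set (GL (Fin n) F)) ∩
      ⋂ i, ⋂ j, ⋂ (_ : j < i), {g : GL (Fin n) F |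
        valuation F ((g : Matrix (Fin n) (Fin n) F) i j) < 1} := by
    ext g
    simp [mem_iwahori_iff]
  rw [h]
  refine isOpen_maxCompact.inter ?_
  refine isOpen_iInter_of_finite fun i => isOpen_iInter_of_finite fun j =>
    isOpen_iInter_of_finite fun _ => ?_
  have hO : IsOpen {x : F | valuation F x < 1} := by
    simp_rw [← (valuation F).restrict_lt_one_iff]
    exact Valuation.isOpen_ball 1
  exact hO.preimage ((Units.continuous_val).matrix_elem i j)

end IntegralGroup

/-! ### Finiteness from compactness -/

section Finiteness

/-- A compact subgroup has finite orbits on a set on which the stabilizers are open. -/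
theorem finite_orbit_of_compact {G X : Type*} [Group G] [TopologicalSpace G] [IsTopologicalGroup G]
    [MulAction G X] {S : Subgroup G} (hS : IsCompact (S : Set G)) (x : X)
    {U : Subgroup G} (hU : IsOpen (U : Set G)) (hx : ∀ u ∈ U, u • x = x) :
    (MulAction.orbit S x).Finite := by
  obtain ⟨t, ht⟩ := hS.elim_finite_subcover (fun g : G => (fun y => g⁻¹ * y) ⁻¹' (U : Set G))
    (fun g => hU.preimage (by fun_prop)) fun g _ => Set.mem_iUnion.mpr ⟨g, by simp [U.one_mem]⟩
  refine (t.finite_toSet.image fun g => g • x).subset ?_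
  rintro _ ⟨⟨g, hg⟩, rfl⟩
  obtain ⟨g', hg', h⟩ := Set.mem_iUnion₂.mp (ht hg)
  refine ⟨g', hg', ?_⟩
  have := hx _ h
  rw [mul_smul] at this
  change g' • x = g • x
  conv_lhs => rw [← this, smul_inv_smul]

/-- The quotient embeds into the `S`-orbit of the base point of `G ⧸ U`, which is finite since the
open subgroup `U` fixes that point. -/
theorem finite_quotient_of_compact {G : Type*} [Group G] [TopologicalSpace G]
    [IsTopologicalGroup G] {S U : Subgroup G} (hS : IsCompact (S : Set G))
    (hU : IsOpen (U : Set G)) : Finite (S ⧸ U.subgroupOf S) := by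
  have h := finite_orbit_of_compact hS ((1 : G) : G ⧸ U) hU (fun u hu => by
    change ((u * 1 : G) : G ⧸ U) = _
    rw [mul_one]
    exact (QuotientGroup.eq.mpr (by simpa using hu)).symm)
  have : Finite (MulAction.orbit S ((1 : G) : G ⧸ U)) := h.to_subtype
  refine Finite.of_injective (β := MulAction.orbit S ((1 : G) : G ⧸ U))
    (fun s => ⟨(s.out : G), s.out, by
      change (((s.out : G) * 1 : G) : G ⧸ U) = _
      rw [mul_one]⟩) ?_
  intro a b hab
  have h' : ((a.out : G) : G ⧸ U) = ((b.out : G) : G ⧸ U) := congrArg Subtype.val hab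
  have h'' : (a.out : G)⁻¹ * (b.out : G) ∈ U := QuotientGroup.eq.mp h'
  rw [← a.out_eq', ← b.out_eq']
  exact QuotientGroup.eq.mpr h''

end Finiteness

/-! ### The Iwasawa decomposition and its exponents -/

section Iwasawa

variable {F : Type u} [Field F] [ValuativeRel F] [TopologicalSpace F]
  [IsNonarchimedeanLocalField F] {n : ℕ}

/-- The permutation matrix whose right multiplication permutes columns. -/
noncomputable def permGL (F : Type u) [Field F] {n : ℕ} (w : Equiv.Perm (Fin n)) :
    GL (Fin n) F :=
  Matrix.GeneralLinearGroup.mkOfDetNeZero ((1 : Matrix (Fin n) (Fin n) F).submatrix id w) (by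
    rw [Matrix.det_permute', Matrix.det_one, mul_one]
    rcases Int.units_eq_one_or (Equiv.Perm.sign w) with h | h <;> simp [h])

theorem mul_permGL_apply (A : Matrix (Fin n) (Fin n) F) (w : Equiv.Perm (Fin n)) (i j : Fin n) :
    (A * (permGL F w : Matrix (Fin n) (Fin n) F)) i j = A i (w j) := by
  change (A * (1 : Matrix (Fin n) (Fin n) F).submatrix id w) i j = _
  rw [Matrix.mul_apply]
  simp [Matrix.one_apply]

theorem permGL_mem (w : Equiv.Perm (Fin n)) : permGL F w ∈ maxCompact F n := by
  refine (mem_intGL_iff (ι := Fin n)).mpr ⟨fun i j => ?_, ?_⟩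
  · change valuation F (((1 : Matrix (Fin n) (Fin n) F).submatrix id w) i j) ≤ 1
    rw [Matrix.submatrix_apply, Matrix.one_apply]
    split_ifs <;> simp
  · change valuation F ((1 : Matrix (Fin n) (Fin n) F).submatrix id w).det = 1
    rw [Matrix.det_permute', Matrix.det_one, mul_one]
    rcases Int.units_eq_one_or (Equiv.Perm.sign w) with h | h <;> simp [h]

/-- The matrix that differs from the identity in the entries left of the diagonal of row `i₀`. -/
theorem exists_row_operation (i₀ : Fin n) (c : Fin n → F) (hc : ∀ j < i₀, valuation F (c j) ≤ 1) :
    ∃ k ∈ maxCompact F n, ∀ (A : Matrix (Fin n) (Fin n) F) (i j : Fin n),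
      (A * (k : Matrix (Fin n) (Fin n) F)) i j = A i j + if j < i₀ then A i i₀ * c j else 0 := by
  let U : Matrix (Fin n) (Fin n) F :=
    1 + Matrix.of fun i j => if i = i₀ ∧ j < i₀ then c j else 0
  have hU : U.det = 1 := by
    rw [Matrix.det_of_isLowerTriangular]
    · refine Finset.prod_eq_one fun i _ => ?_
      have : ¬ (i = i₀ ∧ i < i₀) := by rintro ⟨rfl, h⟩; exact lt_irrefl _ h
      simp [U, this]
    · intro i j hij
      have hij' : i < j := hij
      have : ¬ (i = i₀ ∧ j < i₀) := by rintro ⟨rfl, h⟩; exact lt_asymm h hij'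
      simp [U, this, hij'.ne]
  refine ⟨Matrix.GeneralLinearGroup.mkOfDetNeZero U (by simp [hU]), ?_, fun A i j => ?_⟩
  · refine (mem_intGL_iff (ι := Fin n)).mpr ⟨fun i j => ?_, ?_⟩
    · change valuation F (U i j) ≤ 1
      refine (Valuation.map_add _ _ _).trans (max_le ?_ ?_)
      · rw [Matrix.one_apply]
        split_ifs <;> simp
      · rw [Matrix.of_apply]
        split_ifs with h
        · exact hc j h.2
        · simp
    · change valuation F U.det = 1
      rw [hU, map_one]
  · change (A * U) i j = _
    rw [mul_add, mul_one, Matrix.add_apply, Matrix.mul_apply]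
    congr 1
    by_cases h : j < i₀ <;> simp [h]

/-- Column elimination, with `m` counting the rows already cleared from the bottom. In the next row
`i₀` the pivot is an entry of largest absolute value among the columns up to `i₀`, so that the
quotients used to clear the row are integral. -/
theorem exists_mul_upperTriangular (g : GL (Fin n) F) (m : ℕ) : ∃ k ∈ maxCompact F n,
    ∀ i j : Fin n, n ≤ i + m → j < i →
      ((g * k : GL (Fin n) F) : Matrix (Fin n) (Fin n) F) i j = 0 := by
  induction m with
  | zero => exact ⟨1, one_mem _, fun i j hi => absurd hi (by have := i.2; omega)⟩
  | succ m ih =>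
    obtain ⟨k, hk, h⟩ := ih
    by_cases hm : n ≤ m
    · exact ⟨k, hk, fun i j _ => h i j (by omega)⟩
    obtain ⟨i₀, hi₀⟩ : ∃ i₀ : Fin n, (i₀ : ℕ) + (m + 1) = n :=
      ⟨⟨n - (m + 1), by omega⟩, by simp only; omega⟩
    set A : Matrix (Fin n) (Fin n) F := ((g * k : GL (Fin n) F) : Matrix (Fin n) (Fin n) F) with hA
    obtain ⟨j₀, hj₀, hmax⟩ := Finset.exists_max_image (Finset.Iic i₀)
      (fun j => valuation F (A i₀ j)) ⟨i₀, by simp⟩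
    rw [Finset.mem_Iic] at hj₀
    by_cases h0 : A i₀ j₀ = 0
    · refine ⟨k, hk, fun i j hi hj => ?_⟩
      by_cases hii : i = i₀
      · subst hii
        have := hmax j (by simpa using hj.le)
        rw [h0, map_zero, le_zero_iff, map_eq_zero] at this
        exact this
      · refine h i j ?_ hj
        have : (i : ℕ) ≠ i₀ := fun h => hii (Fin.ext h)
        omega
    · let w := Equiv.swap i₀ j₀
      have hw : ∀ j, j ≤ i₀ → w j ≤ i₀ := by
        intro j hj
        by_cases h1 : j = i₀
        · subst h1; simpa [w] using hj₀
        by_cases h2 : j = j₀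
        · subst h2; simp [w]
        · simpa [w, Equiv.swap_apply_of_ne_of_ne h1 h2] using hj
      obtain ⟨k', hk', hop⟩ := exists_row_operation i₀ (fun j => -(A i₀ (w j) / A i₀ j₀))
        (fun j hj => by
          rw [Valuation.map_neg, map_div₀]
          refine div_le_one_of_le₀ (hmax _ ?_) zero_le
          simpa using hw j hj.le)
      refine ⟨k * permGL F w * k', mul_mem (mul_mem hk (permGL_mem w)) hk', fun i j hi hj => ?_⟩
      rw [← mul_assoc, ← mul_assoc, Units.val_mul, hop, Units.val_mul, ← hA, mul_permGL_apply,
        mul_permGL_apply]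
      by_cases hii : i = i₀
      · subst hii
        rw [if_pos hj]
        simp only [w, Equiv.swap_apply_left]
        field_simp
        ring
      · have hi' : n ≤ i + m := by
          have : (i : ℕ) ≠ i₀ := fun h => hii (Fin.ext h)
          omega
        have hlt : i₀ < i := by
          rw [Fin.lt_def]
          omega
        -- The operations only combine columns up to `i₀`, and these vanish in the rows already
        -- cleared.
        have hz : ∀ j, j ≤ i₀ → A i j = 0 := fun j hj => h i j hi' (hj.trans_lt hlt)
        have hz' : A i (w j) = 0 := by
          by_cases hjj : j ≤ i₀
          · exact hz _ (hw j hjj)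
          · have h1 : j ≠ i₀ := fun h => hjj h.le
            have h2 : j ≠ j₀ := fun h => hjj (h ▸ hj₀)
            simp only [w, Equiv.swap_apply_of_ne_of_ne h1 h2]
            exact h i j hi' hj
        rw [hz', hz _ (hw _ le_rfl)]
        simp

/-- The Iwasawa decomposition. -/
theorem exists_iwasawa (g : GL (Fin n) F) :
    ∃ b ∈ borel F n, ∃ k ∈ maxCompact F n, g = b * k := by
  obtain ⟨k, hk, h⟩ := exists_mul_upperTriangular g n
  exact ⟨g * k, fun i j hij => h i j (by omega) hij, k⁻¹, inv_mem hk, by group⟩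

theorem borel_diag_ne_zero {b : GL (Fin n) F} (hb : b ∈ borel F n) (i : Fin n) :
    (b : Matrix (Fin n) (Fin n) F) i i ≠ 0 := by
  have h : (b : Matrix (Fin n) (Fin n) F).det ≠ 0 :=
    (Matrix.isUnit_iff_isUnit_det _).mp b.isUnit |>.ne_zero
  rw [Matrix.det_of_isUpperTriangular hb, Finset.prod_ne_zero_iff] at h
  exact h i (Finset.mem_univ i)

theorem borel_mul_diag {R : Type*} [CommRing R] {x y : Matrix (Fin n) (Fin n) R}
    (hx : x.IsUpperTriangular) (hy : y.IsUpperTriangular) (i : Fin n) :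
    (x * y) i i = x i i * y i i := by
  rw [Matrix.mul_apply, Finset.sum_eq_single i]
  · intro j _ hj
    rcases lt_or_gt_of_ne hj with h | h
    · rw [hx h, zero_mul]
    · rw [hy h, mul_zero]
  · simp

/-- The valuations of the diagonal entries. -/
noncomputable def diagOrd (b : GL (Fin n) F) (i : Fin n) : ℤ :=
  vord ((b : Matrix (Fin n) (Fin n) F) i i)

theorem diagOrd_mul {b b' : GL (Fin n) F} (hb : b ∈ borel F n) (hb' : b' ∈ borel F n) :
    diagOrd (b * b') = diagOrd b + diagOrd b' := by
  ext i
  simp only [diagOrd, Pi.add_apply, Units.val_mul]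
  rw [borel_mul_diag hb hb', vord_mul (borel_diag_ne_zero hb i) (borel_diag_ne_zero hb' i)]

theorem diagOrd_one : diagOrd (1 : GL (Fin n) F) = 0 := by
  ext i
  simp [diagOrd]

theorem diagOrd_inv {b : GL (Fin n) F} (hb : b ∈ borel F n) : diagOrd b⁻¹ = -diagOrd b := by
  have := diagOrd_mul hb (inv_mem hb)
  rw [mul_inv_cancel, diagOrd_one] at this
  exact (neg_eq_of_add_eq_zero_right this.symm).symm

/-- The diagonal entries of `b` and of `b⁻¹` are integral and inverse to each other, hence units. -/
theorem diagOrd_eq_zero {b : GL (Fin n) F} (hb : b ∈ borel F n) (hK : b ∈ maxCompact F n) :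
    diagOrd b = 0 := by
  have key : ∀ x : GL (Fin n) F, x ∈ borel F n → x ∈ maxCompact F n → 0 ≤ diagOrd x :=
    fun x hx hxK i => (vord_nonneg (borel_diag_ne_zero hx i)).mpr
      (((mem_intGL_iff (ι := Fin n)).mp hxK).1 i i)
  have h := key _ (inv_mem hb) (inv_mem hK)
  rw [diagOrd_inv hb] at h
  exact le_antisymm (neg_nonneg.mp h) (key _ hb hK)

/-- The triangular factor of a chosen Iwasawa decomposition. -/
noncomputable def iwasawaB (g : GL (Fin n) F) : GL (Fin n) F := (exists_iwasawa g).choose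

theorem iwasawaB_mem (g : GL (Fin n) F) : iwasawaB g ∈ borel F n :=
  (exists_iwasawa g).choose_spec.1

/-- The integral factor of a chosen Iwasawa decomposition. -/
noncomputable def iwasawaK (g : GL (Fin n) F) : GL (Fin n) F := (iwasawaB g)⁻¹ * g

theorem iwasawaK_mem (g : GL (Fin n) F) : iwasawaK g ∈ maxCompact F n := by
  obtain ⟨k, hk, h⟩ := (exists_iwasawa g).choose_spec.2
  have : iwasawaK g = k := by
    rw [iwasawaK, inv_mul_eq_iff_eq_mul]
    exact h
  rwa [this]

theorem iwasawa_mul (g : GL (Fin n) F) : iwasawaB g * iwasawaK g = g := by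
  rw [iwasawaK, mul_inv_cancel_left]

/-- The Iwasawa exponents of `g`: the valuations of the diagonal entries of `b` if `g = b k`. -/
noncomputable def height (g : GL (Fin n) F) : Fin n → ℤ := diagOrd (iwasawaB g)

/-- Two triangular factors of `g` differ by an element of `borel F n ∩ maxCompact F n`, whose
diagonal entries are units; so the exponents do not depend on the chosen decomposition. -/
theorem height_eq {g b k : GL (Fin n) F} (hb : b ∈ borel F n) (hk : k ∈ maxCompact F n)
    (h : g = b * k) : height g = diagOrd b := by
  have h1 : b⁻¹ * iwasawaB g = k * (iwasawaK g)⁻¹ := by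
    rw [inv_mul_eq_iff_eq_mul, ← mul_assoc, eq_mul_inv_iff_mul_eq, iwasawa_mul, h]
  have h2 := diagOrd_eq_zero (mul_mem (inv_mem hb) (iwasawaB_mem g))
    (h1 ▸ mul_mem hk (inv_mem (iwasawaK_mem g)))
  rw [diagOrd_mul (inv_mem hb) (iwasawaB_mem g), diagOrd_inv hb, neg_add_eq_zero] at h2
  exact h2.symm

theorem height_borel_mul {b : GL (Fin n) F} (hb : b ∈ borel F n) (g : GL (Fin n) F) :
    height (b * g) = diagOrd b + height g := by
  rw [height_eq (mul_mem hb (iwasawaB_mem g)) (iwasawaK_mem g)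
    (by rw [mul_assoc, iwasawa_mul]), diagOrd_mul hb (iwasawaB_mem g), height]

theorem height_mul_maxCompact (g : GL (Fin n) F) {k : GL (Fin n) F} (hk : k ∈ maxCompact F n) :
    height (g * k) = height g := by
  rw [height_eq (iwasawaB_mem g) (mul_mem (iwasawaK_mem g) hk)
    (by rw [← mul_assoc, iwasawa_mul]), height]

theorem height_of_borel {b : GL (Fin n) F} (hb : b ∈ borel F n) : height b = diagOrd b :=
  height_eq hb (one_mem _) (mul_one b).symm

end Iwasawa

/-! ### Iwasawa exponents, minors and a regular torus element -/

section Torus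

variable {F : Type u} [Field F] [ValuativeRel F] [TopologicalSpace F]
  [IsNonarchimedeanLocalField F] {n : ℕ}

/-- The diagonal matrix with entries `x i`. -/
def torusGL (x : Fin n → Fˣ) : GL (Fin n) F :=
  Units.map (Matrix.diagonalRingHom (Fin n) F).toMonoidHom (MulEquiv.piUnits.symm x)

theorem torusGL_val (x : Fin n → Fˣ) :
    (torusGL x : Matrix (Fin n) (Fin n) F) = Matrix.diagonal fun i => (x i : F) := rfl

theorem torusGL_mem (x : Fin n → Fˣ) : torusGL x ∈ borel F n :=
  Matrix.blockTriangular_diagonal _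

theorem diagOrd_torusGL (x : Fin n → Fˣ) (i : Fin n) : diagOrd (torusGL x) i = ord (x i) := by
  simp [diagOrd, torusGL_val, ord_eq_vord]

theorem vord_det_maxCompact {k : GL (Fin n) F} (hk : k ∈ maxCompact F n) :
    vord (k : Matrix (Fin n) (Fin n) F).det = 0 :=
  (vord_eq_zero ((Matrix.isUnit_iff_isUnit_det _).mp k.isUnit).ne_zero).mpr
    ((mem_intGL_iff (ι := Fin n)).mp hk).2

theorem sum_height (g : GL (Fin n) F) :
    ∑ i, height g i = vord (g : Matrix (Fin n) (Fin n) F).det := by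
  have h : ∀ g : GL (Fin n) F, (g : Matrix (Fin n) (Fin n) F).det ≠ 0 :=
    fun g => ((Matrix.isUnit_iff_isUnit_det _).mp g.isUnit).ne_zero
  conv_rhs => rw [← iwasawa_mul g]
  rw [Units.val_mul, Matrix.det_mul, vord_mul (h _) (h _), vord_det_maxCompact (iwasawaK_mem g),
    add_zero, Matrix.det_of_isUpperTriangular (iwasawaB_mem g),
    vord_prod _ _ fun i _ => borel_diag_ne_zero (iwasawaB_mem g) i]
  rfl

theorem valuation_mul_apply_le {m : Type*} [Fintype m] {A B : Matrix m m F}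
    (hA : ∀ i j, valuation F (A i j) ≤ 1) (hB : ∀ i j, valuation F (B i j) ≤ 1) (i j : m) :
    valuation F ((A * B) i j) ≤ 1 := by
  rw [Matrix.mul_apply]
  refine Valuation.map_sum_le _ fun l _ => ?_
  rw [map_mul]
  exact mul_le_one' (hA i l) (hB l j)

theorem valuation_det_le {m : Type*} [Fintype m] [DecidableEq m] {A : Matrix m m F}
    (hA : ∀ i j, valuation F (A i j) ≤ 1) : valuation F A.det ≤ 1 := by
  let A' : Matrix m m 𝒪[F] := Matrix.of fun i j => ⟨_, hA i j⟩
  have h : A.det = ((A'.det : 𝒪[F]) : F) := ((algebraMap 𝒪[F] F).map_det A').symm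
  rw [h]
  exact A'.det.2

theorem height_nonneg {g : GL (Fin n) F}
    (hg : ∀ i j, valuation F ((g : Matrix (Fin n) (Fin n) F) i j) ≤ 1) (i : Fin n) :
    0 ≤ height g i := by
  refine (vord_nonneg (borel_diag_ne_zero (iwasawaB_mem g) i)).mpr ?_
  have h : iwasawaB g = g * (iwasawaK g)⁻¹ := by rw [eq_mul_inv_iff_mul_eq, iwasawa_mul]
  rw [h, Units.val_mul]
  exact valuation_mul_apply_le hg
    ((mem_intGL_iff (ι := Fin n)).mp (inv_mem (iwasawaK_mem g))).1 i i

theorem sum_eq_sum_subtype {ι M : Type*} [Fintype ι] [AddCommMonoid M] (p : ι → Prop)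
    [DecidablePred p] (f : ι → M) (h : ∀ i, ¬ p i → f i = 0) :
    ∑ i, f i = ∑ i : {i // p i}, f i := by
  rw [← Fintype.sum_subtype_add_sum_subtype p f, Finset.sum_eq_zero (s := Finset.univ)
    (f := fun i : {i // ¬ p i} => f i) fun i _ => h i i.2, add_zero]

/-- The rows of `b` from `m` on vanish in the columns before `m`, so the last rows of `b * k`
involve only the last rows of `k`. -/
theorem minor_mul {R : Type*} [CommRing R] {b k : Matrix (Fin n) (Fin n) R}
    (hb : b.IsUpperTriangular) (m : Fin n) (c : {l // m ≤ l} → Fin n) :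
    ((b * k).submatrix Subtype.val c).det =
      (∏ l : {l // m ≤ l}, b l l) * (k.submatrix Subtype.val c).det := by
  have hmul : (b * k).submatrix Subtype.val c =
      b.submatrix (Subtype.val : {l // m ≤ l} → Fin n) Subtype.val *
        k.submatrix Subtype.val c := by
    ext l l'
    rw [Matrix.submatrix_apply, Matrix.mul_apply, Matrix.mul_apply,
      sum_eq_sum_subtype (m ≤ ·) fun p => b l p * k p (c l')]
    · rfl
    · intro i hi
      rw [hb (lt_of_lt_of_le (not_le.mp hi) l.2), zero_mul]
  rw [hmul, Matrix.det_mul, Matrix.det_of_isUpperTriangular]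
  · rfl
  · intro i j hij
    exact hb hij

/-- A minor of the last rows of `g` bounds the last Iwasawa exponents. -/
theorem sum_height_le_minor (g : GL (Fin n) F) (m : Fin n) (c : {l // m ≤ l} → Fin n)
    (h0 : ((g : Matrix (Fin n) (Fin n) F).submatrix Subtype.val c).det ≠ 0) :
    ∑ l : {l // m ≤ l}, height g l ≤
      vord ((g : Matrix (Fin n) (Fin n) F).submatrix Subtype.val c).det := by
  have hg : (g : Matrix (Fin n) (Fin n) F) = (iwasawaB g : Matrix (Fin n) (Fin n) F) *
      (iwasawaK g : Matrix (Fin n) (Fin n) F) := by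
    rw [← Units.val_mul, iwasawa_mul]
  rw [hg, minor_mul (iwasawaB_mem g)] at h0 ⊢
  rw [vord_mul (left_ne_zero_of_mul h0) (right_ne_zero_of_mul h0),
    vord_prod Finset.univ (fun l : {l // m ≤ l} => (iwasawaB g : Matrix (Fin n) (Fin n) F) l l)
      fun l _ => borel_diag_ne_zero (iwasawaB_mem g) l]
  have := (vord_nonneg (right_ne_zero_of_mul h0)).mpr (valuation_det_le fun i j =>
    ((mem_intGL_iff (ι := Fin n)).mp (iwasawaK_mem g)).1 _ _)
  simp only [height, diagOrd]
  linarith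

/-- By `h`, a relation among the last rows that holds in the columns `c` holds in all columns.
Extended by zero it would be a relation among the rows of the invertible matrix `A`. -/
theorem minor_ne_zero {κ : Type*} [Field κ] {A : Matrix (Fin n) (Fin n) κ} (hA : A.det ≠ 0)
    (m : Fin n) (c : {l // m ≤ l} → Fin n)
    (h : ∀ x : {l // m ≤ l} → κ, (∀ l', ∑ l, x l * A l (c l') = 0) → ∀ j, ∑ l, x l * A l j = 0) :
    (A.submatrix Subtype.val c).det ≠ 0 := by
  intro hdet
  obtain ⟨x, hx0, hx⟩ := Matrix.exists_vecMul_eq_zero_iff.mpr hdet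
  refine hA (Matrix.exists_vecMul_eq_zero_iff.mp
    ⟨fun l => if h : m ≤ l then x ⟨l, h⟩ else 0, ?_, ?_⟩)
  · contrapose! hx0
    ext ⟨l, hl⟩
    simpa [hl] using congrFun hx0 l
  · ext j
    have hj := h x (fun l' => congrFun hx l') j
    refine Eq.trans ?_ hj
    simp only [Matrix.vecMul, dotProduct]
    rw [sum_eq_sum_subtype (m ≤ ·)]
    · refine Finset.sum_congr rfl fun l _ => ?_
      rw [dif_pos l.2]
    · intro i hi
      rw [dif_neg hi, zero_mul]

/-- The diagonal matrix with entries `ϖ ^ i`. -/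
def regularTorus (n : ℕ) (ϖ : Fˣ) : GL (Fin n) F := torusGL fun i => ϖ ^ (i : ℕ)

theorem ord_pow (x : Fˣ) (m : ℕ) : ord (x ^ m) = m * ord x := by
  rw [ord_eq_vord, Units.val_pow_eq_pow_val, vord_pow x.ne_zero, ord_eq_vord]

theorem height_regularTorus {ϖ : Fˣ} (hϖ : ord ϖ = 1) (i : Fin n) :
    height (regularTorus n ϖ) i = i := by
  rw [regularTorus, height_of_borel (torusGL_mem _), diagOrd_torusGL, ord_pow, hϖ, mul_one]

/-- The torus element multiplies column `j` by `ϖ ^ j`. A minor of `x` in the columns `c` that is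
nonzero modulo `ϖ` is a unit, so the scaled minor has valuation exactly the sum of the `c l`. -/
theorem sum_height_mul_regularTorus_le {ϖ : Fˣ} (hϖ : ord ϖ = 1) (x : GL (Fin n) 𝒪[F])
    (m : Fin n) (c : {l // m ≤ l} → Fin n)
    (h : ((x.val.map (IsLocalRing.residue 𝒪[F])).submatrix Subtype.val c).det ≠ 0) :
    ∑ l : {l // m ≤ l}, height (Matrix.GeneralLinearGroup.map (algebraMap 𝒪[F] F) x *
      regularTorus n ϖ) l ≤ ∑ l, (c l : ℤ) := by
  have hdet : ((((Matrix.GeneralLinearGroup.map (algebraMap 𝒪[F] F) x * regularTorus n ϖ :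
      GL (Fin n) F) : Matrix (Fin n) (Fin n) F)).submatrix Subtype.val c).det =
      (∏ l, (ϖ : F) ^ (c l : ℕ)) * (((x.val.submatrix Subtype.val c).det : 𝒪[F]) : F) := by
    have h1 : (((x.val.submatrix Subtype.val c).det : 𝒪[F]) : F) =
        ((x.val.submatrix Subtype.val c).map (algebraMap 𝒪[F] F)).det :=
      (algebraMap 𝒪[F] F).map_det _
    rw [h1, ← Matrix.det_mul_row]
    congr 1
    ext i j
    rw [Matrix.submatrix_apply, Units.val_mul, regularTorus, torusGL_val, Matrix.mul_diagonal,
      mul_comm]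
    simp
  have hu : valuation F (((x.val.submatrix Subtype.val c).det : 𝒪[F]) : F) = 1 := by
    rw [← isUnit_iff_valuation]
    by_contra hn
    refine h ?_
    rw [Matrix.submatrix_map]
    have := (IsLocalRing.residue 𝒪[F]).map_det (x.val.submatrix Subtype.val c)
    rw [RingHom.mapMatrix_apply] at this
    rw [← this, IsLocalRing.residue_eq_zero_iff]
    exact hn
  have hne : (((x.val.submatrix Subtype.val c).det : 𝒪[F]) : F) ≠ 0 := by
    intro h0
    rw [h0, map_zero] at hu
    exact zero_ne_one hu
  have hp : ∀ l ∈ (Finset.univ : Finset {l // m ≤ l}), (ϖ : F) ^ (c l : ℕ) ≠ 0 :=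
    fun l _ => pow_ne_zero _ ϖ.ne_zero
  refine (sum_height_le_minor _ m c ?_).trans (le_of_eq ?_)
  · rw [hdet]
    exact mul_ne_zero (Finset.prod_ne_zero_iff.mpr hp) hne
  · rw [hdet, vord_mul (Finset.prod_ne_zero_iff.mpr hp) hne, vord_prod _ _ hp,
      (vord_eq_zero hne).mpr hu, add_zero]
    refine Finset.sum_congr rfl fun l _ => ?_
    rw [vord_pow ϖ.ne_zero, ← ord_eq_vord, hϖ, mul_one]

theorem residue_det_ne_zero (x : GL (Fin n) 𝒪[F]) :
    (x.val.map (IsLocalRing.residue 𝒪[F])).det ≠ 0 := by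
  have := (IsLocalRing.residue 𝒪[F]).map_det x.val
  rw [RingHom.mapMatrix_apply] at this
  rw [← this]
  exact (((Matrix.isUnit_iff_isUnit_det _).mp x.isUnit).map (IsLocalRing.residue 𝒪[F])).ne_zero

theorem sum_subtype_le_split {M : Type*} [AddCommMonoid M] (m : Fin n) (f : Fin n → M) :
    ∑ l : {l // m ≤ l}, f l = f m + ∑ l ∈ Finset.Ioi m, f l := by
  rw [← Finset.sum_subtype (Finset.Ici m) (by simp) f, ← Finset.Ioi_insert,
    Finset.sum_insert (by simp)]

/-- If `k` is integral but not in the Iwahori subgroup, then the Iwasawa exponents of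
`k diag(1, ϖ, …, ϖ^(n-1))` are smaller than `(0, …, n-1)` for the lexicographic order
that gives priority to the last coordinates. -/
theorem exists_height_lt {ϖ : Fˣ} (hϖ : ord ϖ = 1) {k : GL (Fin n) F} (hk : k ∈ maxCompact F n)
    (hkI : k ∉ iwahori F n) : ∃ m : Fin n, height (k * regularTorus n ϖ) m < m ∧
      ∀ l, m < l → height (k * regularTorus n ϖ) l = l := by
  classical
  obtain ⟨x, rfl⟩ := id hk
  set A := x.val.map (IsLocalRing.residue 𝒪[F]) with hA
  have hAdet : A.det ≠ 0 := residue_det_ne_zero x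
  set h := height (Matrix.GeneralLinearGroup.map (algebraMap 𝒪[F] F) x * regularTorus n ϖ)
  have hviol : (Finset.univ.filter fun i => ∃ j < i, A i j ≠ 0).Nonempty := by
    by_contra hne
    rw [Finset.not_nonempty_iff_eq_empty, Finset.filter_eq_empty_iff] at hne
    refine hkI (mem_iwahori_iff.mpr ⟨hk, fun i j hij => ?_⟩)
    have := hne (Finset.mem_univ i)
    push Not at this
    exact (residue_eq_zero_iff_valuation (x.val i j)).mp (this j hij)
  -- `i₀` is the last row in which the reduction of `k` fails to be upper triangular, and `j₀` is
  -- the column of a nonzero entry to the left of the diagonal there.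
  obtain ⟨i₀, hi₀, hmax⟩ := Finset.exists_max_image _ id hviol
  simp only [Finset.mem_filter, Finset.mem_univ, true_and, id] at hi₀ hmax
  obtain ⟨j₀, hj₀, hne⟩ := hi₀
  have hz : ∀ i, i₀ < i → ∀ j < i, A i j = 0 := by
    intro i hi j hj
    by_contra h
    exact absurd (hmax i ⟨j, hj, h⟩) (not_le.mpr hi)
  -- Below row `i₀` the reduction is upper triangular, so the trailing principal minors are nonzero.
  have hle : ∀ m, i₀ < m → ∑ l : {l // m ≤ l}, (h l - (l : ℤ)) ≤ 0 := by
    intro m hm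
    rw [Finset.sum_sub_distrib, sub_nonpos]
    refine sum_height_mul_regularTorus_le hϖ x m (fun l => l) (minor_ne_zero hAdet m _ ?_)
    intro y hy j
    by_cases hj : m ≤ j
    · exact hy ⟨j, hj⟩
    · refine Finset.sum_eq_zero fun l _ => ?_
      rw [hz l (hm.trans_le l.2) j ((not_le.mp hj).trans_le l.2), mul_zero]
  -- Column `j₀` replaces column `i₀`. It vanishes in all later rows, so the minor stays nonzero,
  -- while the bound on the exponents drops because `j₀ < i₀`.
  have hlt : ∑ l : {l // i₀ ≤ l}, (h l - (l : ℤ)) < 0 := by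
    let c : {l // i₀ ≤ l} → Fin n := fun l => if (l : Fin n) = i₀ then j₀ else l
    rw [Finset.sum_sub_distrib, sub_neg]
    refine (sum_height_mul_regularTorus_le hϖ x i₀ c (minor_ne_zero hAdet i₀ _ ?_)).trans_lt ?_
    · intro y hy
      have hy0 : y ⟨i₀, le_rfl⟩ = 0 := by
        have := hy ⟨i₀, le_rfl⟩
        rw [Finset.sum_eq_single ⟨i₀, le_rfl⟩] at this
        · simpa [c, hne] using this
        · intro l _ hl
          have hl' : i₀ < l := lt_of_le_of_ne l.2 fun h => hl (Subtype.ext h.symm)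
          simp only [c, if_pos]
          rw [hz l hl' j₀ (hj₀.trans hl'), mul_zero]
        · simp
      intro j
      by_cases hj : i₀ < j
      · have := hy ⟨j, hj.le⟩
        simpa only [c, if_neg hj.ne'] using this
      · refine Finset.sum_eq_zero fun l _ => ?_
        by_cases hl : (l : Fin n) = i₀
        · have : l = ⟨i₀, le_rfl⟩ := Subtype.ext hl
          rw [this, hy0, zero_mul]
        · have hl' : i₀ < l := lt_of_le_of_ne l.2 (Ne.symm hl)
          rw [hz l hl' j ((not_lt.mp hj).trans_lt hl'), mul_zero]
    · refine Finset.sum_lt_sum (fun l _ => ?_) ⟨⟨i₀, le_rfl⟩, Finset.mem_univ _, ?_⟩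
      · by_cases hl : (l : Fin n) = i₀
        · simp only [c, if_pos hl]
          rw [hl]
          exact_mod_cast hj₀.le
        · simp only [c, if_neg hl]
          exact le_rfl
      · simp only [c, if_pos]
        exact_mod_cast hj₀
  -- At the last index `m ≥ i₀` with negative trailing sum, all later trailing sums vanish; their
  -- differences give equality beyond `m`, and the deficit sits at `m` itself.
  obtain ⟨m, hm, hmmax⟩ := Finset.exists_max_image
    (Finset.univ.filter fun m => i₀ ≤ m ∧ ∑ l : {l // m ≤ l}, (h l - (l : ℤ)) < 0) id
    ⟨i₀, by simpa using hlt⟩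
  simp only [Finset.mem_filter, Finset.mem_univ, true_and, id] at hm hmmax
  have heq : ∀ l, m < l → ∑ l' : {l' // l ≤ l'}, (h l' - (l' : ℤ)) = 0 := by
    intro l hl
    refine le_antisymm (hle l (hm.1.trans_lt hl)) (not_lt.mp fun hlt => ?_)
    exact absurd (hmmax l ⟨hm.1.trans hl.le, hlt⟩) (not_le.mpr hl)
  have htail : ∀ d : ℕ, ∀ l : Fin n, n - (l : ℕ) ≤ d → m < l → h l - (l : ℤ) = 0 := by
    intro d
    induction d with
    | zero => intro l hl; have := l.2; omega
    | succ d ih =>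
      intro l hl hml
      have := heq l hml
      rw [sum_subtype_le_split l fun l' => h l' - (l' : ℤ), Finset.sum_eq_zero, add_zero] at this
      · exact this
      · intro l' hl'
        rw [Finset.mem_Ioi] at hl'
        have h2 : (l : ℕ) < l' := hl'
        have := l.2
        exact ih l' (by omega) (hml.trans hl')
  refine ⟨m, ?_, fun l hl => sub_eq_zero.mp (htail n l (by omega) hl)⟩
  have := hm.2
  rw [sum_subtype_le_split m fun l' => h l' - (l' : ℤ), Finset.sum_eq_zero, add_zero] at this
  · exact sub_neg.mp this
  · intro l' hl'
    exact htail n l' (by omega) (Finset.mem_Ioi.mp hl')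

end Torus

/-! ### Sums over orbits in a coset space -/

section OrbitSum

variable {G : Type*} [Group G] {K S : Subgroup G}

theorem apply_out {C : Type*} {φ : G → C} (hφ : ∀ g, ∀ k ∈ K, φ (g * k) = φ g) (x g : G) :
    φ (x * (g : G ⧸ K).out) = φ (x * g) := by
  obtain ⟨k, hk⟩ := QuotientGroup.mk_out_eq_mul K g
  rw [hk, ← mul_assoc, hφ _ _ k.2]

theorem sum_orbit_translate {y₀ : G ⧸ K} (hfin : (MulAction.orbit S y₀).Finite)
    {C : Type*} [AddCommMonoid C] {φ : G → C} (hφ : ∀ g, ∀ k ∈ K, φ (g * k) = φ g) (x : G)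
    {s : G} (hs : s ∈ S) :
    ∑ y ∈ hfin.toFinset, φ (x * s * y.out) = ∑ y ∈ hfin.toFinset, φ (x * y.out) := by
  refine Finset.sum_equiv (MulAction.toPerm (⟨s, hs⟩ : S)) (fun y => ?_) fun y _ => ?_
  · simp only [Set.Finite.mem_toFinset, MulAction.toPerm_apply]
    rw [← MulAction.orbit_eq_iff, ← MulAction.orbit_eq_iff, MulAction.orbit_smul]
  · have h : MulAction.toPerm (⟨s, hs⟩ : S) y = ((s * y.out : G) : G ⧸ K) := by
      conv_lhs => rw [← y.out_eq']
      rfl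
    rw [h, apply_out hφ, mul_assoc]

end OrbitSum

/-! ### Unramified principal series and spherical vectors -/

section Spherical

variable {F : Type u} [Field F] [ValuativeRel F] [TopologicalSpace F]
  [IsNonarchimedeanLocalField F] {n : ℕ}

/-- The monomial `∏ X i ^ μ i`. -/
def monom {C : Type*} [Field C] (X : Fin n → Cˣ) (μ : Fin n → ℤ) : Cˣ := ∏ i, X i ^ μ i

theorem monom_add {C : Type*} [Field C] (X : Fin n → Cˣ) (μ ν : Fin n → ℤ) :
    monom X (μ + ν) = monom X μ * monom X ν := by
  simp [monom, zpow_add, Finset.prod_mul_distrib]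

theorem monom_zero {C : Type*} [Field C] (X : Fin n → Cˣ) : monom X 0 = 1 := by
  simp [monom]

/-- The spherical vector of an unramified principal series. -/
noncomputable def sph {C : Type*} [Field C] (X : Fin n → Cˣ) (g : GL (Fin n) F) : C :=
  (monom X (height g) : Cˣ)

/-- `f` belongs to the unnormalized unramified principal series with parameters `X`. -/
def IsPS {C : Type*} [Field C] (X : Fin n → Cˣ) (f : GL (Fin n) F → C) : Prop :=
  ∀ b ∈ borel F n, ∀ g, f (b * g) = (monom X (diagOrd b) : Cˣ) * f g

/-- `f` is right invariant under the Iwahori subgroup. -/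
def IwInv {M : Type*} (f : GL (Fin n) F → M) : Prop :=
  ∀ g, ∀ x ∈ iwahori F n, f (g * x) = f g

variable {C : Type*} [Field C] (X : Fin n → Cˣ)

theorem sph_isPS : IsPS X (sph X : GL (Fin n) F → C) := by
  intro b hb g
  rw [sph, height_borel_mul hb, monom_add, Units.val_mul, sph]

theorem sph_mul_maxCompact (g : GL (Fin n) F) (k : GL (Fin n) F) (hk : k ∈ maxCompact F n) :
    sph X (g * k) = sph X g := by
  rw [sph, height_mul_maxCompact g hk, sph]

variable {X}

/-- An element of a principal series is determined by its restriction to `GL_n(𝒪_F)`. -/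
theorem IsPS.ext {f f' : GL (Fin n) F → C} (hf : IsPS X f) (hf' : IsPS X f')
    (h : ∀ k ∈ maxCompact F n, f k = f' k) : f = f' := by
  ext g
  rw [← iwasawa_mul g, hf _ (iwasawaB_mem g), hf' _ (iwasawaB_mem g), h _ (iwasawaK_mem g)]

theorem IsPS.translate {f : GL (Fin n) F → C} (hf : IsPS X f) (y : GL (Fin n) F) :
    IsPS X fun g => f (g * y) := fun b hb g => by
  simp only [mul_assoc, hf b hb]

theorem IsPS.smul {f : GL (Fin n) F → C} (hf : IsPS X f) (c : C) :
    IsPS X fun g => c * f g := fun b hb g => by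
  simp only [hf b hb]
  ring

theorem IsPS.sum {ι : Type*} {s : Finset ι} {f : ι → GL (Fin n) F → C}
    (hf : ∀ i ∈ s, IsPS X (f i)) : IsPS X fun g => ∑ i ∈ s, f i g := fun b hb g => by
  rw [Finset.mul_sum]
  exact Finset.sum_congr rfl fun i hi => hf i hi b hb g

/-- The factorization of an Iwahori element into an upper triangular one and one that
reduces to the identity. -/
theorem exists_triangular_lift (x : GL (Fin n) 𝒪[F])
    (hx : x ∈ (borel 𝓀[F] n).comap
      (Matrix.GeneralLinearGroup.map (IsLocalRing.residue 𝒪[F]))) :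
    ∃ b : GL (Fin n) 𝒪[F], b.val.IsUpperTriangular ∧
      Matrix.GeneralLinearGroup.map (IsLocalRing.residue 𝒪[F]) b =
        Matrix.GeneralLinearGroup.map (IsLocalRing.residue 𝒪[F]) x := by
  let B : Matrix (Fin n) (Fin n) 𝒪[F] := Matrix.of fun i j => if j < i then 0 else x.val i j
  have hBt : B.IsUpperTriangular := fun i j hij => if_pos hij
  have hBr : B.map (IsLocalRing.residue 𝒪[F]) = x.val.map (IsLocalRing.residue 𝒪[F]) := by
    ext i j
    by_cases h : j < i
    · have h1 : (x.val.map (IsLocalRing.residue 𝒪[F])) i j = 0 := hx h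
      rw [h1]
      simp [B, h]
    · simp [B, h]
  have hdet : IsUnit B.det := by
    by_contra hn
    have h1 := (IsLocalRing.residue 𝒪[F]).map_det B
    rw [RingHom.mapMatrix_apply, hBr] at h1
    exact residue_det_ne_zero x (h1 ▸ (IsLocalRing.residue_eq_zero_iff _).mpr hn)
  exact ⟨Matrix.nonsingInvUnit B hdet, hBt, Units.ext hBr⟩

/-- The restriction to `GL_n(𝒪_F)` of an Iwahori invariant element of a principal series is
left invariant under the Iwahori subgroup as well. -/
theorem IsPS.iwahori_mul {f : GL (Fin n) F → C} (hf : IsPS X f) (hI : IwInv f)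
    {i k : GL (Fin n) F} (hi : i ∈ iwahori F n) (hk : k ∈ maxCompact F n) : f (i * k) = f k := by
  obtain ⟨x, hx, rfl⟩ := hi
  obtain ⟨κ, rfl⟩ := hk
  obtain ⟨b, hb, hbx⟩ := exists_triangular_lift x hx
  set ι := Matrix.GeneralLinearGroup.map (n := Fin n) (algebraMap 𝒪[F] F)
  set red := Matrix.GeneralLinearGroup.map (n := Fin n) (IsLocalRing.residue 𝒪[F])
  have hbB : ι b ∈ borel F n := fun i j hij => by
    change algebraMap 𝒪[F] F (b.val i j) = 0
    rw [hb hij, map_zero]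
  -- The factor `b⁻¹ * x` reduces to the identity. The matrices with this property form a normal
  -- subgroup of `GL_n(𝒪_F)` inside the Iwahori subgroup, so after conjugation by `κ` it is absorbed
  -- by the right invariance of `f`.
  have hdec : ι x * ι κ = ι b * (ι κ * ι (κ⁻¹ * (b⁻¹ * x) * κ)) := by
    rw [← map_mul, ← map_mul, ← map_mul]
    congr 1
    group
  rw [hdec, hf _ hbB, diagOrd_eq_zero hbB ⟨b, rfl⟩, monom_zero, Units.val_one, one_mul]
  refine hI _ _ ⟨_, ?_, rfl⟩
  change red (κ⁻¹ * (b⁻¹ * x) * κ) ∈ borel 𝓀[F] n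
  rw [map_mul, map_mul, map_mul, map_inv, map_inv, hbx]
  have : (red κ)⁻¹ * ((red x)⁻¹ * red x) * red κ = 1 := by group
  rw [this]
  exact one_mem _

end Spherical

/-! ### The spherical vector generates the Iwahori invariants for generic parameters -/

section Cyclic

variable {F : Type u} [Field F] [ValuativeRel F] [TopologicalSpace F]
  [IsNonarchimedeanLocalField F] {n : ℕ}

theorem sph_pos {X : Fin n → ℚˣ} (hX : ∀ i, 1 ≤ (X i : ℚ)) (g : GL (Fin n) F) : 0 < sph X g := by
  simp only [sph, monom, Units.coe_prod, Units.val_zpow_eq_zpow_val]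
  exact Finset.prod_pos fun i _ => zpow_pos (zero_lt_one.trans_le (hX i)) _

theorem prod_split {M : Type*} [CommMonoid M] (m : Fin n) (f : Fin n → M) :
    ∏ l, f l = (∏ l ∈ Finset.Iio m, f l) * (f m * ∏ l ∈ Finset.Ioi m, f l) := by
  rw [← Finset.prod_insert (by simp), Finset.Ioi_insert, ← Finset.prod_union]
  · congr 1
    ext l
    simp [lt_or_ge]
  · rw [Finset.disjoint_left]
    intro l h1 h2
    rw [Finset.mem_Iio] at h1
    rw [Finset.mem_Ici] at h2
    exact absurd h1 (not_lt.mpr h2)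

theorem valuation_mul_torus_le {ϖ : Fˣ} (hϖ : ord ϖ = 1) {k : GL (Fin n) F}
    (hk : k ∈ maxCompact F n) (i j : Fin n) :
    valuation F (((k * regularTorus n ϖ : GL (Fin n) F) : Matrix (Fin n) (Fin n) F) i j) ≤ 1 := by
  rw [Units.val_mul]
  refine valuation_mul_apply_le ((mem_intGL_iff (ι := Fin n)).mp hk).1 (fun i j => ?_) i j
  rw [regularTorus, torusGL_val, Matrix.diagonal_apply]
  split_ifs
  · rw [← vord_nonneg (Units.ne_zero _), ← ord_eq_vord, ord_pow, hϖ]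
    positivity
  · simp

/-- Outside the Iwahori subgroup the exponents drop at some place `m` and agree beyond it
(`exists_height_lt`). At least one factor `X m` is lost, and by `hXA` it outweighs `A` times
anything that the parameters before `m` can gain. -/
theorem mul_sph_le {ϖ : Fˣ} (hϖ : ord ϖ = 1) {A : ℚ} (hA : 0 ≤ A) {X : Fin n → ℚˣ}
    (hX : ∀ i, 1 ≤ (X i : ℚ))
    (hXA : ∀ m, A * ∏ l ∈ Finset.Iio m, (X l : ℚ) ^ (∑ i : Fin n, (i : ℕ)) ≤ X m)
    {k : GL (Fin n) F} (hk : k ∈ maxCompact F n) (hkI : k ∉ iwahori F n) :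
    A * sph X (k * regularTorus n ϖ) ≤ sph X (regularTorus n ϖ) := by
  obtain ⟨m, hm, htail⟩ := exists_height_lt hϖ hk hkI
  set h := height (k * regularTorus n ϖ) with hh
  have hpos : ∀ l, (0 : ℚ) < X l := fun l => zero_lt_one.trans_le (hX l)
  have h0 : ∀ l, 0 ≤ h l := height_nonneg (valuation_mul_torus_le hϖ hk)
  -- Multiplication by `k` preserves the valuation of the determinant. As the exponents are
  -- nonnegative, each is at most this total, which is the exponent in `hXA`.
  have hsum : ∑ l, h l = ∑ l : Fin n, ((l : ℕ) : ℤ) := by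
    rw [hh, sum_height, Units.val_mul, Matrix.det_mul,
      vord_mul ((Matrix.isUnit_iff_isUnit_det _).mp k.isUnit).ne_zero
        ((Matrix.isUnit_iff_isUnit_det _).mp (regularTorus n ϖ).isUnit).ne_zero,
      vord_det_maxCompact hk, zero_add, ← sum_height]
    exact Finset.sum_congr rfl fun l _ => height_regularTorus hϖ l
  have hle : ∀ l, h l ≤ ((∑ i : Fin n, (i : ℕ) : ℕ) : ℤ) := by
    intro l
    push_cast
    rw [← hsum]
    exact Finset.single_le_sum (fun l _ => h0 l) (Finset.mem_univ l)
  have e1 : sph X (k * regularTorus n ϖ) = (∏ l ∈ Finset.Iio m, (X l : ℚ) ^ h l) *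
      ((X m : ℚ) ^ h m * ∏ l ∈ Finset.Ioi m, (X l : ℚ) ^ h l) := by
    rw [← prod_split]
    simp [sph, monom, hh]
  have e2 : sph X (regularTorus n ϖ : GL (Fin n) F) =
      (∏ l ∈ Finset.Iio m, (X l : ℚ) ^ ((l : ℕ) : ℤ)) *
      ((X m : ℚ) ^ ((m : ℕ) : ℤ) * ∏ l ∈ Finset.Ioi m, (X l : ℚ) ^ ((l : ℕ) : ℤ)) := by
    rw [← prod_split m fun l => (X l : ℚ) ^ ((l : ℕ) : ℤ)]
    simp [sph, monom, height_regularTorus hϖ]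
  have e3 : ∏ l ∈ Finset.Ioi m, (X l : ℚ) ^ h l =
      ∏ l ∈ Finset.Ioi m, (X l : ℚ) ^ ((l : ℕ) : ℤ) :=
    Finset.prod_congr rfl fun l hl => by rw [htail l (Finset.mem_Ioi.mp hl)]
  have hT : 0 < ∏ l ∈ Finset.Ioi m, (X l : ℚ) ^ ((l : ℕ) : ℤ) :=
    Finset.prod_pos fun l _ => zpow_pos (hpos l) _
  have hP : ∏ l ∈ Finset.Iio m, (X l : ℚ) ^ h l ≤
      ∏ l ∈ Finset.Iio m, (X l : ℚ) ^ (∑ i : Fin n, (i : ℕ)) := by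
    refine Finset.prod_le_prod (fun l _ => (zpow_pos (hpos l) _).le) fun l _ => ?_
    rw [← zpow_natCast]
    exact zpow_le_zpow_right₀ (hX l) (hle l)
  have hQ : 1 ≤ ∏ l ∈ Finset.Iio m, (X l : ℚ) ^ ((l : ℕ) : ℤ) := by
    have := Finset.prod_le_prod (s := Finset.Iio m) (f := fun _ => (1 : ℚ))
      (g := fun l => (X l : ℚ) ^ ((l : ℕ) : ℤ)) (fun _ _ => zero_le_one) fun l _ => by
        rw [zpow_natCast]
        exact one_le_pow₀ (hX l)
    simpa using this
  have hM : (X m : ℚ) * (X m : ℚ) ^ h m ≤ (X m : ℚ) ^ ((m : ℕ) : ℤ) := by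
    rw [← zpow_one_add₀ (hpos m).ne']
    exact zpow_le_zpow_right₀ (hX m) (by omega)
  have hAP : A * ∏ l ∈ Finset.Iio m, (X l : ℚ) ^ h l ≤ X m :=
    (mul_le_mul_of_nonneg_left hP hA).trans (hXA m)
  rw [e1, e2, e3]
  set T := ∏ l ∈ Finset.Ioi m, (X l : ℚ) ^ ((l : ℕ) : ℤ)
  have hxh : 0 < (X m : ℚ) ^ h m := zpow_pos (hpos m) _
  have hxm : 0 < (X m : ℚ) ^ ((m : ℕ) : ℤ) := zpow_pos (hpos m) _
  calc A * ((∏ l ∈ Finset.Iio m, (X l : ℚ) ^ h l) * ((X m : ℚ) ^ h m * T))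
      = (A * ∏ l ∈ Finset.Iio m, (X l : ℚ) ^ h l) * ((X m : ℚ) ^ h m * T) := by ring
    _ ≤ X m * ((X m : ℚ) ^ h m * T) := mul_le_mul_of_nonneg_right hAP (by positivity)
    _ = (X m * (X m : ℚ) ^ h m) * T := by ring
    _ ≤ (X m : ℚ) ^ ((m : ℕ) : ℤ) * T := mul_le_mul_of_nonneg_right hM hT.le
    _ ≤ _ := le_mul_of_one_le_left (by positivity) hQ

theorem finite_orbit_maxCompact {S : Subgroup (GL (Fin n) F)} (hS : S ≤ maxCompact F n)
    (y : GL (Fin n) F ⧸ maxCompact F n) : (MulAction.orbit S y).Finite := by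
  have h : (MulAction.orbit (maxCompact F n) y).Finite := by
    induction y using QuotientGroup.induction_on with
    | H g =>
      refine finite_orbit_of_compact (isCompact_intGL (ι := Fin n)) _
        (U := (maxCompact F n).comap (MulAut.conj g⁻¹).toMonoidHom) ?_ ?_
      · refine isOpen_maxCompact.preimage ?_
        change Continuous fun x => g⁻¹ * x * (g⁻¹)⁻¹
        fun_prop
      · intro u hu
        have hu' : g⁻¹ * u * (g⁻¹)⁻¹ ∈ maxCompact F n := hu
        change ((u * g : GL (Fin n) F) : GL (Fin n) F ⧸ maxCompact F n) = g
        refine (QuotientGroup.eq.mpr ?_).symm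
        simpa [mul_assoc] using hu'
  refine h.subset ?_
  rintro _ ⟨s, rfl⟩
  exact ⟨⟨s, hS s.2⟩, rfl⟩

theorem det_ne_zero_of_dominant {ι : Type*} [Fintype ι] [DecidableEq ι] (M : Matrix ι ι ℚ)
    (d ε : ℚ) (hd : ∀ i, d ≤ M i i) (h0 : ∀ i j, 0 ≤ M i j) (hε : ∀ i j, i ≠ j → M i j ≤ ε)
    (hε0 : 0 ≤ ε) (h : Fintype.card ι * ε < d) : M.det ≠ 0 := by
  refine det_ne_zero_of_sum_row_lt_diag fun k => ?_
  have h1 : ∑ j ∈ Finset.univ.erase k, ‖M k j‖ = ((∑ j ∈ Finset.univ.erase k, M k j : ℚ) : ℝ) := by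
    push_cast
    refine Finset.sum_congr rfl fun j _ => ?_
    rw [← Rat.norm_cast_real, Real.norm_of_nonneg (by exact_mod_cast h0 k j)]
  rw [h1, ← Rat.norm_cast_real, Real.norm_of_nonneg (by exact_mod_cast h0 k k)]
  refine Rat.cast_lt.mpr (lt_of_le_of_lt ?_ (h.trans_le (hd k)))
  refine (Finset.sum_le_sum (g := fun _ => ε) fun j hj =>
    hε k j (Finset.ne_of_mem_erase hj).symm).trans ?_
  rw [Finset.sum_const, nsmul_eq_mul]
  refine mul_le_mul_of_nonneg_right ?_ hε0
  exact_mod_cast Finset.card_le_univ _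

theorem sph_map {C C' : Type*} [Field C] [Field C'] (φ : C →+* C') (X : Fin n → Cˣ)
    (g : GL (Fin n) F) : sph (fun i => Units.map (φ : C →* C') (X i)) g = φ (sph X g) := by
  simp [sph, monom, Units.coe_prod, Units.val_zpow_eq_zpow_val, map_prod, map_zpow₀]

/-- The Iwahori orbit of the coset of `diag(1, ϖ, …, ϖ^(n-1))`. -/
noncomputable def iwahoriOrbit (n : ℕ) (ϖ : Fˣ) : Finset (GL (Fin n) F ⧸ maxCompact F n) :=
  (finite_orbit_maxCompact (iwahori_le_maxCompact (F := F) (n := n))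
    ((regularTorus n ϖ : GL (Fin n) F) : GL (Fin n) F ⧸ maxCompact F n)).toFinset

/-- The sum of translates of the spherical vector over an Iwahori orbit. -/
noncomputable def sphAvg {C : Type*} [Field C] (ϖ : Fˣ) (X : Fin n → Cˣ) (x : GL (Fin n) F) : C :=
  ∑ y ∈ iwahoriOrbit n ϖ, sph X (x * y.out)

theorem sphAvg_isPS {C : Type*} [Field C] (ϖ : Fˣ) (X : Fin n → Cˣ) : IsPS X (sphAvg ϖ X) :=
  IsPS.sum fun _ _ => (sph_isPS X).translate _

theorem sphAvg_iwInv {C : Type*} [Field C] (ϖ : Fˣ) (X : Fin n → Cˣ) : IwInv (sphAvg ϖ X) :=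
  fun x _ hi => sum_orbit_translate _ (sph_mul_maxCompact X) x hi

theorem sphAvg_map {C C' : Type*} [Field C] [Field C'] (φ : C →+* C') (ϖ : Fˣ) (X : Fin n → Cˣ)
    (g : GL (Fin n) F) :
    sphAvg ϖ (fun i => Units.map (φ : C →* C') (X i)) g = φ (sphAvg ϖ X g) := by
  simp only [sphAvg, map_sum, sph_map]

/-- A coset in the orbit is represented by `i * regularTorus n ϖ` with `i` in the Iwahori subgroup,
and `k * i` still lies outside it, so `mul_sph_le` bounds every term. -/
theorem sphAvg_le {ϖ : Fˣ} (hϖ : ord ϖ = 1) {A : ℚ} (hA : 0 < A) {X : Fin n → ℚˣ}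
    (hX : ∀ i, 1 ≤ (X i : ℚ))
    (hXA : ∀ m, A * ∏ l ∈ Finset.Iio m, (X l : ℚ) ^ (∑ i : Fin n, (i : ℕ)) ≤ X m)
    {k : GL (Fin n) F} (hk : k ∈ maxCompact F n) (hkI : k ∉ iwahori F n) :
    sphAvg ϖ X k ≤ (iwahoriOrbit n ϖ).card * (sph X (regularTorus n ϖ) / A) := by
  rw [← nsmul_eq_mul]
  refine Finset.sum_le_card_nsmul _ _ _ fun y hy => ?_
  rw [iwahoriOrbit, Set.Finite.mem_toFinset] at hy
  obtain ⟨i, rfl⟩ := hy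
  have h1 : sph X (k * (((i : GL (Fin n) F) * regularTorus n ϖ : GL (Fin n) F) :
      GL (Fin n) F ⧸ maxCompact F n).out) = sph X (k * (i : GL (Fin n) F) * regularTorus n ϖ) := by
    rw [apply_out (sph_mul_maxCompact X), mul_assoc]
  refine h1.le.trans ?_
  rw [le_div_iff₀ hA, mul_comm]
  refine mul_sph_le hϖ hA.le hX hXA (mul_mem hk (iwahori_le_maxCompact i.2)) fun h => hkI ?_
  exact (Subgroup.mul_mem_cancel_right _ i.2).mp h

/-- The orbit contains the coset of the torus element, and the remaining terms are positive. -/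
theorem le_sphAvg {ϖ : Fˣ} {X : Fin n → ℚˣ} (hX : ∀ i, 1 ≤ (X i : ℚ)) :
    sph X (regularTorus n ϖ) ≤ sphAvg ϖ X 1 := by
  have h3 : sph X (regularTorus n ϖ) = sph X (1 * ((regularTorus n ϖ : GL (Fin n) F) :
      GL (Fin n) F ⧸ maxCompact F n).out) := by
    rw [apply_out (sph_mul_maxCompact X), one_mul]
  rw [h3]
  refine Finset.single_le_sum (f := fun y : GL (Fin n) F ⧸ maxCompact F n => sph X (1 * y.out))
    (fun y _ => (sph_pos hX _).le) ?_
  rw [iwahoriOrbit, Set.Finite.mem_toFinset]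
  exact MulAction.mem_orbit_self _

theorem sphAvg_mem_span {C : Type*} [Field C] (ϖ : Fˣ) (X : Fin n → Cˣ) (g : GL (Fin n) F) :
    (fun x => sphAvg ϖ X (x * g)) ∈
      Submodule.span C (Set.range fun (g x : GL (Fin n) F) => sph X (x * g)) := by
  have : (fun x => sphAvg ϖ X (x * g)) =
      ∑ y ∈ iwahoriOrbit n ϖ, fun x => sph X (x * (g * y.out)) := by
    ext x
    simp only [sphAvg, Finset.sum_apply, mul_assoc]
  rw [this]
  exact Submodule.sum_mem _ fun y _ => Submodule.subset_span ⟨_, rfl⟩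

/-- For rapidly increasing rational parameters, the translates of the spherical vector span all
Iwahori invariant vectors of the principal series. -/
theorem mem_span_sph {ϖ : Fˣ} (hϖ : ord ϖ = 1) (n : ℕ) (C : Type*) [Field C] [CharZero C] :
    ∃ A : ℚ, 0 ≤ A ∧ ∀ X : Fin n → ℚˣ, (∀ i, 1 ≤ (X i : ℚ)) →
      (∀ m, A * ∏ l ∈ Finset.Iio m, (X l : ℚ) ^ (∑ i : Fin n, (i : ℕ)) ≤ X m) →
      ∀ f : GL (Fin n) F → C, IsPS (fun i => Units.map (algebraMap ℚ C : ℚ →* C) (X i)) f →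
        IwInv f → f ∈ Submodule.span C (Set.range fun (g x : GL (Fin n) F) =>
          sph (fun i => Units.map (algebraMap ℚ C : ℚ →* C) (X i)) (x * g)) := by
  classical
  let K := maxCompact F n
  let Q := K ⧸ (iwahori F n).subgroupOf K
  have : Finite Q := finite_quotient_of_compact (isCompact_intGL (ι := Fin n)) isOpen_iwahori
  let : Fintype Q := Fintype.ofFinite Q
  set O := iwahoriOrbit (F := F) n ϖ with hO
  have hA0 : (0 : ℚ) < Fintype.card Q * O.card + 1 := by positivity
  -- An off-diagonal entry of `M` is at most `O.card * τ / A`, and a row has at most `Fintype.card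
  -- Q` of them; this `A` keeps their sum below the diagonal bound `τ`.
  refine ⟨Fintype.card Q * O.card + 1, hA0.le, fun X hX hXA f hf hfI => ?_⟩
  let X' : Fin n → Cˣ := fun i => Units.map (algebraMap ℚ C : ℚ →* C) (X i)
  have hPS := sphAvg_isPS ϖ X'
  have hInv := sphAvg_iwInv ϖ X'
  have hpos := sph_pos (F := F) hX
  set τ := sph X (regularTorus n ϖ : GL (Fin n) F)
  let rep : Q → GL (Fin n) F := fun q => (q.out : K)
  have hrep : ∀ q, rep q ∈ maxCompact F n := fun q => (q.out : K).2
  -- Column `j` holds the values at the points `(rep i)⁻¹` of the averaged vector translated by `rep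
  -- j`. On the diagonal the argument is `1`, off the diagonal it lies outside the Iwahori subgroup.
  let M : Matrix Q Q ℚ := Matrix.of fun i j => sphAvg ϖ X ((rep i)⁻¹ * rep j)
  have hM : M.det ≠ 0 := by
    refine det_ne_zero_of_dominant M τ (O.card * (τ / (Fintype.card Q * O.card + 1)))
      (fun i => ?_) (fun i j => Finset.sum_nonneg fun y _ => (hpos _).le) (fun i j hij => ?_)
      (by have := hpos (regularTorus n ϖ : GL (Fin n) F); positivity) ?_
    · change τ ≤ sphAvg ϖ X ((rep i)⁻¹ * rep i)
      rw [inv_mul_cancel]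
      exact le_sphAvg hX
    · refine sphAvg_le hϖ hA0 hX hXA (mul_mem (inv_mem (hrep i)) (hrep j)) fun h => hij ?_
      rw [← i.out_eq', ← j.out_eq']
      exact QuotientGroup.eq.mpr h
    · have hτ : 0 < τ := hpos _
      rw [← mul_assoc, ← mul_div_assoc, div_lt_iff₀ hA0]
      nlinarith
  let M' : Matrix Q Q C := M.map (algebraMap ℚ C)
  have hM' : IsUnit M'.det := by
    have h := (algebraMap ℚ C).map_det M
    rw [RingHom.mapMatrix_apply] at h
    rw [isUnit_iff_ne_zero, ← h]
    exact (map_ne_zero _).mpr hM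
  let a : Q → C := M'⁻¹ *ᵥ fun i => f (rep i)⁻¹
  have ha : ∀ i, ∑ j, M' i j * a j = f (rep i)⁻¹ := by
    intro i
    have : (M' *ᵥ a) i = f (rep i)⁻¹ := by
      simp only [a, Matrix.mulVec_mulVec, Matrix.mul_nonsing_inv _ hM', Matrix.one_mulVec]
    exact this
  have hfeq : f = fun x => ∑ j, a j * sphAvg ϖ X' (x * rep j) := by
    refine hf.ext (IsPS.sum fun j _ => (hPS.translate _).smul _) fun k hk => ?_
    -- With this class `k` lies in the left Iwahori coset of `(rep q)⁻¹`, and left invariance on `K`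
    -- reduces the comparison to the points where `a` solves the linear system.
    let q : Q := ((⟨k, hk⟩⁻¹ : K) : Q)
    have hq : k * rep q ∈ iwahori F n := by
      have : ((⟨k, hk⟩⁻¹ : K) : Q) = ((q.out : K) : Q) := q.out_eq'.symm
      have := QuotientGroup.eq.mp this
      rw [inv_inv] at this
      exact this
    have hk' : k = (k * rep q) * (rep q)⁻¹ := by group
    rw [hk', hf.iwahori_mul hfI hq (inv_mem (hrep q)), ← ha q]
    refine Finset.sum_congr rfl fun j _ => ?_
    rw [mul_assoc (k * rep q), hPS.iwahori_mul hInv hq (mul_mem (inv_mem (hrep q)) (hrep j)),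
      sphAvg_map, mul_comm]
    rfl
  rw [hfeq]
  have : (fun x => ∑ j, a j * sphAvg ϖ X' (x * rep j)) =
      ∑ j, a j • fun x => sphAvg ϖ X' (x * rep j) := by
    ext x
    simp
  rw [this]
  exact Submodule.sum_mem _ fun j _ => Submodule.smul_mem _ _ (sphAvg_mem_span _ _ _)

end Cyclic

/-! ### Laurent polynomials that agree on a dense set of parameters -/

section Laurent

variable {n : ℕ} {C : Type*} [Field C]

/-- The polynomial obtained from a Laurent polynomial by clearing denominators. -/
noncomputable def clearedPoly {ι : Type*} (N : ℕ) (s : Finset ι) (a : ι → C) (ν : ι → Fin n → ℤ) :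
    MvPolynomial (Fin n) C :=
  ∑ i ∈ s, MvPolynomial.C (a i) * ∏ j, MvPolynomial.X j ^ ((N : ℤ) + ν i j).toNat

theorem eval_clearedPoly {ι : Type*} {N : ℕ} {s : Finset ι} (a : ι → C) {ν : ι → Fin n → ℤ}
    (h : ∀ i ∈ s, ∀ j, 0 ≤ (N : ℤ) + ν i j) (X : Fin n → Cˣ) :
    MvPolynomial.eval (fun j => (X j : C)) (clearedPoly N s a ν) =
      (∏ j, (X j : C)) ^ N * ∑ i ∈ s, a i * (monom X (ν i) : Cˣ) := by
  simp only [clearedPoly, map_sum, map_mul, map_prod, map_pow, MvPolynomial.eval_C,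
    MvPolynomial.eval_X]
  rw [Finset.mul_sum]
  refine Finset.sum_congr rfl fun i hi => ?_
  rw [mul_left_comm]
  congr 1
  rw [← Finset.prod_pow, monom, Units.coe_prod, ← Finset.prod_mul_distrib]
  refine Finset.prod_congr rfl fun j _ => ?_
  rw [Units.val_zpow_eq_zpow_val, ← zpow_natCast, ← zpow_natCast, Int.toNat_of_nonneg (h i hi j),
    zpow_add₀ (X j).ne_zero]

theorem exists_clearing {ι : Type*} (s : Finset ι) (ν : ι → Fin n → ℤ) :
    ∃ N₀ : ℕ, ∀ N : ℕ, N₀ ≤ N → ∀ i ∈ s, ∀ j, 0 ≤ (N : ℤ) + ν i j := by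
  refine ⟨∑ i ∈ s, ∑ j, (ν i j).natAbs, fun N hN i hi j => ?_⟩
  have h1 : (ν i j).natAbs ≤ ∑ j, (ν i j).natAbs :=
    Finset.single_le_sum (f := fun j => (ν i j).natAbs) (fun _ _ => Nat.zero_le _)
      (Finset.mem_univ j)
  have h2 : ∑ j, (ν i j).natAbs ≤ ∑ i ∈ s, ∑ j, (ν i j).natAbs :=
    Finset.single_le_sum (f := fun i => ∑ j, (ν i j).natAbs) (fun _ _ => Nat.zero_le _) hi
  omega

/-- The bound involves `a l + 1` so that the growth condition survives when each parameter varies in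
the interval `[a l, a l + 1]`. -/
theorem exists_lacunary (A : ℚ) (hA : 0 ≤ A) (L : ℕ) : ∃ a : ℕ → ℚ, (∀ m, 1 ≤ a m) ∧
    ∀ m, A * ∏ l ∈ Finset.range m, (a l + 1) ^ L ≤ a m := by
  -- `P m` is the product of the factors before `m`, defined by recursion so that `a m = A * P m +
  -- 1` can be read off from it.
  let P : ℕ → ℚ := fun m => Nat.rec 1 (fun _ p => p * (A * p + 1 + 1) ^ L) m
  have hP : ∀ m, 0 ≤ P m := by
    intro m
    induction m with
    | zero => exact zero_le_one
    | succ m ih =>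
      change 0 ≤ P m * (A * P m + 1 + 1) ^ L
      positivity
  have hprod : ∀ m, ∏ l ∈ Finset.range m, (A * P l + 1 + 1) ^ L = P m := by
    intro m
    induction m with
    | zero => rfl
    | succ m ih => rw [Finset.prod_range_succ, ih]
  refine ⟨fun m => A * P m + 1, fun m => ?_, fun m => ?_⟩
  · have := mul_nonneg hA (hP m)
    linarith
  · simp only
    rw [hprod]
    linarith

/-- Two Laurent polynomials that agree at rapidly increasing rational arguments are equal. -/
theorem laurent_ext [CharZero C] {ι ι' : Type*} {s : Finset ι} {s' : Finset ι'} {a : ι → C}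
    {a' : ι' → C} {ν : ι → Fin n → ℤ} {ν' : ι' → Fin n → ℤ} {A : ℚ} (hA : 0 ≤ A) {L : ℕ}
    (h : ∀ X : Fin n → ℚˣ, (∀ i, 1 ≤ (X i : ℚ)) →
      (∀ m, A * ∏ l ∈ Finset.Iio m, (X l : ℚ) ^ L ≤ X m) →
      ∑ i ∈ s, a i * (monom (fun i => Units.map (algebraMap ℚ C : ℚ →* C) (X i)) (ν i) : Cˣ) =
      ∑ i ∈ s', a' i * (monom (fun i => Units.map (algebraMap ℚ C : ℚ →* C) (X i)) (ν' i) : Cˣ))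
    (X : Fin n → Cˣ) :
    ∑ i ∈ s, a i * (monom X (ν i) : Cˣ) = ∑ i ∈ s', a' i * (monom X (ν' i) : Cˣ) := by
  obtain ⟨N₁, hN₁⟩ := exists_clearing s ν
  obtain ⟨N₂, hN₂⟩ := exists_clearing s' ν'
  obtain ⟨b, hb1, hb⟩ := exists_lacunary A hA L
  have h1 := hN₁ (N₁ + N₂) (by omega)
  have h2 := hN₂ (N₁ + N₂) (by omega)
  have hpoly : clearedPoly (N₁ + N₂) s a ν = clearedPoly (N₁ + N₂) s' a' ν' := by
    -- Every point of the box of intervals satisfies the growth condition, and polynomials that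
    -- agree on a product of infinite sets are equal.
    refine MvPolynomial.funext_set (fun m : Fin n => algebraMap ℚ C '' Set.Icc (b m) (b m + 1))
      (fun m => (Set.Icc_infinite (by linarith)).image (algebraMap ℚ C).injective.injOn) ?_
    intro x hx
    choose y hy hyx using fun m => hx m (Set.mem_univ m)
    have hy1 : ∀ m, 1 ≤ y m := fun m => (hb1 m).trans (hy m).1
    let Y : Fin n → ℚˣ := fun m => Units.mk0 (y m) (zero_lt_one.trans_le (hy1 m)).ne'
    have hxY : x = fun m => ((Units.map (algebraMap ℚ C : ℚ →* C) (Y m) : Cˣ) : C) := by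
      ext m
      exact (hyx m).symm
    rw [hxY, eval_clearedPoly a h1 fun m => Units.map (algebraMap ℚ C : ℚ →* C) (Y m),
      eval_clearedPoly a' h2 fun m => Units.map (algebraMap ℚ C : ℚ →* C) (Y m)]
    congr 1
    refine h Y hy1 fun m => ?_
    refine le_trans (mul_le_mul_of_nonneg_left ?_ hA) ((hb m).trans (hy m).1)
    rw [← Nat.Iio_eq_range, ← Fin.map_valEmbedding_Iio, Finset.prod_map]
    refine Finset.prod_le_prod (fun l _ => ?_) fun l _ => ?_
    · have := hy1 l
      change 0 ≤ y l ^ L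
      positivity
    · have := hy1 l
      exact pow_le_pow_left₀ (by linarith) (hy l).2 L
  have h3 := congrArg (MvPolynomial.eval fun j => (X j : C)) hpoly
  rw [eval_clearedPoly a h1, eval_clearedPoly a' h2] at h3
  exact mul_left_cancel₀ (pow_ne_zero _ (Finset.prod_ne_zero_iff.mpr fun j _ => (X j).ne_zero)) h3

end Laurent

/-! ### The Bernstein centre on Iwahori fixed vectors -/

section Centre

variable {F : Type u} [Field F] [ValuativeRel F] [TopologicalSpace F]
  [IsNonarchimedeanLocalField F] {E : Type u} [Field E] {n : ℕ}

/-- A representation spanned by the translates of its Iwahori fixed vectors is smooth. -/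
theorem iwahoriBlock_of_span {V : Rep.{u} E (GL (Fin n) F)}
    (h : Submodule.span E {w : V | ∃ (g : GL (Fin n) F) (v : V),
      (∀ x ∈ iwahori F n, V.ρ x v = v) ∧ w = V.ρ g v} = ⊤) : iwahoriBlock F E n V := by
  refine ⟨fun w => ?_, h⟩
  have hw : w ∈ Submodule.span E {w : V | ∃ (g : GL (Fin n) F) (v : V),
      (∀ x ∈ iwahori F n, V.ρ x v = v) ∧ w = V.ρ g v} := h ▸ Submodule.mem_top
  induction hw using Submodule.span_induction with
  | mem w hw =>
    obtain ⟨g, v, hv, rfl⟩ := hw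
    refine ⟨(iwahori F n).comap (MulAut.conj g⁻¹).toMonoidHom, ?_, fun x hx => ?_⟩
    · refine isOpen_iwahori.preimage ?_
      change Continuous fun x => g⁻¹ * x * (g⁻¹)⁻¹
      fun_prop
    · have hx' : g⁻¹ * x * (g⁻¹)⁻¹ ∈ iwahori F n := hx
      have h1 : x * g = g * (g⁻¹ * x * (g⁻¹)⁻¹) := by group
      rw [← Module.End.mul_apply, ← map_mul, h1, map_mul, Module.End.mul_apply, hv _ hx']
  | zero => exact ⟨⊤, isOpen_univ, by simp⟩
  | add v w _ _ hv hw =>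
    obtain ⟨U, hU, h⟩ := hv
    obtain ⟨U', hU', h'⟩ := hw
    exact ⟨U ⊓ U', hU.inter hU', fun x hx => by rw [map_add, h x hx.1, h' x hx.2]⟩
  | smul c v _ hv =>
    obtain ⟨U, hU, h⟩ := hv
    exact ⟨U, hU, fun x hx => by rw [map_smul, h x hx]⟩

theorem centreAct_natural (z : BernsteinCentre F E n) {V W : Rep.{u} E (GL (Fin n) F)}
    (hV : iwahoriBlock F E n V) (hW : iwahoriBlock F E n W) (f : V.ρ.IntertwiningMap W.ρ) (v : V) :
    f (centreAct z V hV v) = centreAct z W hW (f v) := by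
  let V' : (iwahoriBlock F E n).FullSubcategory := ⟨V, hV⟩
  let W' : (iwahoriBlock F E n).FullSubcategory := ⟨W, hW⟩
  let f' : V' ⟶ W' := ObjectProperty.homMk (Rep.ofHom f)
  have h := z.naturality f'
  have h2 := congrArg (fun t => t.hom.hom v) h
  exact h2.symm

theorem centreAct_rho (z : BernsteinCentre F E n) {V : Rep.{u} E (GL (Fin n) F)}
    (hV : iwahoriBlock F E n V) (g : GL (Fin n) F) (v : V) :
    centreAct z V hV (V.ρ g v) = V.ρ g (centreAct z V hV v) :=
  Rep.hom_comm_apply (z.app ⟨V, hV⟩).hom g v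

variable (F E n) in
/-- The permutation representation of `GL_n(F)` on the cosets of the Iwahori subgroup. -/
noncomputable def iwCosetRep :
    Representation E (GL (Fin n) F) ((GL (Fin n) F ⧸ iwahori F n) →₀ E) where
  toFun g := Finsupp.lmapDomain E E (g • ·)
  map_one' := by ext; simp
  map_mul' x y := by ext; simp [mul_smul]

variable (F E n) in
/-- The compactly induced representation `c-Ind_I^G 1`. -/
noncomputable def cIndIw : Rep.{u} E (GL (Fin n) F) := Rep.of (iwCosetRep F E n)

theorem iwCosetRep_single (g : GL (Fin n) F) (x : GL (Fin n) F ⧸ iwahori F n) (c : E) :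
    iwCosetRep F E n g (Finsupp.single x c) = Finsupp.single (g • x) c := by
  simp [iwCosetRep]

theorem cIndIw_mem : iwahoriBlock F E n (cIndIw F E n) := by
  refine iwahoriBlock_of_span (eq_top_iff.mpr fun v _ => ?_)
  change (GL (Fin n) F ⧸ iwahori F n) →₀ E at v
  induction v using Finsupp.induction_linear with
  | zero => exact Submodule.zero_mem _
  | add v w hv hw => exact Submodule.add_mem _ (hv trivial) (hw trivial)
  | single x c =>
    induction x using QuotientGroup.induction_on with
    | H x =>
      refine Submodule.subset_span ⟨x, (Finsupp.single
        ((1 : GL (Fin n) F) : GL (Fin n) F ⧸ iwahori F n) c), ?_, ?_⟩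
      · intro g hg
        refine (iwCosetRep_single _ _ _).trans ?_
        congr 1
        change ((g * 1 : GL (Fin n) F) : GL (Fin n) F ⧸ iwahori F n) = (1 : GL (Fin n) F)
        refine (QuotientGroup.eq.mpr ?_).symm
        simpa using hg
      · refine ((iwCosetRep_single _ _ _).trans ?_).symm
        congr 1
        change ((x * 1 : GL (Fin n) F) : GL (Fin n) F ⧸ iwahori F n) = x
        rw [mul_one]

/-- The element of `E[G/I]` by which `z` acts on Iwahori fixed vectors. -/
noncomputable def heckeCoeff (z : BernsteinCentre F E n) : (GL (Fin n) F ⧸ iwahori F n) →₀ E :=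
  centreAct z (cIndIw F E n) cIndIw_mem
    (Finsupp.single ((1 : GL (Fin n) F) : GL (Fin n) F ⧸ iwahori F n) (1 : E) :
      (GL (Fin n) F ⧸ iwahori F n) →₀ E)

/-- The map `c-Ind_I^G 1 → V` given by an Iwahori fixed vector. -/
noncomputable def orbitMap {V : Type*} [AddCommGroup V] [Module E V]
    (ρ : Representation E (GL (Fin n) F) V) (v : V) (hv : ∀ x ∈ iwahori F n, ρ x v = v) :
    (iwCosetRep F E n).IntertwiningMap ρ :=
  LinearMap.intertwiningMap_of_isIntertwiningMap _ _
    (Finsupp.linearCombination E fun y : GL (Fin n) F ⧸ iwahori F n => ρ y.out v) (by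
      intro g w
      induction w using Finsupp.induction_linear with
      | zero => simp
      | add v w hv hw => simp only [map_add, hv, hw]
      | single x c =>
        rw [iwCosetRep_single, Finsupp.linearCombination_single, Finsupp.linearCombination_single,
          map_smul, ← Module.End.mul_apply, ← map_mul]
        congr 1
        have h := apply_out (K := iwahori F n) (φ := fun g => ρ g v)
          (fun g k hk => by rw [map_mul, Module.End.mul_apply, hv k hk]) 1 (g * x.out)
        simp only [one_mul] at h
        rw [← h]
        congr 2
        conv_lhs => rw [← x.out_eq']
        rfl)

theorem orbitMap_apply {V : Type*} [AddCommGroup V] [Module E V]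
    (ρ : Representation E (GL (Fin n) F) V) (v : V) (hv : ∀ x ∈ iwahori F n, ρ x v = v)
    (w : (GL (Fin n) F ⧸ iwahori F n) →₀ E) :
    orbitMap ρ v hv w = w.sum fun y c => c • ρ y.out v := rfl

/-- This is naturality of `z` along the map `c-Ind_I^G 1 → V` that sends the base coset to `v`. Thus
one element of `E[G/I]` describes `z` on the fixed vectors of all objects at once. -/
theorem centreAct_eq_sum (z : BernsteinCentre F E n) {V : Rep.{u} E (GL (Fin n) F)}
    (hV : iwahoriBlock F E n V) {v : V} (hv : ∀ x ∈ iwahori F n, V.ρ x v = v) :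
    centreAct z V hV v = (heckeCoeff z).sum fun y c => c • V.ρ y.out v := by
  have h := centreAct_natural z cIndIw_mem hV (orbitMap V.ρ v hv)
    (Finsupp.single ((1 : GL (Fin n) F) : GL (Fin n) F ⧸ iwahori F n) (1 : E) :
      (GL (Fin n) F ⧸ iwahori F n) →₀ E)
  have h1 : orbitMap V.ρ v hv (Finsupp.single ((1 : GL (Fin n) F) : GL (Fin n) F ⧸ iwahori F n)
      (1 : E) : (GL (Fin n) F ⧸ iwahori F n) →₀ E) = v := by
    rw [orbitMap_apply, Finsupp.sum_single_index (by simp), one_smul]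
    have h := apply_out (K := iwahori F n) (φ := fun g => V.ρ g v)
      (fun g k hk => by rw [map_mul, Module.End.mul_apply, hv k hk]) 1 1
    simpa only [one_mul, map_one, Module.End.one_apply] using h
  refine (congrArg (centreAct z V hV) h1.symm).trans (h.symm.trans ?_)
  exact orbitMap_apply _ _ _ _

end Centre

/-! ### Spherical vectors as eigenvectors of the centre -/

section HeckeEigen

variable {F : Type u} [Field F] [ValuativeRel F] [TopologicalSpace F]
  [IsNonarchimedeanLocalField F] {E : Type u} [Field E] {n : ℕ}

/-- The cosets in the double coset of `diag(ϖ I_r, I_{n-r})`. -/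
noncomputable def heckeOrbit (n r : ℕ) (ϖ : Fˣ) : Finset (GL (Fin n) F ⧸ maxCompact F n) :=
  (finite_orbit_maxCompact (le_refl (maxCompact F n))
    ((heckeElement n r ϖ : GL (Fin n) F) : GL (Fin n) F ⧸ maxCompact F n)).toFinset

/-- The eigenvalue of the double coset operator on the spherical vector. -/
noncomputable def satake {C : Type*} [Field C] (r : ℕ) (ϖ : Fˣ) (X : Fin n → Cˣ) : C :=
  ∑ y ∈ heckeOrbit n r ϖ, sph X y.out

/-- In the Iwasawa decomposition of `x` the triangular factor comes out by equivariance, and the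
integral factor only permutes the orbit. -/
theorem sum_heckeOrbit_sph {C : Type*} [Field C] (r : ℕ) (ϖ : Fˣ) (X : Fin n → Cˣ)
    (x : GL (Fin n) F) :
    ∑ y ∈ heckeOrbit n r ϖ, sph X (x * y.out) = satake r ϖ X * sph X x := by
  have h : ∀ y : GL (Fin n) F ⧸ maxCompact F n, sph X (x * y.out) =
      (monom X (diagOrd (iwasawaB x)) : Cˣ) * sph X (iwasawaK x * y.out) := by
    intro y
    rw [← sph_isPS X _ (iwasawaB_mem x), ← mul_assoc, iwasawa_mul]
  simp only [h]
  rw [← Finset.mul_sum, mul_comm]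
  congr 1
  have := sum_orbit_translate (finite_orbit_maxCompact (le_refl (maxCompact F n))
    ((heckeElement n r ϖ : GL (Fin n) F) : GL (Fin n) F ⧸ maxCompact F n))
    (sph_mul_maxCompact X) 1 (iwasawaK_mem x)
  simp only [one_mul] at this
  exact this

/-- The representative chosen for the trivial coset need not be `1`, but it lies in `K` and
therefore permutes the orbit. -/
theorem doubleCosetOp_single_one (r : ℕ) (ϖ : Fˣ) :
    doubleCosetOp (heckeElement n r ϖ) (Finsupp.single
      ((1 : GL (Fin n) F) : GL (Fin n) F ⧸ maxCompact F n) (1 : E) :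
        (GL (Fin n) F ⧸ maxCompact F n) →₀ E) =
      ∑ y ∈ heckeOrbit n r ϖ, (Finsupp.single y (1 : E) :
        (GL (Fin n) F ⧸ maxCompact F n) →₀ E) := by
  set o := ((1 : GL (Fin n) F) : GL (Fin n) F ⧸ maxCompact F n).out with ho
  have hoK : o ∈ maxCompact F n := by
    have := QuotientGroup.eq.mp (((1 : GL (Fin n) F) : GL (Fin n) F ⧸ maxCompact F n).out_eq')
    simpa [ho] using this
  have h1 : doubleCosetOp (heckeElement n r ϖ) (Finsupp.single
      ((1 : GL (Fin n) F) : GL (Fin n) F ⧸ maxCompact F n) (1 : E) :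
        (GL (Fin n) F ⧸ maxCompact F n) →₀ E) =
      cosetRep F E n o (∑ᶠ y ∈ MulAction.orbit (maxCompact F n)
        ((heckeElement n r ϖ : GL (Fin n) F) : GL (Fin n) F ⧸ maxCompact F n),
          (Finsupp.single y (1 : E) : (GL (Fin n) F ⧸ maxCompact F n) →₀ E)) := by
    refine (Finsupp.lsum_single E (M := E) (N := cInd F E n) _ _ _).trans ?_
    exact one_smul E _
  rw [h1, finsum_mem_eq_finite_toFinset_sum _ (finite_orbit_maxCompact (le_refl (maxCompact F n))
    ((heckeElement n r ϖ : GL (Fin n) F) : GL (Fin n) F ⧸ maxCompact F n)), map_sum]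
  refine Finset.sum_equiv (MulAction.toPerm (⟨o, hoK⟩ : maxCompact F n)) (fun y => ?_)
    fun y _ => ?_
  · simp only [heckeOrbit, Set.Finite.mem_toFinset, MulAction.toPerm_apply]
    rw [← MulAction.orbit_eq_iff, ← MulAction.orbit_eq_iff, MulAction.orbit_smul]
  · rw [cosetRep_single]
    rfl

/-- The canonical generator of `c-Ind_K^G 1`. -/
noncomputable abbrev baseCoset (F : Type u) [Field F] [ValuativeRel F] [TopologicalSpace F]
    [IsNonarchimedeanLocalField F] (E : Type u) [Field E] (n : ℕ) :
    (GL (Fin n) F ⧸ maxCompact F n) →₀ E :=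
  Finsupp.single ((1 : GL (Fin n) F) : GL (Fin n) F ⧸ maxCompact F n) (1 : E)

theorem baseCoset_fixed (x : GL (Fin n) F) (hx : x ∈ maxCompact F n) :
    cosetRep F E n x (baseCoset F E n) = baseCoset F E n := by
  rw [cosetRep_single]
  congr 1
  change ((x * 1 : GL (Fin n) F) : GL (Fin n) F ⧸ maxCompact F n) = (1 : GL (Fin n) F)
  refine (QuotientGroup.eq.mpr ?_).symm
  simpa using hx

theorem cosetRep_baseCoset (x : GL (Fin n) F) :
    cosetRep F E n x (baseCoset F E n) =
      Finsupp.single (x : GL (Fin n) F ⧸ maxCompact F n) 1 := by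
  rw [cosetRep_single]
  congr 1
  change ((x * 1 : GL (Fin n) F) : GL (Fin n) F ⧸ maxCompact F n) = x
  rw [mul_one]

section

variable {r : ℕ} {ϖ : Fˣ} {z : BernsteinCentre F E n}

/-- Both sides are the value of `z` at the generator of `c-Ind_K^G 1`. All that is known of
`heckeCoeff z` is thus its image in `E[G/K]`. -/
theorem heckeCoeff_sum_single
    (hz : centreAct z (cInd F E n) cInd_mem = doubleCosetOp (heckeElement n r ϖ)) :
    ((heckeCoeff z).sum fun y c =>
      (Finsupp.single ((y.out : GL (Fin n) F) : GL (Fin n) F ⧸ maxCompact F n) c :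
        (GL (Fin n) F ⧸ maxCompact F n) →₀ E)) =
      ∑ y ∈ heckeOrbit n r ϖ, (Finsupp.single y (1 : E) :
        (GL (Fin n) F ⧸ maxCompact F n) →₀ E) := by
  have h := centreAct_eq_sum z cInd_mem (v := (baseCoset F E n))
    fun x hx => baseCoset_fixed x (iwahori_le_maxCompact hx)
  rw [hz] at h
  refine Eq.trans ?_ (h.symm.trans (doubleCosetOp_single_one r ϖ))
  refine Finsupp.sum_congr fun y _ => ?_
  change _ = (heckeCoeff z) y • cosetRep F E n y.out (baseCoset F E n)
  rw [cosetRep_baseCoset, Finsupp.smul_single, smul_eq_mul, mul_one]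

variable {C : Type u} [Field C] [Algebra E C]

/-- For fixed `x` the function `y ↦ sph X (x * y)` is right invariant under `K`, so it defines a
linear form on `E[G/K]`, which is applied to `heckeCoeff_sum_single`. -/
theorem hecke_sph
    (hz : centreAct z (cInd F E n) cInd_mem = doubleCosetOp (heckeElement n r ϖ))
    (X : Fin n → Cˣ) (x : GL (Fin n) F) :
    ((heckeCoeff z).sum fun y c => algebraMap E C c * sph X (x * y.out)) =
      satake r ϖ X * sph X x := by
  rw [← sum_heckeOrbit_sph]
  have h := congrArg (Finsupp.linearCombination E
    fun y : GL (Fin n) F ⧸ maxCompact F n => sph X (x * y.out)) (heckeCoeff_sum_single hz)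
  rw [map_finsuppSum, map_sum] at h
  simp only [Finsupp.linearCombination_single, one_smul,
    apply_out (sph_mul_maxCompact X)] at h
  rw [← h]
  exact Finsupp.sum_congr fun y _ => (Algebra.smul_def _ _).symm

end

variable (F E n) in
/-- The representation of `GL_n(F)` on all functions by right translation. -/
def funRep (C : Type u) [Field C] [Algebra E C] :
    Representation E (GL (Fin n) F) (GL (Fin n) F → C) where
  toFun g :=
    { toFun := fun f x => f (x * g)
      map_add' := fun _ _ => rfl
      map_smul' := fun _ _ => rfl }
  map_one' := by ext; simp
  map_mul' x y := by ext; simp [mul_assoc]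

/-- The subspace generated by the Iwahori fixed vectors. -/
def genSub {V : Type u} [AddCommGroup V] [Module E V] (ρ : Representation E (GL (Fin n) F) V) :
    Submodule E V :=
  Submodule.span E {w | ∃ (g : GL (Fin n) F) (v : V), (∀ x ∈ iwahori F n, ρ x v = v) ∧ w = ρ g v}

theorem genSub_le {V : Type u} [AddCommGroup V] [Module E V]
    (ρ : Representation E (GL (Fin n) F) V) (g : GL (Fin n) F) :
    genSub ρ ≤ (genSub ρ).comap (ρ g) := by
  refine Submodule.span_le.mpr ?_
  rintro w ⟨g', v, hv, rfl⟩
  refine Submodule.subset_span ⟨g * g', v, hv, ?_⟩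
  rw [map_mul, Module.End.mul_apply]

/-- The subrepresentation generated by the Iwahori fixed vectors. -/
def genRep {V : Type u} [AddCommGroup V] [Module E V] (ρ : Representation E (GL (Fin n) F) V) :
    Rep.{u} E (GL (Fin n) F) :=
  Rep.of (ρ.subrepresentation (genSub ρ) (genSub_le ρ))

theorem mem_genSub {V : Type u} [AddCommGroup V] [Module E V]
    {ρ : Representation E (GL (Fin n) F) V} {v : V} (hv : ∀ x ∈ iwahori F n, ρ x v = v) :
    v ∈ genSub ρ :=
  Submodule.subset_span ⟨1, v, hv, by simp⟩

theorem genRep_mem {V : Type u} [AddCommGroup V] [Module E V]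
    (ρ : Representation E (GL (Fin n) F) V) : iwahoriBlock F E n (genRep ρ) := by
  refine iwahoriBlock_of_span (eq_top_iff.mpr ?_)
  rintro ⟨w, hw⟩ -
  change (⟨w, hw⟩ : genSub ρ) ∈ Submodule.span E {w : genSub ρ | _}
  induction hw using Submodule.span_induction with
  | mem w hw =>
    obtain ⟨g, v, hv, rfl⟩ := hw
    exact Submodule.subset_span ⟨g, (⟨v, mem_genSub hv⟩ : genSub ρ),
      fun x hx => Subtype.ext (hv x hx), rfl⟩
  | zero => exact Submodule.zero_mem _
  | add v w hv' hw' hv hw => exact Submodule.add_mem _ hv hw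
  | smul c v hv' hv => exact Submodule.smul_mem _ c hv

/-- The ambient representation need not belong to the block. On the part generated by Iwahori fixed
vectors `z` is defined, and its values can still be computed in `V`. -/
theorem centreAct_genRep (z : BernsteinCentre F E n) {V : Type u} [AddCommGroup V] [Module E V]
    (ρ : Representation E (GL (Fin n) F) V) (g : GL (Fin n) F) {v : V}
    (hv : ∀ x ∈ iwahori F n, ρ x v = v) (hgv : ρ g v ∈ genSub ρ) :
    (genSub ρ).subtype (centreAct z (genRep ρ) (genRep_mem ρ) (⟨ρ g v, hgv⟩ : genSub ρ)) =
      ρ g ((heckeCoeff z).sum fun y c => c • ρ y.out v) := by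
  have h1 := centreAct_rho z (genRep_mem ρ) g (⟨v, mem_genSub hv⟩ : genSub ρ)
  have h2 := centreAct_eq_sum z (genRep_mem ρ) (v := (⟨v, mem_genSub hv⟩ : genSub ρ))
    fun x hx => Subtype.ext (hv x hx)
  rw [h2] at h1
  refine (congrArg (genSub ρ).subtype h1).trans ?_
  change ρ g ((genSub ρ).subtype ((heckeCoeff z).sum fun y c => c •
    (ρ.subrepresentation (genSub ρ) (genSub_le ρ)) y.out ⟨v, mem_genSub hv⟩)) = _
  congr 1
  rw [map_finsuppSum]
  rfl

variable {r : ℕ} {ϖ : Fˣ} {z : BernsteinCentre F E n}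
  {C : Type u} [Field C] [Algebra E C]

/-- A translate of `sph X` need not be Iwahori fixed, so `heckeCoeff z` cannot be applied to it
directly. Writing `f` as a sum of translates and using that `z` commutes with `G` reduces the claim
to `hecke_sph`. -/
theorem hecke_eigen_of_mem_span
    (hz : centreAct z (cInd F E n) cInd_mem = doubleCosetOp (heckeElement n r ϖ))
    (X : Fin n → Cˣ) {f : GL (Fin n) F → C} (hf : IwInv f)
    (hspan : f ∈ Submodule.span C (Set.range fun (g x : GL (Fin n) F) => sph X (x * g)))
    (x : GL (Fin n) F) :
    ((heckeCoeff z).sum fun y c => algebraMap E C c * f (x * y.out)) = satake r ϖ X * f x := by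
  let ρ := funRep F E n C
  have hfix : ∀ x ∈ iwahori F n, ρ x f = f := fun x hx => funext fun g => hf g x hx
  obtain ⟨a, ha⟩ := Finsupp.mem_span_range_iff_exists_finsupp.mp hspan
  -- The representation is only `E`-linear, so coefficients from `C` are absorbed into the
  -- functions.
  have hfixs : ∀ c : C, ∀ x ∈ iwahori F n, ρ x (fun g => c * sph X g) = fun g => c * sph X g :=
    fun c x hx => funext fun g => congrArg (c * ·)
      (sph_mul_maxCompact X g x (iwahori_le_maxCompact hx))
  have hmem : ∀ g, ρ g (fun y => a g * sph X y) ∈ genSub ρ :=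
    fun g => genSub_le ρ g (mem_genSub (hfixs (a g)))
  have hsum : (⟨f, mem_genSub hfix⟩ : genSub ρ) =
      ∑ g ∈ a.support, (⟨ρ g (fun y => a g * sph X y), hmem g⟩ : genSub ρ) := by
    refine Subtype.ext ?_
    rw [AddSubmonoidClass.coe_finsetSum]
    exact ha.symm
  have h1 := centreAct_genRep z ρ 1 hfix (by simpa using mem_genSub hfix)
  simp only [map_one, Module.End.one_apply] at h1
  have h2 : (genSub ρ).subtype (centreAct z (genRep ρ) (genRep_mem ρ)
      (⟨f, mem_genSub hfix⟩ : genSub ρ)) = ∑ g ∈ a.support,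
        ρ g ((heckeCoeff z).sum fun y c => c • ρ y.out fun y => a g * sph X y) := by
    rw [hsum]
    refine (congrArg (genSub ρ).subtype (map_sum (centreAct z (genRep ρ) (genRep_mem ρ))
      (fun g => (⟨ρ g (fun y => a g * sph X y), hmem g⟩ : genSub ρ)) a.support)).trans ?_
    refine (map_sum (genSub ρ).subtype _ _).trans ?_
    exact Finset.sum_congr rfl fun g _ => centreAct_genRep z ρ g (hfixs (a g)) (hmem g)
  rw [h1] at h2
  have h3 := congrFun h2 x
  rw [Finsupp.sum_apply'] at h3
  have h4 : ((heckeCoeff z).sum fun y c => algebraMap E C c * f (x * y.out)) =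
      (heckeCoeff z).sum fun y c => (c • ρ y.out f) x :=
    Finsupp.sum_congr fun y _ => (Algebra.smul_def _ _).symm
  rw [h4, h3, ← ha, Finset.sum_apply, Finsupp.sum, Finset.sum_apply, Finset.mul_sum]
  refine Finset.sum_congr rfl fun g _ => ?_
  change ((heckeCoeff z).sum fun y c => c • ρ y.out fun y => a g * sph X y) (x * g) =
    satake r ϖ X * (a g * sph X (x * g))
  rw [mul_left_comm, ← hecke_sph hz X (x * g), Finsupp.sum_apply', Finsupp.mul_sum]
  refine Finsupp.sum_congr fun y _ => ?_
  change (heckeCoeff z) y • (a g * sph X (x * g * y.out)) = _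
  rw [Algebra.smul_def]
  ring

end HeckeEigen

/-! ### Deforming the parameters of a principal series -/

section Deformation

variable {F : Type u} [Field F] [ValuativeRel F] [TopologicalSpace F]
  [IsNonarchimedeanLocalField F] {n : ℕ} {C : Type u} [Field C]

/-- The element of the principal series with parameters `Y` that has the same restriction to
`GL_n(𝒪_F)` as `f`. -/
noncomputable def deform (Y : Fin n → Cˣ) (f : GL (Fin n) F → C) (g : GL (Fin n) F) : C :=
  (monom Y (height g) : Cˣ) * f (iwasawaK g)

/-- The ambiguity of an Iwasawa decomposition lies in `borel F n ∩ maxCompact F n`. There `monom X`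
is trivial for every `X`, so `f` restricted to `K` does not see the ambiguity and any other
parameters may be used. -/
theorem deform_eq {X : Fin n → Cˣ} {f : GL (Fin n) F → C} (hf : IsPS X f) (Y : Fin n → Cˣ)
    {b k : GL (Fin n) F} (hb : b ∈ borel F n) (hk : k ∈ maxCompact F n) :
    deform Y f (b * k) = (monom Y (diagOrd b) : Cˣ) * f k := by
  rw [deform, height_eq hb hk rfl]
  congr 1
  have h : iwasawaK (b * k) = ((iwasawaB (b * k))⁻¹ * b) * k := by rw [iwasawaK, mul_assoc]
  have hB : (iwasawaB (b * k))⁻¹ * b ∈ borel F n := mul_mem (inv_mem (iwasawaB_mem _)) hb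
  have hK : (iwasawaB (b * k))⁻¹ * b ∈ maxCompact F n := by
    rw [← Subgroup.mul_mem_cancel_right _ hk, ← h]
    exact iwasawaK_mem _
  rw [h, hf _ hB, diagOrd_eq_zero hB hK, monom_zero, Units.val_one, one_mul]

theorem deform_isPS {X : Fin n → Cˣ} {f : GL (Fin n) F → C} (hf : IsPS X f) (Y : Fin n → Cˣ) :
    IsPS Y (deform Y f) := by
  intro b hb g
  have h : b * g = (b * iwasawaB g) * iwasawaK g := by rw [mul_assoc, iwasawa_mul]
  rw [h, deform_eq hf Y (mul_mem hb (iwasawaB_mem g)) (iwasawaK_mem g),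
    diagOrd_mul hb (iwasawaB_mem g), monom_add, Units.val_mul, mul_assoc]
  rfl

theorem deform_iwInv {X : Fin n → Cˣ} {f : GL (Fin n) F → C} (hf : IsPS X f) (hI : IwInv f)
    (Y : Fin n → Cˣ) : IwInv (deform Y f) := by
  intro g x hx
  have h : g * x = iwasawaB g * (iwasawaK g * x) := by rw [← mul_assoc, iwasawa_mul]
  rw [h, deform_eq hf Y (iwasawaB_mem g) (mul_mem (iwasawaK_mem g) (iwahori_le_maxCompact hx)),
    hI _ x hx]
  rfl

theorem deform_self {X : Fin n → Cˣ} {f : GL (Fin n) F → C} (hf : IsPS X f) : deform X f = f := by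
  ext g
  conv_rhs => rw [← iwasawa_mul g]
  rw [hf _ (iwasawaB_mem g)]
  rfl

variable {E : Type u} [Field E] [Algebra E C] [CharZero C]
  {r : ℕ} {ϖ : Fˣ} {z : BernsteinCentre F E n}

/-- A central element that acts on `c-Ind_K^G 1` as the double coset operator acts on the Iwahori
invariants of every unramified principal series as multiplication by a scalar. -/
theorem hecke_eigen (hϖ : ord ϖ = 1)
    (hz : centreAct z (cInd F E n) cInd_mem = doubleCosetOp (heckeElement n r ϖ))
    {X : Fin n → Cˣ} {f : GL (Fin n) F → C} (hf : IsPS X f) (hI : IwInv f) (x : GL (Fin n) F) :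
    ((heckeCoeff z).sum fun y c => algebraMap E C c * f (x * y.out)) = satake r ϖ X * f x := by
  obtain ⟨A, hA, hspan⟩ := mem_span_sph (F := F) hϖ n C
  -- With the values of `f` on `K` as coefficients and Iwasawa exponents as exponents, both sides
  -- are Laurent polynomials in the parameters. For rapidly growing parameters they agree by
  -- `hecke_eigen_of_mem_span`.
  have key := laurent_ext (C := C) (s := (heckeCoeff z).support) (s' := heckeOrbit n r ϖ)
    (a := fun y => algebraMap E C (heckeCoeff z y) * f (iwasawaK (x * y.out)))
    (a' := fun _ => f (iwasawaK x)) (ν := fun y => height (x * y.out))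
    (ν' := fun y => height y.out + height x) hA (L := ∑ i : Fin n, (i : ℕ)) (fun Y hY hYA => ?_) X
  · have h : ∀ g, f g = (monom X (height g) : Cˣ) * f (iwasawaK g) :=
      fun g => (congrFun (deform_self hf) g).symm
    calc ((heckeCoeff z).sum fun y c => algebraMap E C c * f (x * y.out))
        = ∑ y ∈ (heckeCoeff z).support, algebraMap E C (heckeCoeff z y) *
            f (iwasawaK (x * y.out)) * (monom X (height (x * y.out)) : Cˣ) := by
          refine Finset.sum_congr rfl fun y _ => ?_
          simp only
          rw [h (x * y.out)]
          ring
      _ = _ := key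
      _ = satake r ϖ X * f x := by
          rw [h x, satake, Finset.sum_mul]
          refine Finset.sum_congr rfl fun y _ => ?_
          rw [monom_add, Units.val_mul, sph]
          ring
  · set Y' : Fin n → Cˣ := fun i => Units.map (algebraMap ℚ C : ℚ →* C) (Y i)
    have h := hecke_eigen_of_mem_span hz Y' (deform_iwInv hf hI Y')
      (hspan Y hY hYA _ (deform_isPS hf Y') (deform_iwInv hf hI Y')) x
    calc ∑ y ∈ (heckeCoeff z).support, algebraMap E C (heckeCoeff z y) *
            f (iwasawaK (x * y.out)) * (monom Y' (height (x * y.out)) : Cˣ)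
        = (heckeCoeff z).sum fun y c => algebraMap E C c * deform Y' f (x * y.out) := by
          refine Finset.sum_congr rfl fun y _ => ?_
          simp only [deform]
          ring
      _ = _ := h
      _ = _ := by
          rw [satake, Finset.sum_mul]
          refine Finset.sum_congr rfl fun y _ => ?_
          rw [monom_add, Units.val_mul, deform, sph]
          ring

end Deformation

/-! ### Cells in the double coset of `diag(ϖ I_r, I_{n-r})` -/

section Cells

variable {F : Type u} [Field F] [ValuativeRel F] [TopologicalSpace F]
  [IsNonarchimedeanLocalField F] {n : ℕ}

/-- The nilpotent matrix with entries `a i j` for `i < j`, `i ∈ J`, `j ∉ J`. -/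
def cellMatrix {R : Type*} [Zero R] (J : Finset (Fin n)) (a : Fin n → Fin n → R) :
    Matrix (Fin n) (Fin n) R :=
  Matrix.of fun i j => if i ∈ J ∧ j ∉ J ∧ i < j then a i j else 0

theorem cellMatrix_apply {R : Type*} [Zero R] (J : Finset (Fin n)) (a : Fin n → Fin n → R)
    (i j : Fin n) : cellMatrix J a i j = if i ∈ J ∧ j ∉ J ∧ i < j then a i j else 0 := rfl

/-- Nonzero entries have row index in `J` and column index outside `J`, so no two of them compose.
-/
theorem cellMatrix_mul {R : Type*} [CommRing R] (J : Finset (Fin n)) (a a' : Fin n → Fin n → R) :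
    cellMatrix J a * cellMatrix J a' = 0 := by
  ext i j
  rw [Matrix.mul_apply]
  refine Finset.sum_eq_zero fun l _ => ?_
  by_cases hl : l ∈ J <;> simp [cellMatrix_apply, hl]

theorem one_add_cellMatrix_isUpperTriangular {R : Type*} [CommRing R] (J : Finset (Fin n))
    (a : Fin n → Fin n → R) : (1 + cellMatrix J a).IsUpperTriangular := by
  intro i j hij
  have hij' : j < i := hij
  simp [cellMatrix_apply, hij'.ne', not_lt.mpr hij'.le]

/-- The unipotent matrix `1 + cellMatrix J a`. -/
def cellGL {R : Type*} [CommRing R] (J : Finset (Fin n)) (a : Fin n → Fin n → R) :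
    GL (Fin n) R where
  val := 1 + cellMatrix J a
  inv := 1 - cellMatrix J a
  val_inv := by
    rw [add_mul, mul_sub, mul_sub, cellMatrix_mul]
    simp
  inv_val := by
    rw [sub_mul, mul_add, mul_add, cellMatrix_mul]
    simp

/-- The image in `GL_n(F)` of the unipotent matrix attached to integral entries. -/
noncomputable def cellF (J : Finset (Fin n)) (a : Fin n → Fin n → 𝒪[F]) : GL (Fin n) F :=
  Matrix.GeneralLinearGroup.map (algebraMap 𝒪[F] F) (cellGL J a)

theorem cellF_val (J : Finset (Fin n)) (a : Fin n → Fin n → 𝒪[F]) :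
    (cellF J a : Matrix (Fin n) (Fin n) F) = 1 + cellMatrix J fun i j => (a i j : F) := by
  change (1 + cellMatrix J a).map (algebraMap 𝒪[F] F) = _
  ext i j
  simp only [Matrix.map_apply, Matrix.add_apply, Matrix.one_apply, cellMatrix_apply, map_add]
  split_ifs <;> simp <;> rfl

theorem cellF_inv_val (J : Finset (Fin n)) (a : Fin n → Fin n → 𝒪[F]) :
    ((cellF J a)⁻¹ : GL (Fin n) F).val = 1 - cellMatrix J fun i j => (a i j : F) := by
  rw [cellF, ← map_inv]
  change (1 - cellMatrix J a).map (algebraMap 𝒪[F] F) = _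
  ext i j
  simp only [Matrix.map_apply, Matrix.sub_apply, Matrix.one_apply, cellMatrix_apply, map_sub]
  split_ifs <;> simp <;> rfl

theorem cellF_mem_maxCompact (J : Finset (Fin n)) (a : Fin n → Fin n → 𝒪[F]) :
    cellF J a ∈ maxCompact F n := ⟨_, rfl⟩

theorem cellF_mem_borel (J : Finset (Fin n)) (a : Fin n → Fin n → 𝒪[F]) :
    cellF J a ∈ borel F n := by
  change ((cellF J a : Matrix (Fin n) (Fin n) F)).IsUpperTriangular
  rw [cellF_val]
  exact one_add_cellMatrix_isUpperTriangular J _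

/-- The diagonal matrix with entries `ϖ` at the indices in `J` and `1` elsewhere. -/
def cellTorus (ϖ : Fˣ) (J : Finset (Fin n)) : GL (Fin n) F :=
  torusGL fun i => if i ∈ J then ϖ else 1

theorem height_cell {ϖ : Fˣ} (hϖ : ord ϖ = 1) (J : Finset (Fin n)) (a : Fin n → Fin n → 𝒪[F]) :
    height (cellF J a * cellTorus ϖ J) = fun i => if i ∈ J then 1 else 0 := by
  rw [height_borel_mul (cellF_mem_borel J a), diagOrd_eq_zero (cellF_mem_borel J a)
    (cellF_mem_maxCompact J a), zero_add, cellTorus, height_of_borel (torusGL_mem _)]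
  ext i
  rw [diagOrd_torusGL]
  split_ifs
  · exact hϖ
  · exact ord_one

theorem sph_cell {ϖ : Fˣ} (hϖ : ord ϖ = 1) (J : Finset (Fin n)) (a : Fin n → Fin n → 𝒪[F])
    {C : Type*} [Field C] (X : Fin n → Cˣ) :
    sph X (cellF J a * cellTorus ϖ J) = ∏ i ∈ J, (X i : C) := by
  rw [sph, height_cell hϖ, monom, Units.coe_prod, ← Finset.prod_subset (Finset.subset_univ J)]
  · exact Finset.prod_congr rfl fun i hi => by simp [hi]
  · intro i _ hi
    simp [hi]

theorem exists_perm_image {r : ℕ} (J : Finset (Fin n)) (hJ : J.card = r) :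
    ∃ w : Equiv.Perm (Fin n), ∀ j, w j ∈ J ↔ (j : ℕ) < r := by
  have hr : r ≤ n := by
    rw [← hJ]
    simpa using Finset.card_le_univ J
  have hcard : Fintype.card {j : Fin n // (j : ℕ) < r} = Fintype.card {j // j ∈ J} := by
    rw [Fintype.card_coe, hJ, Fintype.card_subtype]
    have : (Finset.univ.filter fun j : Fin n => (j : ℕ) < r).map Fin.valEmbedding =
        Finset.range r := by
      ext m
      simp only [Finset.mem_map, Finset.mem_filter, Finset.mem_univ, true_and,
        Fin.valEmbedding_apply, Finset.mem_range]
      constructor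
      · rintro ⟨j, hj, rfl⟩
        exact hj
      · intro hm
        exact ⟨⟨m, by omega⟩, hm, rfl⟩
    rw [← Finset.card_map Fin.valEmbedding, this, Finset.card_range]
  let e := Fintype.equivOfCardEq hcard
  refine ⟨e.extendSubtype, fun j => ⟨fun h => ?_, fun h => e.extendSubtype_mem j h⟩⟩
  by_contra hn
  exact e.extendSubtype_not_mem j hn h

/-- A permutation matrix in `K` carries the standard torus element to the one with `ϖ` at the places
in `J`. -/
theorem cell_mem_heckeOrbit {ϖ : Fˣ} {r : ℕ} (J : Finset (Fin n)) (hJ : J.card = r)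
    (a : Fin n → Fin n → 𝒪[F]) :
    ((cellF J a * cellTorus ϖ J : GL (Fin n) F) : GL (Fin n) F ⧸ maxCompact F n) ∈
      heckeOrbit n r ϖ := by
  obtain ⟨w, hw⟩ := exists_perm_image J hJ
  have hcomm : cellTorus ϖ J * permGL F w = permGL F w * heckeElement n r ϖ := by
    have hh : heckeElement n r ϖ = torusGL fun i : Fin n => if (i : ℕ) < r then ϖ else 1 := rfl
    refine Units.ext ?_
    rw [Units.val_mul, Units.val_mul, cellTorus, torusGL_val, hh, torusGL_val]
    ext i j
    rw [mul_permGL_apply, Matrix.mul_diagonal]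
    change _ = (1 : Matrix (Fin n) (Fin n) F) i (w j) * _
    rw [Matrix.diagonal_apply, Matrix.one_apply]
    by_cases h : i = w j
    · subst h
      simp only [if_true, one_mul, hw]
    · simp [h]
  rw [heckeOrbit, Set.Finite.mem_toFinset]
  refine ⟨⟨cellF J a * permGL F w, mul_mem (cellF_mem_maxCompact J a) (permGL_mem w)⟩, ?_⟩
  change ((cellF J a * permGL F w * heckeElement n r ϖ : GL (Fin n) F) :
    GL (Fin n) F ⧸ maxCompact F n) = _
  rw [mul_assoc, ← hcomm, ← mul_assoc]
  refine (QuotientGroup.eq.mpr ?_).symm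
  rw [inv_mul_cancel_left]
  exact permGL_mem w

/-- If the cosets agree through an integral matrix `k`, comparing the entries at `(i, j)` gives `a'
i j - a i j = ϖ * k i j`. -/
theorem cell_injective {ϖ : Fˣ} (hϖ : ord ϖ = 1) {J : Finset (Fin n)}
    {a a' : Fin n → Fin n → 𝒪[F]}
    (h : ((cellF J a * cellTorus ϖ J : GL (Fin n) F) : GL (Fin n) F ⧸ maxCompact F n) =
      (cellF J a' * cellTorus ϖ J : GL (Fin n) F)) {i j : Fin n} (hi : i ∈ J) (hj : j ∉ J)
    (hij : i < j) : IsLocalRing.residue 𝒪[F] (a i j) = IsLocalRing.residue 𝒪[F] (a' i j) := by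
  have hk := QuotientGroup.eq.mp h
  set k := (cellF J a * cellTorus ϖ J)⁻¹ * (cellF J a' * cellTorus ϖ J) with hkdef
  have h1 : (cellTorus ϖ J * k : GL (Fin n) F) = (cellF J a)⁻¹ * cellF J a' * cellTorus ϖ J := by
    rw [hkdef]
    group
  have h2 := congrArg (fun g : GL (Fin n) F => (g : Matrix (Fin n) (Fin n) F) i j) h1
  simp only [Units.val_mul] at h2
  rw [cellF_val, cellF_inv_val, cellTorus, torusGL_val, Matrix.diagonal_mul, Matrix.mul_diagonal,
    sub_mul, mul_add, mul_add, cellMatrix_mul, if_pos hi, if_neg hj] at h2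
  simp only [one_mul, mul_one, add_zero, Units.val_one, Matrix.sub_apply, Matrix.add_apply,
    Matrix.one_apply, hij.ne, if_false, zero_add, cellMatrix_apply, hi, hj, hij, not_false_eq_true,
    and_self, if_true] at h2
  rw [← sub_eq_zero, ← map_sub, ← neg_eq_zero, ← map_neg, neg_sub, residue_eq_zero_iff_valuation]
  have h3 : ((a' i j - a i j : 𝒪[F]) : F) = (ϖ : F) * (k : Matrix (Fin n) (Fin n) F) i j := by
    rw [h2]
    push_cast
    ring
  rw [h3, map_mul]
  refine mul_lt_one_of_lt_of_le ?_ (((mem_intGL_iff (ι := Fin n)).mp hk).1 i j)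
  rw [← vord_pos ϖ.ne_zero, ← ord_eq_vord, hϖ]
  exact one_pos

end Cells

/-! ### Counting cosets: the Satake value as an elementary symmetric function -/

section Count

variable {F : Type u} [Field F] [ValuativeRel F] [TopologicalSpace F]
  [IsNonarchimedeanLocalField F] {n : ℕ}

/-- In an upper triangular matrix `B` with `A B = 0`, the rows whose diagonal entry in `A` is
invertible are combinations of the later ones among the others. -/
theorem row_mem_span {κ : Type*} [Field κ] {A B : Matrix (Fin n) (Fin n) κ}
    (hA : A.IsUpperTriangular) (hAB : A * B = 0) {J : Finset (Fin n)}
    (hJ : ∀ i ∈ J, A i i ≠ 0) (i : Fin n) (hi : i ∈ J) :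
    B i ∈ Submodule.span κ (B '' {l | i < l ∧ l ∉ J}) := by
  induction hd : n - (i : ℕ) using Nat.strong_induction_on generalizing i with
  | _ d ih =>
    have hrow : ∑ l, A i l • B l = 0 := by
      ext j
      have := congrFun (congrFun hAB i) j
      rw [Matrix.mul_apply] at this
      simpa [Finset.sum_apply] using this
    -- Row `i` of `A * B = 0` is solved for `B i`. Only later rows occur, and those with index in
    -- `J` are eliminated by induction from the bottom.
    rw [← Finset.add_sum_erase _ _ (Finset.mem_univ i), add_eq_zero_iff_eq_neg] at hrow
    rw [← inv_smul_smul₀ (hJ i hi) (B i), hrow]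
    refine Submodule.smul_mem _ _ (Submodule.neg_mem _ (Submodule.sum_mem _ fun l hl => ?_))
    rcases lt_or_gt_of_ne (Finset.ne_of_mem_erase hl) with h | h
    · rw [hA h, zero_smul]
      exact Submodule.zero_mem _
    · refine Submodule.smul_mem _ _ ?_
      by_cases hlJ : l ∈ J
      · refine Submodule.span_mono (Set.image_mono ?_) (ih (n - (l : ℕ)) ?_ l hlJ rfl)
        · rintro m ⟨hm, hm'⟩
          exact ⟨h.trans hm, hm'⟩
        · have : (i : ℕ) < l := h
          have := l.2
          omega
      · exact Submodule.subset_span ⟨l, ⟨h, hlJ⟩, rfl⟩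

theorem exists_coeff {κ : Type*} [Field κ] {A B : Matrix (Fin n) (Fin n) κ}
    (hA : A.IsUpperTriangular) (hAB : A * B = 0) {J : Finset (Fin n)}
    (hJ : ∀ i ∈ J, A i i ≠ 0) : ∃ c : Fin n → Fin n → κ, ∀ i ∈ J, ∀ j,
      B i j = ∑ l, cellMatrix J c i l * B l j := by
  have h : ∀ i, ∃ c : Fin n → κ, i ∈ J → ∀ j,
      B i j = ∑ l, (if l ∉ J ∧ i < l then c l else 0) * B l j := by
    intro i
    by_cases hi : i ∈ J
    · obtain ⟨c, hc, hB⟩ := (Finsupp.mem_span_image_iff_linearCombination κ).mp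
        (row_mem_span hA hAB hJ i hi)
      refine ⟨c, fun _ j => ?_⟩
      have hB' := congrFun hB j
      have hB'' : (Finsupp.linearCombination κ B) c j = ∑ l, c l * B l j := by
        have h := Finsupp.linearCombination_apply κ (v := fun l => B l) c
        rw [Finsupp.sum_fintype _ _ (by simp)] at h
        refine (congrFun h j).trans ?_
        rw [Finset.sum_apply]
        rfl
      refine (hB''.symm.trans hB').symm.trans (Finset.sum_congr rfl fun l _ => ?_)
      by_cases hl : l ∉ J ∧ i < l
      · rw [if_pos hl]
      · have : c l = 0 := by
          by_contra hne
          exact hl (And.symm (hc (Finsupp.mem_support_iff.mpr hne)))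
        rw [if_neg hl, this]
    · exact ⟨0, fun h => absurd h hi⟩
  choose c hc using h
  refine ⟨c, fun i hi j => ?_⟩
  rw [hc i hi j]
  refine Finset.sum_congr rfl fun l _ => ?_
  rw [cellMatrix_apply]
  simp [hi]

/-- A triangular representative `b` of the coset and `ϖ b⁻¹` are both integral, so the diagonal
valuations of `b` are `0` or `1`, and `J` collects the places with value `1`. The reductions `A` of
`ϖ b⁻¹` and `B` of `b` satisfy `A B = 0`, and `A` has nonzero diagonal entries on `J`; hence
`exists_coeff` expresses the rows of `B` in `J` through later rows outside `J`. These coefficients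
are the coordinates of the cell. -/
theorem exists_cell {ϖ : Fˣ} (hϖ : ord ϖ = 1) {r : ℕ} (hr : r ≤ n)
    {y : GL (Fin n) F ⧸ maxCompact F n} (hy : y ∈ heckeOrbit n r ϖ) :
    ∃ J : Finset (Fin n), J.card = r ∧ ∃ c : Fin n → Fin n → 𝓀[F],
      ∀ a : Fin n → Fin n → 𝒪[F], (∀ i j, IsLocalRing.residue 𝒪[F] (a i j) = c i j) →
        y = ((cellF J a * cellTorus ϖ J : GL (Fin n) F) : GL (Fin n) F ⧸ maxCompact F n) := by
  rw [heckeOrbit, Set.Finite.mem_toFinset] at hy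
  obtain ⟨⟨k, hk⟩, rfl⟩ := hy
  set g := k * heckeElement n r ϖ with hg
  set b := iwasawaB g with hb
  have hbB : b ∈ borel F n := iwasawaB_mem g
  have hbg : b = g * (iwasawaK g)⁻¹ := by rw [eq_mul_inv_iff_mul_eq, iwasawa_mul]
  have hh : heckeElement n r ϖ = torusGL fun i : Fin n => if (i : ℕ) < r then ϖ else 1 := rfl
  have hϖ1 : valuation F (ϖ : F) ≤ 1 := by
    rw [← vord_nonneg ϖ.ne_zero, ← ord_eq_vord, hϖ]
    exact zero_le_one
  have hle : ∀ i j, valuation F ((b : Matrix (Fin n) (Fin n) F) i j) ≤ 1 := by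
    rw [hbg, hg, Units.val_mul, Units.val_mul]
    refine valuation_mul_apply_le (valuation_mul_apply_le ((mem_intGL_iff (ι := Fin n)).mp hk).1
      fun i j => ?_) ((mem_intGL_iff (ι := Fin n)).mp (inv_mem (iwasawaK_mem g))).1
    rw [hh, torusGL_val, Matrix.diagonal_apply]
    split_ifs <;> simp [hϖ1]
  -- This exhibits `ϖ b⁻¹` as a product of integral matrices, since `ϖ diag(ϖ I_r, 1)⁻¹` is
  -- integral.
  have hbinv : (ϖ : F) • ((b⁻¹ : GL (Fin n) F) : Matrix (Fin n) (Fin n) F) =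
      (iwasawaK g : Matrix (Fin n) (Fin n) F) * ((torusGL fun i : Fin n =>
        if (i : ℕ) < r then 1 else ϖ : GL (Fin n) F) : Matrix (Fin n) (Fin n) F) *
          ((k⁻¹ : GL (Fin n) F) : Matrix (Fin n) (Fin n) F) := by
    have h1 : b⁻¹ = iwasawaK g * (heckeElement n r ϖ)⁻¹ * k⁻¹ := by
      rw [hbg, hg]
      group
    have h2 : ((torusGL fun i : Fin n => if (i : ℕ) < r then 1 else ϖ : GL (Fin n) F) :
        Matrix (Fin n) (Fin n) F) =
        (ϖ : F) • (((heckeElement n r ϖ)⁻¹ : GL (Fin n) F) : Matrix (Fin n) (Fin n) F) := by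
      have h3 : (heckeElement n r ϖ)⁻¹ =
          torusGL fun i : Fin n => if (i : ℕ) < r then ϖ⁻¹ else 1 := by
        rw [inv_eq_iff_mul_eq_one, hh]
        refine Units.ext ?_
        rw [Units.val_mul, torusGL_val, torusGL_val, Matrix.diagonal_mul_diagonal, Units.val_one,
          ← Matrix.diagonal_one]
        congr 1
        ext i
        split_ifs <;> simp
      rw [h3, torusGL_val, torusGL_val, ← Matrix.diagonal_smul]
      congr 1
      ext i
      simp only [Pi.smul_apply, smul_eq_mul]
      split_ifs <;> simp
    rw [h1, h2, Units.val_mul, Units.val_mul, Matrix.mul_smul, Matrix.smul_mul]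
  have hle' : ∀ i j,
      valuation F (((ϖ : F) • ((b⁻¹ : GL (Fin n) F) : Matrix (Fin n) (Fin n) F)) i j) ≤ 1 := by
    rw [hbinv]
    refine valuation_mul_apply_le (valuation_mul_apply_le
      ((mem_intGL_iff (ι := Fin n)).mp (iwasawaK_mem g)).1
      fun i j => ?_) ((mem_intGL_iff (ι := Fin n)).mp (inv_mem hk)).1
    rw [torusGL_val, Matrix.diagonal_apply]
    split_ifs <;> simp [hϖ1]
  have hdiag0 : ∀ i, 0 ≤ diagOrd b i :=
    fun i => (vord_nonneg (borel_diag_ne_zero hbB i)).mpr (hle i i)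
  have hdinv : ∀ i, vord (((ϖ : F) • ((b⁻¹ : GL (Fin n) F) : Matrix (Fin n) (Fin n) F)) i i) =
      1 - diagOrd b i := by
    intro i
    rw [Matrix.smul_apply, smul_eq_mul, vord_mul ϖ.ne_zero (borel_diag_ne_zero (inv_mem hbB) i),
      ← ord_eq_vord, hϖ]
    have := congrFun (diagOrd_inv hbB) i
    change 1 + diagOrd b⁻¹ i = _
    rw [this, Pi.neg_apply]
    ring
  have hdinv0 : ∀ i, ((ϖ : F) • ((b⁻¹ : GL (Fin n) F) : Matrix (Fin n) (Fin n) F)) i i ≠ 0 :=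
    fun i => mul_ne_zero ϖ.ne_zero (borel_diag_ne_zero (inv_mem hbB) i)
  have hdiag1 : ∀ i, diagOrd b i ≤ 1 := by
    intro i
    have := (vord_nonneg (hdinv0 i)).mpr (hle' i i)
    rw [hdinv] at this
    linarith
  let J : Finset (Fin n) := Finset.univ.filter fun i => diagOrd b i = 1
  have hdiagJ : ∀ i, diagOrd b i = if i ∈ J then 1 else 0 := by
    intro i
    have h0 := hdiag0 i
    have h1 := hdiag1 i
    by_cases h : diagOrd b i = 1
    · simp [J, h]
    · simp only [J, Finset.mem_filter, Finset.mem_univ, true_and, h, if_false]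
      omega
  have hsum : ∑ i, diagOrd b i = r := by
    have h1 : ∑ i, height g i = vord (g : Matrix (Fin n) (Fin n) F).det := sum_height g
    change ∑ i, height g i = _
    rw [h1, hg, Units.val_mul, Matrix.det_mul,
      vord_mul ((Matrix.isUnit_iff_isUnit_det _).mp k.isUnit).ne_zero
        ((Matrix.isUnit_iff_isUnit_det _).mp (heckeElement n r ϖ).isUnit).ne_zero,
      vord_det_maxCompact hk, zero_add, ← sum_height, hh, height_of_borel (torusGL_mem _)]
    simp only [diagOrd_torusGL]
    have h2 : ∀ i : Fin n, ord (if (i : ℕ) < r then ϖ else 1) = if (i : ℕ) < r then 1 else 0 := by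
      intro i
      split_ifs
      · exact hϖ
      · exact ord_one
    simp only [h2, Finset.sum_boole, Fin.card_filter_val_lt, min_eq_right hr]
  have hJcard : J.card = r := by
    have : ∑ i, diagOrd b i = (J.card : ℤ) := by
      simp only [hdiagJ]
      simp
    exact_mod_cast this.symm.trans hsum
  let B : Matrix (Fin n) (Fin n) 𝒪[F] := Matrix.of fun i j => ⟨_, hle i j⟩
  let A : Matrix (Fin n) (Fin n) 𝒪[F] := Matrix.of fun i j => ⟨_, hle' i j⟩
  have hAB : A.map (IsLocalRing.residue 𝒪[F]) * B.map (IsLocalRing.residue 𝒪[F]) = 0 := by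
    rw [← Matrix.map_mul]
    ext i j
    rw [Matrix.map_apply, Matrix.zero_apply, residue_eq_zero_iff_valuation]
    have h1 : (((A * B) i j : 𝒪[F]) : F) = (ϖ : F) * (1 : Matrix (Fin n) (Fin n) F) i j := by
      have h2 : (A * B).map (algebraMap 𝒪[F] F) =
          ((ϖ : F) • ((b⁻¹ : GL (Fin n) F) : Matrix (Fin n) (Fin n) F)) *
            (b : Matrix (Fin n) (Fin n) F) := by
        rw [Matrix.map_mul]
        rfl
      rw [Matrix.smul_mul, ← Units.val_mul, inv_mul_cancel] at h2
      exact congrFun (congrFun h2 i) j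
    rw [h1, map_mul]
    refine mul_lt_one_of_lt_of_le ?_ ?_
    · rw [← vord_pos ϖ.ne_zero, ← ord_eq_vord, hϖ]
      exact one_pos
    · rw [Matrix.one_apply]
      split_ifs <;> simp
  have hAt : (A.map (IsLocalRing.residue 𝒪[F])).IsUpperTriangular := by
    intro i j hij
    have h1 : A i j = 0 := by
      refine Subtype.ext ?_
      change (ϖ : F) * ((b⁻¹ : GL (Fin n) F) : Matrix (Fin n) (Fin n) F) i j = 0
      rw [(inv_mem hbB : b⁻¹ ∈ borel F n) hij, mul_zero]
    rw [Matrix.map_apply, h1, map_zero]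
  have hAJ : ∀ i ∈ J, (A.map (IsLocalRing.residue 𝒪[F])) i i ≠ 0 := by
    intro i hi h0
    rw [Matrix.map_apply, residue_eq_zero_iff_valuation] at h0
    have h1 := (vord_pos (hdinv0 i)).mpr h0
    rw [hdinv, hdiagJ, if_pos hi] at h1
    omega
  obtain ⟨c, hc⟩ := exists_coeff hAt hAB hAJ
  refine ⟨J, hJcard, c, fun a ha => ?_⟩
  have hbq : ((k * heckeElement n r ϖ : GL (Fin n) F) : GL (Fin n) F ⧸ maxCompact F n) = b := by
    refine (QuotientGroup.eq.mpr ?_).symm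
    exact iwasawaK_mem g
  refine hbq.trans ?_
  refine (QuotientGroup.eq.mpr ?_).symm
  have hcB : cellF J a * cellTorus ϖ J ∈ borel F n :=
    mul_mem (cellF_mem_borel J a) (torusGL_mem _)
  -- The two elements have the same Iwasawa exponents, so the quotient has unit determinant and only
  -- the integrality of its entries is left.
  have hdet : vord (((cellF J a * cellTorus ϖ J)⁻¹ * b : GL (Fin n) F) :
      Matrix (Fin n) (Fin n) F).det = 0 := by
    have h2 : height ((cellF J a * cellTorus ϖ J)⁻¹ * b) = 0 := by
      rw [height_borel_mul (inv_mem hcB), diagOrd_inv hcB, ← height_of_borel hcB, height_cell hϖ,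
        height_of_borel hbB]
      ext i
      simp [hdiagJ]
    rw [← sum_height, h2]
    simp
  refine (mem_intGL_iff (ι := Fin n)).mpr ⟨fun i j => ?_, ?_⟩
  -- Row `i` of the quotient is row `i` of `B` minus the combination of later rows given by the
  -- cell, divided by `ϖ` when `i ∈ J`. The choice of `c` makes this divisible.
  · have h1 : (((cellF J a * cellTorus ϖ J)⁻¹ * b : GL (Fin n) F) :
        Matrix (Fin n) (Fin n) F) i j = (((if i ∈ J then ϖ else 1 : Fˣ)⁻¹ : Fˣ) : F) *
          ((B i j - ∑ l, cellMatrix J a i l * B l j : 𝒪[F]) : F) := by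
      have h2 : cellTorus ϖ J * ((cellF J a * cellTorus ϖ J)⁻¹ * b) = (cellF J a)⁻¹ * b := by
        group
      have h3 := congrArg (fun g : GL (Fin n) F => (g : Matrix (Fin n) (Fin n) F) i j) h2
      simp only [Units.val_mul (cellTorus ϖ J), Units.val_mul (cellF J a)⁻¹] at h3
      rw [cellF_inv_val, cellTorus, torusGL_val, Matrix.diagonal_mul, sub_mul, one_mul] at h3
      rw [← cellTorus] at h3
      rw [eq_comm, Units.inv_mul_eq_iff_eq_mul, h3, Matrix.sub_apply, Matrix.mul_apply]
      push_cast
      congr 1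
      refine Finset.sum_congr rfl fun l _ => ?_
      congr 1
      simp only [cellMatrix_apply]
      split_ifs <;> rfl
    rw [h1]
    by_cases hi : i ∈ J
    · rw [if_pos hi, Units.val_inv_eq_inv_val]
      refine dvd_of_valuation_lt_one ϖ.ne_zero hϖ ?_
      rw [← residue_eq_zero_iff_valuation, map_sub, sub_eq_zero, map_sum]
      refine (hc i hi j).trans (Finset.sum_congr rfl fun l _ => ?_)
      rw [map_mul]
      congr 1
      simp only [cellMatrix_apply]
      split_ifs
      · exact (ha i l).symm
      · exact (map_zero _).symm
    · rw [if_neg hi, inv_one, Units.val_one, one_mul]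
      exact (B i j - ∑ l, cellMatrix J a i l * B l j).2
  · exact (vord_eq_zero ((Matrix.isUnit_iff_isUnit_det _).mp (Units.isUnit _)).ne_zero).mp hdet

/-- The index pairs of the nontrivial entries of the cell attached to `J`. -/
def cellPairs (J : Finset (Fin n)) : Finset (Fin n × Fin n) :=
  Finset.univ.filter fun x => x.1 ∈ J ∧ x.2 ∉ J ∧ x.1 < x.2

/-- The cosets correspond to a subset `J` of size `r` together with an element of the residue field
for each pair in `cellPairs J`, and `sph X` is constant on the cell of `J`. -/
theorem satake_eq_sum {ϖ : Fˣ} (hϖ : ord ϖ = 1) {r : ℕ} (hr : r ≤ n) {C : Type*} [Field C]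
    (X : Fin n → Cˣ) : satake r ϖ X = ∑ J ∈ Finset.powersetCard r (Finset.univ : Finset (Fin n)),
      (resCard F : C) ^ (cellPairs J).card * ∏ i ∈ J, (X i : C) := by
  classical
  have : Finite 𝓀[F] := inferInstance
  have := Fintype.ofFinite 𝓀[F]
  let ℓ : 𝓀[F] → 𝒪[F] := Function.surjInv IsLocalRing.residue_surjective
  have hℓ : ∀ x, IsLocalRing.residue 𝒪[F] (ℓ x) = x :=
    Function.surjInv_eq IsLocalRing.residue_surjective
  let ext (J : Finset (Fin n)) (c : cellPairs J → 𝓀[F]) (i j : Fin n) : 𝒪[F] :=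
    if h : (i, j) ∈ cellPairs J then ℓ (c ⟨(i, j), h⟩) else 0
  let cell (x : Σ J : Finset (Fin n), cellPairs J → 𝓀[F]) : GL (Fin n) F :=
    cellF x.1 (ext x.1 x.2) * cellTorus ϖ x.1
  have hcell : ∀ x, sph X (cell x) = ∏ i ∈ x.1, (X i : C) := fun x => sph_cell hϖ _ _ X
  have hsum : satake r ϖ X = ∑ x ∈ (Finset.powersetCard r (Finset.univ : Finset (Fin n))).sigma
      fun J => (Finset.univ : Finset (cellPairs J → 𝓀[F])), ∏ i ∈ x.1, (X i : C) := by
    refine (Finset.sum_bij (fun x _ => (cell x : GL (Fin n) F ⧸ maxCompact F n))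
      ?_ ?_ ?_ ?_).symm
    · intro x hx
      exact cell_mem_heckeOrbit _ (Finset.mem_powersetCard.mp (Finset.mem_sigma.mp hx).1).2 _
    · rintro ⟨J, c⟩ hx ⟨J', c'⟩ hx' h
      -- The Iwasawa exponents of a coset are the indicator function of `J`.
      have hJ : J = J' := by
        obtain ⟨k, hk, hkc⟩ : ∃ k ∈ maxCompact F n, cell ⟨J', c'⟩ = cell ⟨J, c⟩ * k :=
          ⟨_, QuotientGroup.eq.mp h, by group⟩
        have h1 := height_mul_maxCompact (cell ⟨J, c⟩) hk
        rw [← hkc] at h1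
        have h2 : height (cell ⟨J, c⟩) = fun i => if i ∈ J then 1 else 0 := height_cell hϖ J _
        have h3 : height (cell ⟨J', c'⟩) = fun i => if i ∈ J' then 1 else 0 := height_cell hϖ J' _
        rw [h2, h3] at h1
        ext i
        have := congrFun h1 i
        by_cases ha : i ∈ J <;> by_cases hb : i ∈ J' <;> simp_all
      subst hJ
      congr 1
      funext ⟨⟨i, j⟩, hij⟩
      have hij' := hij
      simp only [cellPairs, Finset.mem_filter, Finset.mem_univ, true_and] at hij'
      have := cell_injective hϖ h hij'.1 hij'.2.1 hij'.2.2
      simpa only [ext, dif_pos hij, hℓ] using this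
    · intro y hy
      obtain ⟨J, hJ, c, hc⟩ := exists_cell hϖ hr hy
      refine ⟨⟨J, fun x => c x.1.1 x.1.2⟩, ?_, ?_⟩
      · simp [hJ]
      · have h1 : cell ⟨J, fun x => c x.1.1 x.1.2⟩ =
            cellF J (fun i j => ℓ (c i j)) * cellTorus ϖ J := by
          change cellF J _ * _ = _
          congr 1
          refine Units.ext ?_
          rw [cellF_val, cellF_val]
          congr 1
          ext i j
          simp only [cellMatrix_apply]
          split_ifs with h
          · have : (i, j) ∈ cellPairs J := by simpa [cellPairs] using h
            simp only [ext, dif_pos this]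
          · rfl
        rw [h1]
        exact (hc _ fun i j => hℓ _).symm
    · intro x hx
      have := apply_out (K := maxCompact F n) (sph_mul_maxCompact X) 1 (cell x)
      rw [one_mul, one_mul] at this
      rw [this, hcell]
  rw [hsum, Finset.sum_sigma]
  refine Finset.sum_congr rfl fun J _ => ?_
  change ∑ _s : cellPairs J → 𝓀[F], ∏ i ∈ J, (X i : C) = _
  rw [Finset.sum_const, nsmul_eq_mul, Finset.card_univ, Fintype.card_fun, Fintype.card_coe,
    resCard, Nat.card_eq_fintype_card, Nat.cast_pow]

theorem two_mul_card_lt {α : Type*} [LinearOrder α] (J : Finset α) :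
    2 * ((J ×ˢ J).filter fun x => x.1 < x.2).card = J.card * J.card - J.card := by
  have h1 : ((J ×ˢ J).filter fun x => x.2 < x.1).card =
      ((J ×ˢ J).filter fun x => x.1 < x.2).card :=
    Finset.card_equiv (Equiv.prodComm α α) (by simp [and_comm])
  have h2 : J.offDiag = ((J ×ˢ J).filter fun x => x.1 < x.2) ∪
      ((J ×ˢ J).filter fun x => x.2 < x.1) := by
    ext x
    simp only [Finset.mem_offDiag, Finset.mem_union, Finset.mem_filter, Finset.mem_product,
      ne_iff_lt_or_gt]
    tauto
  rw [← Finset.offDiag_card, h2, Finset.card_union_of_disjoint, h1, two_mul]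
  rw [Finset.disjoint_left]
  intro x hx hx'
  simp only [Finset.mem_filter] at hx hx'
  exact lt_asymm hx.2 hx'.2

/-- Both sides count the pairs `i < j` with `i ∈ J`, split on the left according to whether `j ∈ J`.
-/
theorem card_cellPairs_add (J : Finset (Fin n)) :
    (cellPairs J).card + ((J ×ˢ J).filter fun x => x.1 < x.2).card = ∑ i ∈ J, (n - 1 - i) := by
  rw [← Finset.card_union_of_disjoint]
  · have h : cellPairs J ∪ ((J ×ˢ J).filter fun x => x.1 < x.2) =
        (J ×ˢ Finset.univ).filter fun x => x.1 < x.2 := by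
      ext x
      simp only [cellPairs, Finset.mem_union, Finset.mem_filter, Finset.mem_product,
        Finset.mem_univ]
      tauto
    rw [h, Finset.card_filter, Finset.sum_product]
    refine Finset.sum_congr rfl fun i _ => ?_
    rw [← Finset.card_filter, ← Fin.card_Ioi]
    congr 1
    ext j
    simp
  · rw [Finset.disjoint_left]
    intro x hx hx'
    simp only [cellPairs, Finset.mem_filter, Finset.mem_product] at hx hx'
    exact hx.2.2.1 hx'.1.2

/-- The Satake parameter, with the half sum of positive roots and the twist absorbed in the
variables, is an elementary symmetric function. -/
theorem satake_eq_esymm {ϖ : Fˣ} (hϖ : ord ϖ = 1) {r : ℕ} (hr : r ≤ n) {C : Type*} [Field C]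
    {q : Cˣ} (hq : (q : C) = resCard F) (d : Fin n → Cˣ) :
    satake r ϖ (fun j : Fin n => q⁻¹ ^ (n - 1 - (j : ℕ)) * d j) =
      (resCard F : C) ^ ((r : ℤ) * (1 - r) / 2) *
        ∑ J ∈ Finset.powersetCard r (Finset.univ : Finset (Fin n)), ∏ i ∈ J, (d i : C) := by
  rw [satake_eq_sum hϖ hr, Finset.mul_sum]
  refine Finset.sum_congr rfl fun J hJ => ?_
  have hJr : J.card = r := (Finset.mem_powersetCard.mp hJ).2
  simp only [Units.val_mul, Units.val_pow_eq_pow_val, Finset.prod_mul_distrib,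
    Finset.prod_pow_eq_pow_sum]
  rw [← card_cellPairs_add, ← mul_assoc]
  congr 1
  have h1 := two_mul_card_lt J
  set m := ((J ×ˢ J).filter fun x => x.1 < x.2).card
  -- The pairs `i < j` inside `J` are those missing from the cell, which leaves the power `q ^
  -- (-m)`. The product `r * (1 - r)` is even, so the integer division is exact.
  have h2 : (r : ℤ) * (1 - r) / 2 = -(m : ℤ) := by
    rw [hJr] at h1
    have h3 : (2 * m : ℤ) = r * r - r := by
      have : r ≤ r * r := Nat.le_mul_self r
      zify [this] at h1
      exact h1
    rw [show (r : ℤ) * (1 - r) = 2 * -(m : ℤ) by linarith]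
    exact Int.mul_ediv_cancel_left _ two_ne_zero
  rw [h2, ← hq, pow_add, zpow_neg, zpow_natCast, ← mul_assoc, Units.val_inv_eq_inv_val,
    inv_pow, inv_pow, mul_inv_cancel₀ (pow_ne_zero _ q.ne_zero), one_mul]

theorem satake_smul {ϖ : Fˣ} (hϖ : ord ϖ = 1) {r : ℕ} (hr : r ≤ n) {C : Type*} [Field C]
    (m : Cˣ) (X : Fin n → Cˣ) :
    satake r ϖ (fun j => m * X j) = (m : C) ^ r * satake r ϖ X := by
  rw [satake_eq_sum hϖ hr, satake_eq_sum hϖ hr, Finset.mul_sum]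
  refine Finset.sum_congr rfl fun J hJ => ?_
  simp only [Units.val_mul, Finset.prod_mul_distrib, Finset.prod_const,
    (Finset.mem_powersetCard.mp hJ).2]
  ring

end Count

/-! ### Averaging over compact groups -/

section Averaging

variable {C H V W : Type*} [Field C] [CharZero C] [Group H] [TopologicalSpace H]
  [IsTopologicalGroup H] [AddCommGroup V] [Module C V] [AddCommGroup W] [Module C W]

/-- Averaging over a compact group: a vector of a quotient that is fixed lifts to a fixed vector. -/
theorem exists_fixed_lift {ρ : Representation C H V} (hρ : IsSmooth ρ) {S : Subgroup H}
    (hS : IsCompact (S : Set H)) (Q : V →ₗ[C] W) (v : V) (hv : ∀ h ∈ S, Q (ρ h v) = Q v) :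
    ∃ u, Q u = Q v ∧ ∀ h ∈ S, ρ h u = u := by
  obtain ⟨U, hU, hUv⟩ := hρ v
  have hfin : Finite (S ⧸ U.subgroupOf S) := finite_quotient_of_compact hS hU
  have := Fintype.ofFinite (S ⧸ U.subgroupOf S)
  let φ : S → V := fun g => ρ g v
  have hφ : ∀ g, ∀ k ∈ U.subgroupOf S, φ (g * k) = φ g := by
    intro g k hk
    change ρ ((g : H) * k) v = ρ g v
    rw [map_mul, Module.End.mul_apply, hUv _ (Subgroup.mem_subgroupOf.mp hk)]
  have hcard : (Fintype.card (S ⧸ U.subgroupOf S) : C) ≠ 0 :=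
    Nat.cast_ne_zero.mpr Fintype.card_ne_zero
  -- The orbit map of `v` on `S` factors through a finite quotient, so the average is a finite sum,
  -- and characteristic zero allows division by its length.
  refine ⟨(Fintype.card (S ⧸ U.subgroupOf S) : C)⁻¹ • ∑ y : S ⧸ U.subgroupOf S, φ y.out, ?_, ?_⟩
  · have h1 : ∀ y : S ⧸ U.subgroupOf S, Q (φ y.out) = Q v := fun y => hv _ y.out.2
    rw [map_smul, map_sum, Finset.sum_congr rfl fun y _ => h1 y, Finset.sum_const,
      Finset.card_univ, ← Nat.cast_smul_eq_nsmul C, inv_smul_smul₀ hcard]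
  · intro h hh
    rw [map_smul, map_sum]
    congr 1
    refine Fintype.sum_equiv (MulAction.toPerm (⟨h, hh⟩ : S)) _ _ fun y => ?_
    have h1 : MulAction.toPerm (⟨h, hh⟩ : S) y =
        ((⟨h, hh⟩ * y.out : S) : S ⧸ U.subgroupOf S) := by
      conv_lhs => rw [← y.out_eq']
      rfl
    have h2 := apply_out hφ 1 (⟨h, hh⟩ * y.out)
    rw [one_mul, one_mul] at h2
    rw [h1, h2]
    change ρ h (ρ y.out v) = ρ (h * (y.out : S)) v
    rw [map_mul, Module.End.mul_apply]

end Averaging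

/-! ### Separating the points of a tensor product -/

section Separation

variable {C : Type*} [Field C]

/-- The operators of finite rank that are combinations of evaluations. -/
def evalOperators {V Y : Type*} [AddCommGroup V] [Module C V] (ev : Y → V →ₗ[C] C) :
    Submodule C (V →ₗ[C] V) :=
  Submodule.span C {P | ∃ y e, P = (ev y).smulRight e}

/-- Induction on `S`: if `P` does not fix the new vector `f`, some evaluation detects `f - P f`, and
adding `v ↦ ev y (v - P v) • g` with `g` a normalized multiple of `f - P f` corrects this without
changing the vectors already fixed. -/
theorem exists_evalOperator {V Y : Type*} [AddCommGroup V] [Module C V] {ev : Y → V →ₗ[C] C}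
    (hev : ∀ v, (∀ y, ev y v = 0) → v = 0) (S : Finset V) :
    ∃ P ∈ evalOperators ev, ∀ v ∈ S, P v = v := by
  classical
  induction S using Finset.induction_on with
  | empty => exact ⟨0, Submodule.zero_mem _, by simp⟩
  | insert f S hf ih =>
    obtain ⟨P, hP, hPS⟩ := ih
    by_cases hg : f - P f = 0
    · refine ⟨P, hP, fun v hv => ?_⟩
      rcases Finset.mem_insert.mp hv with rfl | hv
      · exact (sub_eq_zero.mp hg).symm
      · exact hPS v hv
    obtain ⟨y, hy⟩ : ∃ y, ev y (f - P f) ≠ 0 := by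
      by_contra! h
      exact hg (hev _ h)
    obtain ⟨g, hgdef⟩ : ∃ g, g = (ev y (f - P f))⁻¹ • (f - P f) := ⟨_, rfl⟩
    refine ⟨P + ((ev y).smulRight g - (ev y ∘ₗ P).smulRight g), Submodule.add_mem _ hP
      (Submodule.sub_mem _ (Submodule.subset_span ⟨y, g, rfl⟩) ?_), fun v hv => ?_⟩
    · clear hPS hg hy hgdef
      rw [evalOperators] at hP
      induction hP using Submodule.span_induction with
      | mem x hx =>
        obtain ⟨y', e, rfl⟩ := hx
        refine Submodule.subset_span ⟨y', (ev y e) • g, ?_⟩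
        ext v
        simp [smul_smul]
      | zero =>
        rw [LinearMap.comp_zero]
        convert Submodule.zero_mem _
        ext; simp
      | add p q _ _ hp hq =>
        have : (ev y ∘ₗ (p + q)).smulRight g =
            (ev y ∘ₗ p).smulRight g + (ev y ∘ₗ q).smulRight g := by
          ext v; simp [add_smul]
        rw [this]
        exact Submodule.add_mem _ hp hq
      | smul c p _ hp =>
        have : (ev y ∘ₗ (c • p)).smulRight g = c • (ev y ∘ₗ p).smulRight g := by
          ext v; simp [smul_smul]
        rw [this]
        exact Submodule.smul_mem _ _ hp
    · have h1 : (P + ((ev y).smulRight g - (ev y ∘ₗ P).smulRight g)) v =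
          P v + ev y (v - P v) • g := by
        simp [sub_smul]
      rw [h1]
      rcases Finset.mem_insert.mp hv with rfl | hv
      · rw [hgdef, smul_inv_smul₀ hy, add_sub_cancel]
      · rw [hPS v hv, sub_self, map_zero, zero_smul, add_zero]

variable {ι : Type*} [Fintype ι] [DecidableEq ι] {V Y : ι → Type*} [∀ i, AddCommGroup (V i)]
  [∀ i, Module C (V i)]

/-- The linear form `⊗ ℓ_i` on a tensor product. -/
noncomputable def tensorForm (l : ∀ i, V i →ₗ[C] C) : (⨂[C] i, V i) →ₗ[C] C :=
  PiTensorProduct.lift ((MultilinearMap.mkPiAlgebra C ι C).compLinearMap l)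

theorem tensorForm_tprod (l : ∀ i, V i →ₗ[C] C) (v : ∀ i, V i) :
    tensorForm l (PiTensorProduct.tprod C v) = ∏ i, l i (v i) := by
  simp [tensorForm]

/-- Separating families of linear forms separate the points of a tensor product. -/
theorem eq_zero_of_tensorForm {ev : ∀ i, Y i → V i →ₗ[C] C}
    (hev : ∀ i v, (∀ y, ev i y v = 0) → v = 0) (w : ⨂[C] i, V i)
    (hw : ∀ y : ∀ i, Y i, tensorForm (fun i => ev i (y i)) w = 0) : w = 0 := by
  -- Only finitely many vectors of each factor occur in `w`, so operators that fix these fix `w`.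
  have hfix : ∃ S : ∀ i, Finset (V i), ∀ P : ∀ i, V i →ₗ[C] V i, (∀ i, ∀ v ∈ S i, P i v = v) →
      PiTensorProduct.map P w = w := by
    classical
    clear hw
    induction w using PiTensorProduct.induction_on with
    | smul_tprod r f =>
      refine ⟨fun i => {f i}, fun P hP => ?_⟩
      rw [map_smul, PiTensorProduct.map_tprod]
      congr 2
      funext i
      exact hP i _ (by simp)
    | add x y hx hy =>
      obtain ⟨S, hS⟩ := hx
      obtain ⟨S', hS'⟩ := hy
      refine ⟨fun i => S i ∪ S' i, fun P hP => ?_⟩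
      rw [map_add, hS P fun i v hv => hP i v (by simp [hv]),
        hS' P fun i v hv => hP i v (by simp [hv])]
  obtain ⟨S, hS⟩ := hfix
  choose P hP hPS using fun i => exists_evalOperator (hev i) (S i)
  rw [← hS P hPS]
  choose N c g hg using fun i => Submodule.mem_span_set'.mp (hP i)
  choose y e he using fun i a => (g i a).2
  have key : PiTensorProduct.map P = ∑ a : ∀ i, Fin (N i),
      (tensorForm fun i => ev i (y i (a i))).smulRight
        (PiTensorProduct.tprod C fun i => c i (a i) • e i (a i)) := by
    refine PiTensorProduct.ext ?_
    ext v
    simp only [LinearMap.compMultilinearMap_apply, PiTensorProduct.map_tprod, LinearMap.sum_apply,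
      LinearMap.smulRight_apply, tensorForm_tprod]
    have h1 : (fun i => P i (v i)) =
        fun i => ∑ a : Fin (N i), ev i (y i a) (v i) • c i a • e i a := by
      funext i
      rw [← hg i, LinearMap.sum_apply]
      refine Finset.sum_congr rfl fun a _ => ?_
      rw [LinearMap.smul_apply, he i a, LinearMap.smulRight_apply, smul_comm]
    rw [h1, MultilinearMap.map_sum]
    exact Finset.sum_congr rfl fun a _ => MultilinearMap.map_smul_univ _ _ _
  rw [key, LinearMap.sum_apply]
  refine Finset.sum_eq_zero fun a _ => ?_
  rw [LinearMap.smulRight_apply, hw, zero_smul]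

theorem tensorMap_surjective {V' : ι → Type*} [∀ i, AddCommGroup (V' i)] [∀ i, Module C (V' i)]
    {q : ∀ i, V i →ₗ[C] V' i} (hq : ∀ i, Function.Surjective (q i)) :
    Function.Surjective (PiTensorProduct.map q) := by
  rw [← LinearMap.range_eq_top, eq_top_iff, ← PiTensorProduct.span_tprod_eq_top,
    Submodule.span_le]
  rintro _ ⟨v, rfl⟩
  choose u hu using fun i => hq i (v i)
  exact ⟨PiTensorProduct.tprod C u, by rw [PiTensorProduct.map_tprod]; simp only [hu]⟩

end Separation

/-! ### Parabolic subgroups and their inducing representations -/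

section Parabolic

variable {F : Type u} [Field F] [ValuativeRel F] [TopologicalSpace F]
  [IsNonarchimedeanLocalField F] {n t : ℕ}

variable (F) in
/-- The standard parabolic subgroup of block upper triangular matrices. -/
def parab (b : Fin n → Fin t) : Subgroup (GL (Fin n) F) where
  carrier := {x | (x : Matrix (Fin n) (Fin n) F).BlockTriangular b}
  one_mem' := Matrix.blockTriangular_one
  mul_mem' hx hy := by
    simp only [Set.mem_ofPred_eq, Units.val_mul] at *
    exact hx.mul hy
  inv_mem' {x} hx := by
    simp only [Set.mem_ofPred_eq] at *
    rw [Matrix.coe_units_inv]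
    let := x.invertible
    exact Matrix.blockTriangular_inv_of_blockTriangular hx

theorem toSquareBlock_mul {b : Fin n → Fin t} {x y : Matrix (Fin n) (Fin n) F}
    (hx : x.BlockTriangular b) (hy : y.BlockTriangular b) (i : Fin t) :
    (x * y).toSquareBlock b i = x.toSquareBlock b i * y.toSquareBlock b i := by
  ext ⟨j, hj⟩ ⟨k, hk⟩
  rw [Matrix.mul_apply]
  change (x * y) j k = ∑ l : {l // b l = i}, x j l * y l k
  rw [Matrix.mul_apply]
  refine sum_eq_sum_subtype (fun l => b l = i) (fun l => x j l * y l k) fun l hl => ?_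
  rcases lt_or_gt_of_ne hl with h | h
  · rw [hx (by rw [hj]; exact h), zero_mul]
  · rw [hy (by rw [hk]; exact h), mul_zero]

theorem toSquareBlock_one (b : Fin n → Fin t) (i : Fin t) :
    (1 : Matrix (Fin n) (Fin n) F).toSquareBlock b i = 1 := by
  ext ⟨j, hj⟩ ⟨k, hk⟩
  change (1 : Matrix (Fin n) (Fin n) F) j k = _
  simp [Matrix.one_apply]

/-- The projection of a parabolic subgroup to a diagonal block. -/
def blk (b : Fin n → Fin t) (i : Fin t) : parab F b →* GL {j // b j = i} F where
  toFun x :=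
    { val := (x.1 : Matrix (Fin n) (Fin n) F).toSquareBlock b i
      inv := ((x⁻¹).1 : Matrix (Fin n) (Fin n) F).toSquareBlock b i
      val_inv := by
        rw [← toSquareBlock_mul x.2 (x⁻¹).2, ← Units.val_mul, ← Subgroup.coe_mul, mul_inv_cancel]
        exact toSquareBlock_one b i
      inv_val := by
        rw [← toSquareBlock_mul (x⁻¹).2 x.2, ← Units.val_mul, ← Subgroup.coe_mul, inv_mul_cancel]
        exact toSquareBlock_one b i }
  map_one' := Units.ext (toSquareBlock_one b i)
  map_mul' x y := Units.ext (toSquareBlock_mul x.2 y.2 i)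

theorem continuous_blk (b : Fin n → Fin t) (i : Fin t) : Continuous (blk (F := F) b i) := by
  refine Units.continuous_iff.mpr ⟨?_, ?_⟩
  · change Continuous fun x : parab F b => (x.1 : Matrix (Fin n) (Fin n) F).submatrix
      (Subtype.val : {j // b j = i} → Fin n) Subtype.val
    exact (Units.continuous_val.comp continuous_subtype_val).matrix_submatrix _ _
  · change Continuous fun x : parab F b => ((x⁻¹).1 : Matrix (Fin n) (Fin n) F).submatrix
      (Subtype.val : {j // b j = i} → Fin n) Subtype.val
    exact (Units.continuous_val.comp (continuous_subtype_val.comp continuous_inv)).matrix_submatrix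
      _ _

/-- The block diagonal matrix with given blocks. -/
def blockDiag (b : Fin n → Fin t) (m : ∀ i, GL {j // b j = i} F) : GL (Fin n) F where
  val := (Matrix.blockDiagonal' fun i => (m i : Matrix _ _ F)).submatrix
    (Equiv.sigmaFiberEquiv b).symm (Equiv.sigmaFiberEquiv b).symm
  inv := (Matrix.blockDiagonal' fun i => ((m i)⁻¹ : GL _ F).val).submatrix
    (Equiv.sigmaFiberEquiv b).symm (Equiv.sigmaFiberEquiv b).symm
  val_inv := by
    rw [Matrix.submatrix_mul_equiv, ← Matrix.blockDiagonal'_mul]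
    simp only [← Units.val_mul, mul_inv_cancel, Units.val_one]
    rw [← Pi.one_def, Matrix.blockDiagonal'_one, Matrix.submatrix_one_equiv]
  inv_val := by
    rw [Matrix.submatrix_mul_equiv, ← Matrix.blockDiagonal'_mul]
    simp only [← Units.val_mul, inv_mul_cancel, Units.val_one]
    rw [← Pi.one_def, Matrix.blockDiagonal'_one, Matrix.submatrix_one_equiv]

theorem blockDiag_mem (b : Fin n → Fin t) (m : ∀ i, GL {j // b j = i} F) :
    blockDiag b m ∈ parab F b := by
  intro j k hjk
  exact Matrix.blockDiagonal'_apply_ne (fun i => (m i).val) _ _ hjk.ne'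

theorem blk_blockDiag (b : Fin n → Fin t) (m : ∀ i, GL {j // b j = i} F) (i : Fin t) :
    blk b i ⟨blockDiag b m, blockDiag_mem b m⟩ = m i := by
  refine Units.ext ?_
  ext ⟨j, hj⟩ ⟨k, hk⟩
  have hsymm : ∀ l (hl : b l = i), (Equiv.sigmaFiberEquiv b).symm l = ⟨i, ⟨l, hl⟩⟩ := by
    intro l hl
    rw [Equiv.symm_apply_eq]
    rfl
  change Matrix.blockDiagonal' (fun i => (m i : Matrix _ _ F)) ((Equiv.sigmaFiberEquiv b).symm j)
    ((Equiv.sigmaFiberEquiv b).symm k) = _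
  rw [hsymm j hj, hsymm k hk, Matrix.blockDiagonal'_apply_eq]

variable {C : Type u} [Field C]

/-- The square root of the modulus character of a parabolic subgroup. -/
noncomputable def modChar (s : Cˣ) (b : Fin n → Fin t) : parab F b →* Cˣ where
  toFun x := ∏ i, sqrtAbs s (Matrix.GeneralLinearGroup.det (blk b i x)) ^
    ((Fintype.card {j // i < b j} : ℤ) - Fintype.card {j // b j < i})
  map_one' := by simp
  map_mul' x y := by
    simp only [map_mul, mul_zpow, Finset.prod_mul_distrib]

/-- The representation of a parabolic subgroup on a tensor product of representations of its
diagonal blocks, twisted by the square root of the modulus character. -/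
noncomputable def levi (s : Cˣ) (b : Fin n → Fin t) {V : Fin t → Type*} [∀ i, AddCommGroup (V i)]
    [∀ i, Module C (V i)] (ρ : ∀ i, Representation C (GL {j // b j = i} F) (V i)) :
    Representation C (parab F b) (⨂[C] i, V i) where
  toFun x := (modChar s b x : C) • PiTensorProduct.map fun i => ρ i (blk b i x)
  map_one' := by
    simp only [map_one, Units.val_one, one_smul]
    exact PiTensorProduct.map_one
  map_mul' x y := by
    simp only [map_mul, Units.val_mul]
    rw [PiTensorProduct.map_mul, smul_mul_smul_comm]

variable {V : Fin t → Type*} [∀ i, AddCommGroup (V i)] [∀ i, Module C (V i)]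

theorem levi_apply (s : Cˣ) (b : Fin n → Fin t)
    (ρ : ∀ i, Representation C (GL {j // b j = i} F) (V i)) (x : parab F b) (v : ⨂[C] i, V i) :
    levi s b ρ x v = (modChar s b x : C) • PiTensorProduct.map (fun i => ρ i (blk b i x)) v := rfl

theorem isOpen_valuation_det {ι : Type} [Fintype ι] [DecidableEq ι] :
    IsOpen {g : GL ι F | valuation F (g : Matrix ι ι F).det = 1} := by
  have h : IsOpen {x : F | valuation F x = 1} := by
    simpa only [Valuation.restrict_eq_one_iff] using
      (valuation F).isOpen_sphere (r := 1) one_ne_zero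
  exact h.preimage (Units.continuous_val.matrix_det)

/-- The modulus character depends only on the valuations of the block determinants, and having unit
block determinants is an open condition. -/
theorem exists_open_modChar (s : Cˣ) (b : Fin n → Fin t) : ∃ U : Subgroup (parab F b),
    IsOpen (U : Set (parab F b)) ∧ ∀ x ∈ U, modChar s b x = 1 := by
  let ψ (i : Fin t) : parab F b →* Cˣ :=
    (unramChar s⁻¹).comp (Matrix.GeneralLinearGroup.det.comp (blk b i))
  refine ⟨⨅ i, (ψ i).ker, ?_, fun x hx => ?_⟩
  · rw [Subgroup.coe_iInf]
    refine isOpen_iInter_of_finite fun i => ?_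
    refine Subgroup.isOpen_of_mem_nhds _ (g := 1) (Filter.mem_of_superset
      ((isOpen_valuation_det.preimage (continuous_blk (F := F) b i)).mem_nhds ?_) ?_)
    · change valuation F (blk b i 1).val.det = 1
      simp
    · intro x hx
      have hx' : ord (Matrix.GeneralLinearGroup.det (blk b i x)) = 0 := by
        rw [ord_eq_vord]
        exact (vord_eq_zero (Units.ne_zero _)).mpr hx
      change s⁻¹ ^ ord (Matrix.GeneralLinearGroup.det (blk b i x)) = 1
      rw [hx', zpow_zero]
  · have h1 : ∀ i, sqrtAbs s (Matrix.GeneralLinearGroup.det (blk b i x)) = 1 :=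
      fun i => Subgroup.mem_iInf.mp hx i
    change ∏ i, sqrtAbs s (Matrix.GeneralLinearGroup.det (blk b i x)) ^ _ = 1
    simp [h1]

theorem isSmooth_levi (s : Cˣ) (b : Fin n → Fin t)
    {ρ : ∀ i, Representation C (GL {j // b j = i} F) (V i)} (hρ : ∀ i, IsSmooth (ρ i)) :
    IsSmooth (levi s b ρ) := by
  obtain ⟨U₀, hU₀, hmod⟩ := exists_open_modChar (F := F) s b
  intro v
  induction v using PiTensorProduct.induction_on with
  | smul_tprod r f =>
    choose U hU hUf using fun i => hρ i (f i)
    refine ⟨U₀ ⊓ ⨅ i, (U i).comap (blk b i), hU₀.inter ?_, ?_⟩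
    · change IsOpen ((⨅ i, (U i).comap (blk b i) : Subgroup (parab F b)) : Set (parab F b))
      rw [Subgroup.coe_iInf]
      exact isOpen_iInter_of_finite fun i => (hU i).preimage (continuous_blk b i)
    · rintro g ⟨hg0, hg⟩
      have h1 : ∀ i, ρ i (blk b i g) (f i) = f i := fun i =>
        hUf i _ (Subgroup.mem_iInf.mp hg i)
      rw [map_smul, levi_apply, hmod g hg0, Units.val_one, one_smul, PiTensorProduct.map_tprod]
      simp only [h1]
  | add x y hx hy =>
    obtain ⟨U, hU, h⟩ := hx
    obtain ⟨U', hU', h'⟩ := hy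
    refine ⟨U ⊓ U', hU.inter hU', ?_⟩
    rintro g ⟨hg, hg'⟩
    rw [map_add, h g hg, h' g hg']

theorem isClosed_parab (b : Fin n → Fin t) : IsClosed (parab F b : Set (GL (Fin n) F)) := by
  have := t2Space (F := F)
  have h : (parab F b : Set (GL (Fin n) F)) =
      ⋂ i, ⋂ j, ⋂ (_ : b j < b i), {x : GL (Fin n) F | (x : Matrix (Fin n) (Fin n) F) i j = 0} := by
    ext x
    simp only [Set.mem_iInter]
    exact ⟨fun h i j hij => h hij, fun h i j hij => h i j hij⟩
  rw [h]
  refine isClosed_iInter fun i => isClosed_iInter fun j => isClosed_iInter fun _ => ?_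
  exact isClosed_eq (Units.continuous_val.matrix_elem i j) continuous_const

theorem isCompact_iwahori : IsCompact (iwahori F n : Set (GL (Fin n) F)) :=
  (isCompact_intGL (F := F) (ι := Fin n)).of_isClosed_subset
    ((iwahori F n).isClosed_of_isOpen isOpen_iwahori) iwahori_le_maxCompact

/-- The intersection of a parabolic subgroup with a conjugate of the Iwahori subgroup. -/
noncomputable def stabIwahori (b : Fin n → Fin t) (w : GL (Fin n) F) : Subgroup (parab F b) :=
  ((iwahori F n).comap (MulAut.conj w⁻¹).toMonoidHom).subgroupOf (parab F b)

theorem mem_stabIwahori {b : Fin n → Fin t} {w : GL (Fin n) F} {x : parab F b} :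
    x ∈ stabIwahori b w ↔ w⁻¹ * x * w ∈ iwahori F n := by
  rw [stabIwahori, Subgroup.mem_subgroupOf, Subgroup.mem_comap]
  simp

theorem isCompact_stabIwahori (b : Fin n → Fin t) (w : GL (Fin n) F) :
    IsCompact (stabIwahori b w : Set (parab F b)) := by
  have h : (stabIwahori b w : Set (parab F b)) =
      Subtype.val ⁻¹' ((fun x => w * x * w⁻¹) '' (iwahori F n : Set (GL (Fin n) F))) := by
    ext x
    rw [SetLike.mem_coe, mem_stabIwahori]
    constructor
    · intro hx
      exact ⟨_, hx, by group⟩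
    · rintro ⟨y, hy, hyx⟩
      have h : w⁻¹ * (w * y * w⁻¹) * w = y := by group
      rw [← hyx]
      exact h.symm ▸ hy
  rw [h]
  exact (isClosed_parab b).isClosedEmbedding_subtypeVal.isCompact_preimage
    (isCompact_iwahori.image (by fun_prop))

end Parabolic

/-! ### Lifting Iwahori invariant vectors of induced representations -/

section Lift

variable {F : Type u} [Field F] [ValuativeRel F] [TopologicalSpace F]
  [IsNonarchimedeanLocalField F] {n t : ℕ} {C : Type u} [Field C]
  {V V' : Fin t → Type*} [∀ i, AddCommGroup (V i)] [∀ i, Module C (V i)]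
  [∀ i, AddCommGroup (V' i)] [∀ i, Module C (V' i)]

/-- `f` is equivariant for the representation `levi s b ρ` of a parabolic subgroup. -/
def IsInduced (s : Cˣ) (b : Fin n → Fin t)
    (ρ : ∀ i, Representation C (GL {j // b j = i} F) (V i)) (f : GL (Fin n) F → ⨂[C] i, V i) :
    Prop :=
  ∀ (x : parab F b) (g : GL (Fin n) F), f (x * g) = levi s b ρ x (f g)

theorem map_levi (s : Cˣ) (b : Fin n → Fin t)
    {ρ : ∀ i, Representation C (GL {j // b j = i} F) (V i)}
    {ρ' : ∀ i, Representation C (GL {j // b j = i} F) (V' i)}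
    {q : ∀ i, V' i →ₗ[C] V i} (hq : ∀ i g v, q i (ρ' i g v) = ρ i g (q i v)) (x : parab F b)
    (w : ⨂[C] i, V' i) :
    PiTensorProduct.map q (levi s b ρ' x w) = levi s b ρ x (PiTensorProduct.map q w) := by
  rw [levi_apply, levi_apply, map_smul, ← LinearMap.comp_apply, ← LinearMap.comp_apply,
    ← PiTensorProduct.map_comp, ← PiTensorProduct.map_comp]
  congr 3
  funext i
  ext v
  exact hq i _ v

/-- Iwahori invariant vectors of a parabolically induced representation lift along
surjections of the inducing representations. -/
theorem IsInduced.exists_lift [CharZero C] {s : Cˣ} {b : Fin n → Fin t}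
    {ρ : ∀ i, Representation C (GL {j // b j = i} F) (V i)}
    {ρ' : ∀ i, Representation C (GL {j // b j = i} F) (V' i)} (hρ' : ∀ i, IsSmooth (ρ' i))
    {q : ∀ i, V' i →ₗ[C] V i} (hq : ∀ i g v, q i (ρ' i g v) = ρ i g (q i v))
    (hqs : ∀ i, Function.Surjective (q i)) {f : GL (Fin n) F → ⨂[C] i, V i}
    (hf : IsInduced s b ρ f) (hI : IwInv f) :
    ∃ f' : GL (Fin n) F → ⨂[C] i, V' i, IsInduced s b ρ' f' ∧ IwInv f' ∧
      ∀ g, PiTensorProduct.map q (f' g) = f g := by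
  -- The value `f w` is fixed by the intersection of the parabolic subgroup with `w I w⁻¹`. This
  -- group is compact, so averaging gives a lift fixed by it.
  have hfix : ∀ w, ∃ m, PiTensorProduct.map q m = f w ∧
      ∀ h ∈ stabIwahori b w, levi s b ρ' h m = m := by
    intro w
    obtain ⟨v, hv⟩ := tensorMap_surjective hqs (f w)
    obtain ⟨u, hu, hu'⟩ := exists_fixed_lift (isSmooth_levi s b hρ') (isCompact_stabIwahori b w)
      (PiTensorProduct.map q) v (by
        intro h hh
        rw [map_levi s b hq, hv, ← hf, ← hI w _ (mem_stabIwahori.mp hh)]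
        congr 1
        group)
    exact ⟨u, hu.trans hv, hu'⟩
  choose m hm hm' using hfix
  -- Chosen representatives of the double cosets of the parabolic and the Iwahori subgroup; the lift
  -- is prescribed at these points and extended by equivariance.
  let W (g : GL (Fin n) F) : GL (Fin n) F :=
    (DoubleCoset.mk (parab F b) (iwahori F n) g).out
  have hW : ∀ g, ∃ x : parab F b, ∃ y ∈ iwahori F n, g = x * W g * y := by
    intro g
    obtain ⟨h, k, hh, hk, h1⟩ := DoubleCoset.mk_out_eq_mul (parab F b) (iwahori F n) g
    refine ⟨⟨h⁻¹, inv_mem hh⟩, k⁻¹, inv_mem hk, ?_⟩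
    change g = h⁻¹ * (DoubleCoset.mk (parab F b) (iwahori F n) g).out * k⁻¹
    rw [h1]
    group
  choose x y hy hxy using hW
  have hWeq : ∀ g (p : parab F b), ∀ k ∈ iwahori F n, W (p * g * k) = W g := by
    intro g p k hk
    change Quotient.out _ = Quotient.out _
    congr 1
    exact ((DoubleCoset.eq (parab F b) (iwahori F n) g _).mpr ⟨p, p.2, k, hk, rfl⟩).symm
  let f' (g : GL (Fin n) F) : ⨂[C] i, V' i := levi s b ρ' (x g) (m (W g))
  -- Invariance of the chosen lift at `W g` makes the extension independent of how `g` is written in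
  -- its double coset.
  have key : ∀ g (p : parab F b), ∀ k ∈ iwahori F n, g = p * W g * k →
      f' g = levi s b ρ' p (m (W g)) := by
    intro g p k hk hg
    have h1 : p⁻¹ * x g ∈ stabIwahori b (W g) := by
      rw [mem_stabIwahori]
      have h2 := (hxy g).symm.trans hg
      have h3 : (W g)⁻¹ * ((p⁻¹ * x g : parab F b) : GL (Fin n) F) * W g = k * (y g)⁻¹ := by
        have h4 : (x g : GL (Fin n) F) * W g = p * W g * k * (y g)⁻¹ := by
          rw [← h2]
          group
        rw [Subgroup.coe_mul, Subgroup.coe_inv, mul_assoc, mul_assoc, h4]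
        group
      rw [h3]
      exact mul_mem hk (inv_mem (hy g))
    change levi s b ρ' (x g) (m (W g)) = _
    conv_lhs => rw [← mul_inv_cancel_left p (x g), map_mul, Module.End.mul_apply, hm' _ _ h1]
  refine ⟨f', fun p g => ?_, fun g k hk => ?_, fun g => ?_⟩
  · have h1 : W (p * g) = W g := by simpa using hWeq g p 1 (one_mem _)
    rw [key (p * g) (p * x g) (y g) (hy g), map_mul, Module.End.mul_apply, h1]
    rw [h1, Subgroup.coe_mul, mul_assoc, mul_assoc, ← mul_assoc (x g : GL (Fin n) F), ← hxy g]
  · have h1 : W (g * k) = W g := by simpa using hWeq g 1 k hk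
    rw [key (g * k) (x g) (y g * k) (mul_mem (hy g) hk), h1]
    rw [h1, ← mul_assoc, ← hxy g]
  · change PiTensorProduct.map q (levi s b ρ' (x g) (m (W g))) = f g
    rw [map_levi s b hq, hm, ← hf, ← hI _ _ (hy g), ← hxy g]

end Lift

/-! ### Parameters of the principal series attached to segments -/

section PrincipalSeries

variable {F : Type u} [Field F] [ValuativeRel F] [TopologicalSpace F]
  [IsNonarchimedeanLocalField F] {n t : ℕ} {C : Type u} [Field C]

theorem isSmooth_smoothIndRep {C G M : Type*} [Field C] [Group G] [TopologicalSpace G]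
    [IsTopologicalGroup G] [AddCommGroup M] [Module C M] (T : Set (G × Module.End C M)) :
    IsSmooth (smoothIndRep T) := by
  rintro ⟨f, hf, U, hU, hfU⟩
  exact ⟨U, hU, fun g hg => Subtype.ext (funext fun x => hfU x g hg)⟩

/-- Evaluation at a group element of a function in an induced representation. -/
def indEval {G M : Type*} [Group G] [TopologicalSpace G] [AddCommGroup M] [Module C M]
    (T : Set (G × Module.End C M)) (g : G) : smoothInd T →ₗ[C] M :=
  LinearMap.proj g ∘ₗ (smoothInd T).subtype

/-- The parameters of the principal series that maps onto `Q(Δ_1) × ⋯ × Q(Δ_t)`, in the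
unnormalized parametrization. -/
noncomputable def segParam (s : Cˣ) (b : Fin n → Fin t) (a : Fin t → Cˣ) (j : Fin n) : Cˣ :=
  s⁻¹ ^ ((Fintype.card {j' // j < j'} : ℤ) - Fintype.card {j' // j' < j}) *
    (a (b j) * (s ^ 2)⁻¹ ^ Fintype.card {j' // j' < j ∧ b j' = b j})

/-- As `b` is monotone, a later index lies in a later block or later in the same block. With
`card_lt_split` this gives the transitivity of the modulus characters. -/
theorem card_gt_split {b : Fin n → Fin t} (hb : Monotone b) {i : Fin t} (j : {j // b j = i}) :
    Fintype.card {j' // (j : Fin n) < j'} =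
      Fintype.card {j' // i < b j'} + Fintype.card {j' : {j // b j = i} // j < j'} := by
  have h1 : Fintype.card {j' : {j // b j = i} // j < j'} =
      Fintype.card {j' : Fin n // b j' = i ∧ (j : Fin n) < j'} :=
    Fintype.card_congr (Equiv.subtypeSubtypeEquivSubtypeInter (fun l => b l = i)
      fun l => (j : Fin n) < l)
  rw [h1, Fintype.card_subtype, Fintype.card_subtype, Fintype.card_subtype,
    ← Finset.card_union_of_disjoint]
  · congr 1
    ext l
    simp only [Finset.mem_filter, Finset.mem_union, Finset.mem_univ, true_and]
    have h2 := j.2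
    constructor
    · intro h
      rcases (hb h.le).lt_or_eq with h3 | h3
      · exact Or.inl (h2 ▸ h3)
      · exact Or.inr ⟨h3.symm.trans h2, h⟩
    · rintro (h | h)
      · by_contra hn
        exact absurd (h.trans_le (hb (not_lt.mp hn))) (by rw [h2]; exact lt_irrefl _)
      · exact h.2
  · rw [Finset.disjoint_left]
    intro l hl hl'
    simp only [Finset.mem_filter, Finset.mem_univ, true_and] at hl hl'
    exact hl.ne' hl'.1

theorem card_lt_split {b : Fin n → Fin t} (hb : Monotone b) {i : Fin t} (j : {j // b j = i}) :
    Fintype.card {j' // j' < (j : Fin n)} =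
      Fintype.card {j' // b j' < i} + Fintype.card {j' : {j // b j = i} // j' < j} := by
  have h1 : Fintype.card {j' : {j // b j = i} // j' < j} =
      Fintype.card {j' : Fin n // b j' = i ∧ j' < (j : Fin n)} :=
    Fintype.card_congr (Equiv.subtypeSubtypeEquivSubtypeInter (fun l => b l = i)
      fun l => l < (j : Fin n))
  rw [h1, Fintype.card_subtype, Fintype.card_subtype, Fintype.card_subtype,
    ← Finset.card_union_of_disjoint]
  · congr 1
    ext l
    simp only [Finset.mem_filter, Finset.mem_union, Finset.mem_univ, true_and]
    have h2 := j.2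
    constructor
    · intro h
      rcases (hb h.le).lt_or_eq with h3 | h3
      · exact Or.inl (h2 ▸ h3)
      · exact Or.inr ⟨h3.trans h2, h⟩
    · rintro (h | h)
      · by_contra hn
        exact absurd ((hb (not_lt.mp hn)).trans_lt h) (by rw [h2]; exact lt_irrefl _)
      · exact h.2
  · rw [Finset.disjoint_left]
    intro l hl hl'
    simp only [Finset.mem_filter, Finset.mem_univ, true_and] at hl hl'
    exact hl.ne hl'.1

theorem card_block_lt {b : Fin n → Fin t} {i : Fin t} (j : {j // b j = i}) :
    Fintype.card {j' : {j // b j = i} // j' < j} =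
      Fintype.card {j' : Fin n // j' < (j : Fin n) ∧ b j' = b j} := by
  refine (Fintype.card_congr (Equiv.subtypeSubtypeEquivSubtypeInter (fun l => b l = i)
      fun l => l < (j : Fin n))).trans ?_
  refine Fintype.card_congr (Equiv.subtypeEquivRight fun l => ?_)
  rw [j.2, and_comm]

theorem borel_le_parab {b : Fin n → Fin t} (hb : Monotone b) : borel F n ≤ parab F b :=
  fun _ hx _ _ hjk => hx (lt_of_not_ge fun h => absurd (hb h) (not_le.mpr hjk))

/-- The scalar by which an upper triangular matrix acts, in terms of its diagonal entries. -/
theorem modChar_mul_prod {b : Fin n → Fin t} (hb : Monotone b) (s : Cˣ) (a : Fin t → Cˣ)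
    {x : parab F b} (hx : x.1 ∈ borel F n) (u : ∀ i, {j // b j = i} → Fˣ)
    (hu : ∀ i j, (blk b i x).val j j = u i j) :
    modChar s b x * ∏ i, ∏ j, (sqrtAbs s (u i j) ^
      ((Fintype.card {j' // j < j'} : ℤ) - Fintype.card {j' // j' < j}) *
        segmentChar s (a i) j (u i j)) = monom (segParam s b a) (diagOrd x.1) := by
  have hord : ∀ i (j : {j // b j = i}), ord (u i j) = diagOrd x.1 j := by
    intro i j
    rw [ord_eq_vord, ← hu]
    rfl
  have hdet : ∀ i, Matrix.GeneralLinearGroup.det (blk b i x) = ∏ j, u i j := by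
    intro i
    refine Units.ext ?_
    have h1 : (blk b i x).val.IsUpperTriangular := fun j k hjk => hx hjk
    rw [Units.coe_prod, ← Finset.prod_congr rfl fun j _ => hu i j]
    exact Matrix.det_of_isUpperTriangular h1
  have hmod : modChar s b x = ∏ i, ∏ j, sqrtAbs s (u i j) ^
      ((Fintype.card {j // i < b j} : ℤ) - Fintype.card {j // b j < i}) := by
    change ∏ i, sqrtAbs s (Matrix.GeneralLinearGroup.det (blk b i x)) ^ _ = _
    refine Finset.prod_congr rfl fun i _ => ?_
    rw [hdet, map_prod, Finset.prod_zpow]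
  rw [hmod, ← Finset.prod_mul_distrib]
  simp only [← Finset.prod_mul_distrib]
  rw [monom, ← Fintype.prod_fiberwise b]
  refine Finset.prod_congr rfl fun i _ => Finset.prod_congr rfl fun j _ => ?_
  -- The exponent of `s⁻¹` for the Borel subgroup is that of the parabolic subgroup plus that of the
  -- Borel subgroup of the block.
  rw [segParam, card_gt_split hb j, card_lt_split hb j, ← card_block_lt j, j.2, ← hord i j]
  simp only [segmentChar, sqrtAbs, unramChar, MonoidHom.coe_mk, OneHom.coe_mk]
  rw [← mul_assoc, ← zpow_mul, ← zpow_mul, ← zpow_add, mul_zpow (s⁻¹ ^ _), ← zpow_mul]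
  congr 2
  push_cast
  ring

end PrincipalSeries

/-! ### The Hecke eigenvalue on quotients of induced representations -/

section Eigenvalue

variable {F : Type u} [Field F] [ValuativeRel F] [TopologicalSpace F]
  [IsNonarchimedeanLocalField F] {n t : ℕ} {C : Type u} [Field C]

/-- The linear forms `ev g` realize `ρ` as a space of functions in the principal series attached to
a segment. -/
structure IsSegModel (s a : Cˣ) {ι : Type} [Fintype ι] [LinearOrder ι] [DecidableEq ι] {V : Type*}
    [AddCommGroup V] [Module C V] (ρ : Representation C (GL ι F) V) (ev : GL ι F → V →ₗ[C] C) :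
    Prop where
  translate : ∀ g h v, ev g (ρ h v) = ev (g * h) v
  separating : ∀ v, (∀ g, ev g v = 0) → v = 0
  triangular : ∀ (m : GL ι F) (u : ι → Fˣ), m.val.IsUpperTriangular → (∀ l, m.val l l = u l) →
    ∀ v, ev m v = ((∏ l, sqrtAbs s (u l) ^
      ((Fintype.card {j // l < j} : ℤ) - Fintype.card {j // j < l}) *
        segmentChar s a l (u l) : Cˣ) : C) * ev 1 v

/-- The model is the principal series with its evaluations. It is stated as an abstract module so
that one model per block can be chosen at once. -/
theorem exists_segModel {s a : Cˣ} {b : Fin n → Fin t} {i : Fin t}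
    {W : Type u} [AddCommGroup W] [Module C W] {τ : Representation C (GL {j // b j = i} F) W}
    (hτ : IsSegmentQuotient s a τ) :
    ∃ (V : ModuleCat.{u} C) (ρ : Representation C (GL {j // b j = i} F) V)
      (ev : GL {j // b j = i} F → V →ₗ[C] C) (q : V →ₗ[C] W), IsSmooth ρ ∧ IsSegModel s a ρ ev ∧
        (∀ g v, q (ρ g v) = τ g (q v)) ∧ Function.Surjective q := by
  obtain ⟨-, q, hq⟩ := hτ
  refine ⟨ModuleCat.of C _, principalSeries s (segmentChar (F := F) (ι := {j // b j = i}) s a),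
    indEval _,
    q.toLinearMap, isSmooth_smoothIndRep _, ⟨fun g h v => rfl,
      fun v hv => Subtype.ext (funext hv), fun m u hm hu v => ?_⟩,
    fun g v => LinearMap.congr_fun (q.isIntertwining' g) v, hq⟩
  have h1 := v.2.1 m _ ⟨hm, u, hu, rfl⟩ 1
  exact (congrArg v.1 (mul_one m)).symm.trans h1

section Model

variable {s : Cˣ} {b : Fin n → Fin t} {a : Fin t → Cˣ} {V : Fin t → Type*}
  [∀ i, AddCommGroup (V i)] [∀ i, Module C (V i)]
  {ρ : ∀ i, Representation C (GL {j // b j = i} F) (V i)}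
  {ev : ∀ i, GL {j // b j = i} F → V i →ₗ[C] C}

theorem tensorForm_levi (hev : ∀ i, IsSegModel s (a i) (ρ i) (ev i)) (x : parab F b)
    (w : ⨂[C] i, V i) : tensorForm (fun i => ev i 1) (levi s b ρ x w) =
      modChar s b x * tensorForm (fun i => ev i (blk b i x)) w := by
  rw [levi_apply, map_smul, smul_eq_mul, ← LinearMap.comp_apply]
  congr 1
  refine LinearMap.congr_fun (PiTensorProduct.ext ?_) w
  ext v
  simp only [LinearMap.compMultilinearMap_apply, LinearMap.comp_apply, PiTensorProduct.map_tprod,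
    tensorForm_tprod]
  refine Finset.prod_congr rfl fun i _ => ?_
  rw [(hev i).translate, one_mul]

/-- Induction in stages: evaluating at `1` in every block turns a vector induced from principal
series of the blocks into a scalar function in a principal series of `GL_n(F)`. -/
theorem isPS_tensorForm (hb : Monotone b) (hev : ∀ i, IsSegModel s (a i) (ρ i) (ev i))
    {f : GL (Fin n) F → ⨂[C] i, V i} (hf : IsInduced s b ρ f) :
    IsPS (segParam s b a) fun g => tensorForm (fun i => ev i 1) (f g) := by
  intro x hx g
  let p : parab F b := ⟨x, borel_le_parab hb hx⟩
  have hne : ∀ i (j : {j // b j = i}), (blk b i p).val j j ≠ 0 :=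
    fun i j => borel_diag_ne_zero hx j
  change tensorForm _ (f (p * g)) = _
  rw [hf, tensorForm_levi hev, ← modChar_mul_prod hb s a hx (fun i j => Units.mk0 _ (hne i j))
    (fun i j => rfl), Units.val_mul, mul_assoc]
  congr 1
  rw [← smul_eq_mul, ← LinearMap.smul_apply]
  refine LinearMap.congr_fun (PiTensorProduct.ext ?_) (f g)
  ext v
  simp only [LinearMap.compMultilinearMap_apply, LinearMap.smul_apply, tensorForm_tprod]
  rw [Units.coe_prod, smul_eq_mul, ← Finset.prod_mul_distrib]
  refine Finset.prod_congr rfl fun i _ => ?_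
  exact (hev i).triangular _ _ (fun j k hjk => hx hjk) (fun j => rfl) _

end Model

variable {E : Type u} [Field E] [Algebra E C] [CharZero C] {z : BernsteinCentre F E n} {r : ℕ}
  {ϖ : Fˣ}

theorem zpow_sum_univ {G ι : Type*} [CommGroup G] [Fintype ι] (m : G) (e : ι → ℤ) :
    m ^ ∑ i, e i = ∏ i, m ^ e i := by
  classical
  induction (Finset.univ : Finset ι) using Finset.induction_on with
  | empty => simp
  | insert i S hi ih => rw [Finset.sum_insert hi, Finset.prod_insert hi, zpow_add, ih]

/-- The valuation of the determinant of a triangular matrix is the sum of its diagonal valuations,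
so the twist multiplies every parameter by `m`. -/
theorem IsPS.twist {X : Fin n → Cˣ} {f : GL (Fin n) F → C} (hf : IsPS X f) (m : Cˣ) :
    IsPS (fun j => m * X j)
      fun g => (unramChar m (Matrix.GeneralLinearGroup.det g) : Cˣ) * f g := by
  intro x hx g
  have h1 : unramChar m (Matrix.GeneralLinearGroup.det x) * monom X (diagOrd x) =
      monom (fun j => m * X j) (diagOrd x) := by
    have h2 : ord (Matrix.GeneralLinearGroup.det x) = ∑ i, diagOrd x i := by
      rw [ord_eq_vord, ← height_of_borel hx, sum_height]
      rfl
    simp only [unramChar, MonoidHom.coe_mk, OneHom.coe_mk, monom, mul_zpow,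
      Finset.prod_mul_distrib, h2]
    congr 1
    exact zpow_sum_univ m _
  simp only [hf x hx, map_mul, ← h1]
  push_cast
  ring

theorem hecke_eigen_twist (hϖ : ord ϖ = 1)
    (hz : centreAct z (cInd F E n) cInd_mem = doubleCosetOp (heckeElement n r ϖ))
    {X : Fin n → Cˣ} {f : GL (Fin n) F → C} (hf : IsPS X f) (hI : IwInv f) (m : Cˣ)
    (x : GL (Fin n) F) :
    ((heckeCoeff z).sum fun y c => algebraMap E C c *
      (unramChar m (Matrix.GeneralLinearGroup.det y.out) : Cˣ) * f (x * y.out)) =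
        satake r ϖ (fun j => m * X j) * f x := by
  have hI' : IwInv fun g => ((unramChar m (Matrix.GeneralLinearGroup.det g) : Cˣ) : C) * f g := by
    intro g k hk
    have h1 : ord (Matrix.GeneralLinearGroup.det k) = 0 := by
      rw [ord_eq_vord]
      exact vord_det_maxCompact (iwahori_le_maxCompact hk)
    have h2 : unramChar m (Matrix.GeneralLinearGroup.det k) = 1 := by
      simp [unramChar, h1]
    simp only [map_mul, h2, mul_one, hI g k hk]
  have h := hecke_eigen hϖ hz (hf.twist m) hI' x
  rw [mul_left_comm, Finsupp.sum] at h
  have hne : ((unramChar m (Matrix.GeneralLinearGroup.det x) : Cˣ) : C) ≠ 0 := Units.ne_zero _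
  rw [← mul_right_inj' hne, ← h, Finsupp.sum, Finset.mul_sum]
  refine Finset.sum_congr rfl fun y _ => ?_
  rw [map_mul, map_mul]
  push_cast
  ring

/-- The fixed vector `v` lifts to an Iwahori fixed `f` in the induced representation, and `f` lifts
to `f'` with values in a tensor product of principal series. The identity is proved for `f'` and
pushed back down. -/
theorem hecke_eigen_parabolic (hϖ : ord ϖ = 1)
    (hz : centreAct z (cInd F E n) cInd_mem = doubleCosetOp (heckeElement n r ϖ))
    {s : Cˣ} {b : Fin n → Fin t} (hb : Monotone b) {a : Fin t → Cˣ}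
    {τ : ∀ i : Fin t, Rep.{u} C (GL {j // b j = i} F)}
    (hτ : ∀ i, IsSegmentQuotient s (a i) (τ i).ρ)
    {V : Type u} [AddCommGroup V] [Module C V] {π : Representation C (GL (Fin n) F) V}
    (hπ : IsQuotientOf π (parabolicInd s b τ)) (m : Cˣ) {v : V}
    (hv : ∀ x ∈ iwahori F n, π x v = v) :
    ((heckeCoeff z).sum fun y c => (algebraMap E C c *
      (unramChar m (Matrix.GeneralLinearGroup.det y.out) : Cˣ)) • π y.out v) =
        satake r ϖ (fun j => m * segParam s b a j) • v := by
  obtain ⟨Q, hQ⟩ := hπ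
  obtain ⟨f₀, hf₀⟩ := hQ v
  have hQint : ∀ g f, Q (parabolicInd s b τ g f) = π g (Q f) := fun g f =>
    LinearMap.congr_fun (Q.isIntertwining' g) f
  obtain ⟨f, hfv, hfI⟩ := exists_fixed_lift (isSmooth_smoothIndRep _) isCompact_iwahori
    Q.toLinearMap f₀ (by
      intro h hh
      have := hQint h f₀
      rw [hf₀, hv h hh, ← hf₀] at this
      exact this)
  have hfv' : Q f = v := hfv.trans hf₀
  have hind : IsInduced s b (fun i => (τ i).ρ) f.1 := fun x g =>
    f.2.1 x.1 _ ⟨x.2, fun i => blk b i x, fun i => rfl, rfl⟩ g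
  have hIw : IwInv f.1 := fun g x hx => congrFun (congrArg Subtype.val (hfI x hx)) g
  choose V' ρ' ev q hsm hev hq hqs using fun i => exists_segModel (hτ i)
  obtain ⟨f', hf', hI', hf'f⟩ := hind.exists_lift hsm hq hqs hIw
  have hps := isPS_tensorForm hb hev hf'
  have hmain : ∀ x, ((heckeCoeff z).sum fun y c => (algebraMap E C c *
      (unramChar m (Matrix.GeneralLinearGroup.det y.out) : Cˣ)) • f' (x * y.out)) =
        satake r ϖ (fun j => m * segParam s b a j) • f' x := by
    intro x
    rw [← sub_eq_zero]
    refine eq_zero_of_tensorForm (ev := ev) (fun i => (hev i).separating) _ fun M => ?_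
    -- Evaluation at `M i` in each block equals, up to the modulus character, evaluation at `1`
    -- after left translation by `d`. Left translation commutes with the Hecke sum, so the scalar
    -- identity at `d * x` suffices.
    let d : parab F b := ⟨blockDiag b M, blockDiag_mem b M⟩
    have h := hecke_eigen_twist hϖ hz hps
      (fun g k hk => by simp only [hI' g k hk]) m (d * x)
    have hlin : ∀ g, tensorForm (fun i => ev i (M i)) (f' g) =
        ((modChar s b d)⁻¹ : Cˣ) * tensorForm (fun i => ev i 1) (f' (d * g)) := by
      intro g
      rw [hf', tensorForm_levi hev, Units.inv_mul_cancel_left]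
      simp only [d, blk_blockDiag]
    rw [map_sub, map_smul, sub_eq_zero, hlin, smul_eq_mul, mul_left_comm, ← h, Finsupp.sum,
      Finsupp.sum, map_sum, Finset.mul_sum]
    refine Finset.sum_congr rfl fun y _ => ?_
    rw [map_smul, hlin, smul_eq_mul, mul_left_comm, mul_assoc (d : GL (Fin n) F)]
  have hX : ((heckeCoeff z).sum fun y c => (algebraMap E C c *
      (unramChar m (Matrix.GeneralLinearGroup.det y.out) : Cˣ)) • parabolicInd s b τ y.out f) =
        satake r ϖ (fun j => m * segParam s b a j) • f := by
    refine Subtype.ext (funext fun x => ?_)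
    have h := congrArg (PiTensorProduct.map q) (hmain x)
    rw [map_smul, hf'f, Finsupp.sum, map_sum] at h
    simp only [map_smul, hf'f] at h
    refine Eq.trans ?_ h
    rw [Finsupp.sum, AddSubmonoidClass.coe_finsetSum, Finset.sum_apply]
    rfl
  have hfin := congrArg Q.toLinearMap hX
  rw [map_smul, Finsupp.sum, map_sum] at hfin
  simp only [map_smul] at hfin
  rw [Finsupp.sum]
  refine Eq.trans (Finset.sum_congr rfl fun y _ => ?_) (hfin.trans ?_)
  · congr 1
    rw [← hfv']
    exact (hQint _ _).symm
  · rw [← hfv']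
    rfl

end Eigenvalue

/-! ### Traces on exterior powers and principal minors -/

section Minors

variable {R : Type*} [CommRing R] {n : ℕ}

/-- The sum of the principal minors of size `r`. -/
noncomputable def minorSum (r : ℕ) (Q : Matrix (Fin n) (Fin n) R) : R :=
  ∑ s ∈ (Finset.univ : Finset (Fin n)).powersetCard r,
    (Q.submatrix (Subtype.val : s → Fin n) (Subtype.val : s → Fin n)).det

theorem minorSum_map {S : Type*} [CommRing S] (f : R →+* S) (r : ℕ)
    (Q : Matrix (Fin n) (Fin n) R) : minorSum r (Q.map f) = f (minorSum r Q) := by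
  rw [minorSum, minorSum, map_sum]
  refine Finset.sum_congr rfl fun s _ => ?_
  rw [f.map_det]
  rfl

theorem minorSum_diagonal (r : ℕ) (d : Fin n → R) :
    minorSum r (Matrix.diagonal d) =
      ∑ s ∈ (Finset.univ : Finset (Fin n)).powersetCard r, ∏ i ∈ s, d i := by
  refine Finset.sum_congr rfl fun s _ => ?_
  rw [Matrix.submatrix_diagonal _ _ Subtype.val_injective, Matrix.det_diagonal]
  exact Finset.prod_coe_sort s d

/-- Over a nontrivial ring the principal minors depend on the characteristic polynomial only. -/
theorem minorSum_eq_of_charpoly_eq {r : ℕ} (hr : r ≤ n) {Q Q' : Matrix (Fin n) (Fin n) R}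
    (h : Q.charpoly = Q'.charpoly) : minorSum r Q = minorSum r Q' := by
  have h1 := Q.charpoly_coeff_eq_sum_minors r (by simpa using hr)
  rw [h, Q'.charpoly_coeff_eq_sum_minors r (by simpa using hr)] at h1
  exact ((isUnit_one.neg.pow r).mul_left_cancel h1).symm

/-- In the wedge basis, indexed by the subsets of size `r`, the diagonal entries of the exterior
power are the principal minors. -/
theorem trace_exteriorPower {M : Type*} [AddCommGroup M] [Module R M] (d : Basis (Fin n) R M)
    (T : M →ₗ[R] M) (r : ℕ) :
    LinearMap.trace R (⋀[R]^r M) (exteriorPower.map r T) =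
      minorSum r (LinearMap.toMatrix d d T) := by
  classical
  have : Fintype (Set.powersetCard (Fin n) r) := Fintype.ofFinite _
  rw [LinearMap.trace_eq_matrix_trace R (d.exteriorPower r), Matrix.trace, minorSum]
  refine Finset.sum_bij (fun s _ => s.1) (fun s _ => ?_) (fun s _ s' _ h => Subtype.ext h)
    (fun s hs => ⟨⟨s, (Finset.mem_powersetCard.mp hs).2⟩, Finset.mem_univ _, rfl⟩) fun s _ => ?_
  · exact Finset.mem_powersetCard.mpr ⟨Finset.subset_univ _, s.2⟩
  · rw [Matrix.diag_apply, LinearMap.toMatrix_apply, exteriorPower.basis_repr_apply,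
      exteriorPower.basis_apply, exteriorPower.ιMulti_family, exteriorPower.map_apply_ιMulti,
      exteriorPower.ιMultiDual_apply_ιMulti, ← Matrix.det_transpose,
      ← Matrix.det_submatrix_equiv_self (s.1.orderIsoOfFin s.2).toEquiv]
    congr 1
    ext i j
    simp only [Matrix.transpose_apply, Matrix.of_apply, Matrix.submatrix_apply,
      LinearMap.toMatrix_apply, Function.comp_apply, Basis.coord_apply]
    rfl

end Minors

/-! ### Characteristic polynomials and commuting nilpotent perturbations -/

section Jordan

variable {C W : Type*} [Field C] [Infinite C] [AddCommGroup W] [Module C W]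

theorem det_one_sub_of_isNilpotent [Module.Finite C W] {N : Module.End C W}
    (hN : IsNilpotent N) : LinearMap.det (1 - N) = 1 := by
  have h := hN.charpoly_eq_X_pow_finrank
  have h1 := LinearMap.eval_charpoly N 1
  rw [h] at h1
  simpa using h1.symm

/-- Commuting endomorphisms with nilpotent difference have the same characteristic polynomial. -/
theorem charpoly_eq_of_isNilpotent_sub [Module.Finite C W] {S Φ : Module.End C W}
    (hc : Commute S Φ) (hN : IsNilpotent (Φ - S)) : Φ.charpoly = S.charpoly := by
  refine Polynomial.funext fun x => ?_
  rw [LinearMap.eval_charpoly, LinearMap.eval_charpoly]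
  set A := algebraMap C (Module.End C W) x - S with hA
  set B := algebraMap C (Module.End C W) x - Φ with hB
  have hBA : B = A - (Φ - S) := by rw [hA, hB]; abel
  have hcomm : Commute A (Φ - S) := by
    refine Commute.sub_left (Algebra.commute_algebraMap_left _ _) ?_
    exact hc.sub_right (Commute.refl S)
  -- If `x` is not an eigenvalue of `S`, the two endomorphisms differ by the factor `1 - A⁻¹ (Φ -
  -- S)`, which is unipotent. Otherwise neither is invertible and both determinants vanish.
  by_cases hu : IsUnit A
  · obtain ⟨u, hu⟩ := hu
    have hcu : Commute (↑u⁻¹ : Module.End C W) (Φ - S) := by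
      rw [← hu] at hcomm
      exact hcomm.units_inv_left
    have h1 : B = A * (1 - ↑u⁻¹ * (Φ - S)) := by
      rw [mul_sub, mul_one, ← hu, Units.mul_inv_cancel_left, hu, hBA]
    rw [h1, map_mul, det_one_sub_of_isNilpotent (hcu.isNilpotent_mul_left hN), mul_one]
  · have hB' : ¬ IsUnit B := by
      intro h
      refine hu ?_
      have h2 : A = B + (Φ - S) := by rw [hBA]; abel
      rw [h2]
      refine hN.isUnit_add_left_of_commute h ?_
      rw [hBA]
      exact (hcomm.sub_left (Commute.refl _)).symm
    rw [LinearMap.isUnit_iff_isUnit_det, isUnit_iff_ne_zero, not_not] at hu hB'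
    rw [hu, hB']

end Jordan

/-! ### Frobenius invariants of `F₀` and of `E ⊗ F₀` -/

section Frobenius

variable {p : ℕ} [Fact p.Prime] {k : Type u} [Field k] [CharP k p]

theorem algebraMap_padicInt (x : ℤ_[p]) :
    algebraMap ℚ_[p] (WittField p k) (x : ℚ_[p]) = algebraMap (WittVector p k) (WittField p k)
      (WittVector.map (ZMod.castHom dvd_rfl k) ((WittVector.equiv p).symm x)) :=
  IsFractionRing.lift_algebraMap (padicIntToWittField_injective p k) x

variable [PerfectRing k p]

theorem wittFrobenius_algebraMap (w : WittVector p k) :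
    wittFrobenius p k (algebraMap _ _ w) = algebraMap _ (WittField p k) (WittVector.frobenius w) :=
  IsFractionRing.ringEquivOfRingEquiv_algebraMap _ _

theorem frobenius_map_castHom (w : WittVector p (ZMod p)) :
    WittVector.frobenius (WittVector.map (ZMod.castHom dvd_rfl k) w) =
      WittVector.map (ZMod.castHom dvd_rfl k) w := by
  ext i
  rw [WittVector.coeff_frobenius_charP, WittVector.map_coeff, ← map_pow, ZMod.pow_card]

theorem wittFrobenius_padic (x : ℚ_[p]) :
    wittFrobenius p k (algebraMap ℚ_[p] (WittField p k) x) = algebraMap ℚ_[p] _ x := by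
  have hle : ∀ y : ℤ_[p], wittFrobenius p k (algebraMap ℚ_[p] (WittField p k) y) =
      algebraMap ℚ_[p] _ (y : ℚ_[p]) := by
    intro y
    rw [algebraMap_padicInt, wittFrobenius_algebraMap, frobenius_map_castHom]
  obtain ⟨y, w, -, rfl⟩ := IsFractionRing.div_surjective (A := ℤ_[p]) x
  rw [map_div₀, map_div₀]
  exact congrArg₂ (· / ·) (hle y) (hle w)

/-- The elements of `W(k)[1/p]` fixed by Frobenius are those of `ℚ_p`. -/
theorem exists_padic_of_wittFrobenius_eq {x : WittField p k} (hx : wittFrobenius p k x = x) :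
    ∃ y : ℚ_[p], algebraMap ℚ_[p] (WittField p k) y = x := by
  obtain ⟨a, b, hb, rfl⟩ := IsFractionRing.div_surjective (A := WittVector p k) x
  obtain ⟨m, u, rfl⟩ := WittVector.exists_eq_pow_p_mul' b (nonZeroDivisors.ne_zero hb)
  set ι := algebraMap (WittVector p k) (WittField p k)
  have hp0 : (p : WittField p k) ^ m ≠ 0 := by
    intro h0
    refine nonZeroDivisors.ne_zero hb ?_
    apply IsFractionRing.injective (WittVector p k) (WittField p k)
    rw [map_mul, map_pow, map_natCast, h0, zero_mul, map_zero]
  -- The denominator is a power of `p` times a unit, so the element is a Witt vector `w` divided by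
  -- `p ^ m`, and Frobenius fixes `w` as well.
  have hw : ι a / ι ((p : WittVector p k) ^ m * u) =
      ι (a * ↑u⁻¹) / (p : WittField p k) ^ m := by
    have hu : ι u ≠ 0 := by
      intro h0
      refine nonZeroDivisors.ne_zero hb ?_
      apply IsFractionRing.injective (WittVector p k) (WittField p k)
      change ι _ = ι _
      rw [map_mul, h0, mul_zero, map_zero]
    have hinv : ι ↑u⁻¹ * ι u = 1 := by rw [← map_mul, Units.inv_mul, map_one]
    rw [map_mul, map_mul, map_pow, map_natCast, div_eq_div_iff (mul_ne_zero hp0 hu) hp0]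
    calc ι a * (p : WittField p k) ^ m = ι a * (ι ↑u⁻¹ * ι u) * p ^ m := by rw [hinv, mul_one]
      _ = _ := by ring
  set w := a * ↑u⁻¹
  rw [hw] at hx ⊢
  have hfw : WittVector.frobenius w = w := by
    rw [map_div₀, map_pow, map_natCast, wittFrobenius_algebraMap, div_left_inj' hp0] at hx
    exact IsFractionRing.injective (WittVector p k) (WittField p k) hx
  -- Frobenius raises the coefficients to the `p`-th power, so the coefficients of `w` lie in the
  -- prime field.
  have hcoeff : ∀ i, ∃ c : ZMod p, ZMod.castHom dvd_rfl k c = w.coeff i := by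
    intro i
    have h1 : w.coeff i ^ p = w.coeff i := by
      rw [← WittVector.coeff_frobenius_charP, hfw]
    have h2 := (Subfield.mem_bot_iff_pow_eq_self k p).mpr h1
    have h3 : (⊥ : Subfield k) ≤ (ZMod.castHom (dvd_refl p) k).fieldRange := bot_le
    exact h3 h2
  choose c hc using hcoeff
  refine ⟨((WittVector.equiv p (WittVector.mk p c) : ℤ_[p]) : ℚ_[p]) / (p : ℚ_[p]) ^ m, ?_⟩
  rw [map_div₀, map_pow, map_natCast, algebraMap_padicInt, RingEquiv.symm_apply_apply]
  congr 2
  ext i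
  rw [WittVector.map_coeff, WittVector.coeff_mk, hc]

variable (p k) in
/-- The Frobenius of `W(k)[1/p]` as an automorphism over `ℚ_p`. -/
noncomputable def wittFrobeniusAlg : WittField p k ≃ₐ[ℚ_[p]] WittField p k :=
  AlgEquiv.ofRingEquiv (f := wittFrobenius p k) wittFrobenius_padic

variable {E : Type u} [Field E] [Algebra ℚ_[p] E]

variable (p k E) in
/-- The automorphism `1 ⊗ φ₀` of `E ⊗ F₀`. -/
noncomputable def coeffFrobenius : E ⊗[ℚ_[p]] WittField p k ≃ₐ[E] E ⊗[ℚ_[p]] WittField p k :=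
  Algebra.TensorProduct.congr AlgEquiv.refl (wittFrobeniusAlg p k)

theorem coeffFrobenius_tmul (e : E) (a : WittField p k) :
    coeffFrobenius p k E (e ⊗ₜ a) = e ⊗ₜ wittFrobenius p k a := rfl

/-- Frobenius acts on the coordinates in `F₀` with respect to a `ℚ_p`-basis of `E`, so each
coordinate is fixed and lies in `ℚ_p`. -/
theorem exists_of_coeffFrobenius_eq {x : E ⊗[ℚ_[p]] WittField p k}
    (hx : coeffFrobenius p k E x = x) :
    ∃ y : E, algebraMap E (E ⊗[ℚ_[p]] WittField p k) y = x := by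
  let ℬ := Module.Free.chooseBasis ℚ_[p] E
  let e := TensorProduct.equivFinsuppOfBasisLeft (N := WittField p k) ℬ
  have hF : ∀ (x : E ⊗[ℚ_[p]] WittField p k) i,
      e (coeffFrobenius p k E x) i = wittFrobenius p k (e x i) := by
    intro x i
    induction x using TensorProduct.induction_on with
    | zero => simp
    | add x y hx hy => simp only [map_add, Finsupp.add_apply, hx, hy]
    | tmul a b =>
      rw [coeffFrobenius_tmul]
      simp only [e, TensorProduct.equivFinsuppOfBasisLeft_apply_tmul, Finsupp.mapRange_apply,
        Algebra.smul_def, map_mul, wittFrobenius_padic]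
  have hfix : ∀ i, ∃ y : ℚ_[p], algebraMap ℚ_[p] (WittField p k) y = e x i := fun i =>
    exists_padic_of_wittFrobenius_eq (by rw [← hF, hx])
  choose y hy using hfix
  refine ⟨(e x).sum fun i _ => y i • ℬ i, ?_⟩
  have hxe : x = (e x).sum fun i a => ℬ i ⊗ₜ a := by
    conv_lhs => rw [← e.symm_apply_apply x, TensorProduct.equivFinsuppOfBasisLeft_symm_apply]
  refine Eq.trans ?_ hxe.symm
  rw [Finsupp.sum, map_sum]
  refine Finset.sum_congr rfl fun i _ => ?_
  change _ = ℬ i ⊗ₜ[ℚ_[p]] (e x) i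
  rw [← hy, Algebra.algebraMap_eq_smul_one (y i), ← TensorProduct.smul_tmul,
    Algebra.TensorProduct.algebraMap_apply, Algebra.algebraMap_self_apply]

end Frobenius

/-! ### The component `D_σ` and the descent of the trace to `E` -/

section Component

variable {p : ℕ} [Fact p.Prime] {k : Type u} [Field k] [CharP k p]
  {E : Type u} [Field E] [Algebra ℚ_[p] E]

/-- The projection of `E ⊗ F₀` to `E` attached to an embedding `σ : F₀ → E`. -/
noncomputable def coeffProj (σ : WittField p k →ₐ[ℚ_[p]] E) : E ⊗[ℚ_[p]] WittField p k →ₐ[E] E :=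
  Algebra.TensorProduct.lift (AlgHom.id E E) σ fun _ _ => Commute.all _ _

theorem coeffProj_tmul (σ : WittField p k →ₐ[ℚ_[p]] E) (e : E) (a : WittField p k) :
    coeffProj σ (e ⊗ₜ a) = e * σ a := by
  simp [coeffProj]

/-- The idempotent that cuts out the component attached to `σ`. -/
theorem exists_coeffIdempotent [FiniteDimensional ℚ_[p] E] (σ : WittField p k →ₐ[ℚ_[p]] E) :
    ∃ ε : E ⊗[ℚ_[p]] WittField p k, coeffProj σ ε = 1 ∧
      ∀ x, x * ε = algebraMap E _ (coeffProj σ x) * ε := by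
  have : FiniteDimensional ℚ_[p] (WittField p k) :=
    FiniteDimensional.of_injective σ.toLinearMap σ.toRingHom.injective
  have : Algebra.FormallyUnramified ℚ_[p] (WittField p k) :=
    Algebra.FormallyUnramified.of_isSeparable _ _
  let f : WittField p k ⊗[ℚ_[p]] WittField p k →ₐ[ℚ_[p]] E ⊗[ℚ_[p]] WittField p k :=
    Algebra.TensorProduct.map σ (AlgHom.id _ _)
  -- The separability idempotent of `F₀` over `ℚ_p` is pushed forward along `σ` in the first factor.
  let ε₀ := Algebra.FormallyUnramified.elem ℚ_[p] (WittField p k)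
  refine ⟨f ε₀, ?_, fun x => ?_⟩
  · have h1 : ∀ y, coeffProj σ (f y) = σ (Algebra.TensorProduct.lmul' ℚ_[p] y) := by
      intro y
      induction y using TensorProduct.induction_on with
      | zero => simp
      | add y z hy hz => simp only [map_add, hy, hz]
      | tmul a b => simp [f, coeffProj_tmul]
    have h2 : Algebra.TensorProduct.lmul' ℚ_[p] ε₀ = 1 := Algebra.FormallyUnramified.lmul_elem
    rw [h1, h2, map_one]
  · induction x using TensorProduct.induction_on with
    | zero => simp
    | add y z hy hz => rw [map_add, map_add, add_mul, add_mul, hy, hz]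
    | tmul e a =>
      have h1 := congrArg f (Algebra.FormallyUnramified.one_tmul_mul_elem (R := ℚ_[p]) a)
      rw [map_mul, map_mul] at h1
      have h2 : f (1 ⊗ₜ a) = 1 ⊗ₜ a := by simp [f]
      have h3 : f (a ⊗ₜ 1) = σ a ⊗ₜ 1 := by simp [f]
      rw [h2, h3] at h1
      have h4 : (e ⊗ₜ a : E ⊗[ℚ_[p]] WittField p k) = (e ⊗ₜ 1) * (1 ⊗ₜ a) := by simp
      rw [h4, mul_assoc, h1, ← h4, coeffProj_tmul, ← mul_assoc]
      congr 1
      simp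

variable [PerfectRing k p] {D : Type*} [AddCommGroup D] [Module (E ⊗[ℚ_[p]] WittField p k) D]

namespace PhiNModule

variable (M : PhiNModule p k E D)

theorem phi_smul_coeff (x : E ⊗[ℚ_[p]] WittField p k) (d : D) :
    M.phi (x • d) = coeffFrobenius p k E x • M.phi d := by
  induction x using TensorProduct.induction_on with
  | zero => simp
  | add y z hy hz => rw [add_smul, map_add, hy, hz, map_add, add_smul]
  | tmul e a => rw [M.phi_smul, coeffFrobenius_tmul]

theorem phi_symm_smul_coeff (x : E ⊗[ℚ_[p]] WittField p k) (d : D) :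
    M.phi.symm (x • d) = (coeffFrobenius p k E).symm x • M.phi.symm d := by
  apply M.phi.injective
  rw [M.phi_smul_coeff, AddEquiv.apply_symm_apply, AddEquiv.apply_symm_apply,
    AlgEquiv.apply_symm_apply]

/-- The image of a basis under `φ`. -/
noncomputable def phiBasis {n : ℕ} (d : Basis (Fin n) (E ⊗[ℚ_[p]] WittField p k) D) :
    Basis (Fin n) (E ⊗[ℚ_[p]] WittField p k) D :=
  Basis.ofEquivFun
    { toFun := fun x i => coeffFrobenius p k E (d.equivFun (M.phi.symm x) i)
      map_add' := fun x y => by ext i; simp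
      map_smul' := fun a x => by
        ext i
        simp only [M.phi_symm_smul_coeff, map_smul, Pi.smul_apply, smul_eq_mul, map_mul,
          AlgEquiv.apply_symm_apply, RingHom.id_apply]
      invFun := fun v => M.phi (d.equivFun.symm fun i => (coeffFrobenius p k E).symm (v i))
      left_inv := fun x => by simp
      right_inv := fun v => by
        ext i
        change coeffFrobenius p k E (d.equivFun (M.phi.symm (M.phi (d.equivFun.symm _))) i) = v i
        rw [AddEquiv.symm_apply_apply, LinearEquiv.apply_symm_apply, AlgEquiv.apply_symm_apply] }

theorem phiBasis_apply {n : ℕ} (d : Basis (Fin n) (E ⊗[ℚ_[p]] WittField p k) D) (j : Fin n) :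
    M.phiBasis d j = M.phi (d j) := by
  apply (M.phiBasis d).equivFun.injective
  ext i
  rw [Basis.equivFun_self]
  change _ = coeffFrobenius p k E (d.equivFun (M.phi.symm (M.phi (d j))) i)
  rw [AddEquiv.symm_apply_apply, Basis.equivFun_self]
  split_ifs <;> simp

/-- The trace of `⋀^r φ^f` is fixed by Frobenius, so it lies in `E`. -/
theorem exists_trace_eq [Finite k] {f : ℕ} (hf : Nat.card k = p ^ f) {n : ℕ}
    (d : Basis (Fin n) (E ⊗[ℚ_[p]] WittField p k) D) (r : ℕ) :
    ∃ y : E, algebraMap E (E ⊗[ℚ_[p]] WittField p k) y =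
      LinearMap.trace (E ⊗[ℚ_[p]] WittField p k) (⋀[E ⊗[ℚ_[p]] WittField p k]^r D)
        (exteriorPower.map r (M.phiPow hf)) := by
  refine exists_of_coeffFrobenius_eq ?_
  have hcomm : ∀ x, M.phiPow hf (M.phi x) = M.phi (M.phiPow hf x) := fun x =>
    (Function.iterate_succ_apply M.phi f x).symm.trans (Function.iterate_succ_apply' M.phi f x)
  -- As `φ` commutes with `φ^f`, the matrix of `φ^f` in the basis `φ(d)` is the Frobenius transform
  -- of its matrix in `d`, while the trace is the same in both bases.
  have hmat : LinearMap.toMatrix (M.phiBasis d) (M.phiBasis d) (M.phiPow hf) =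
      (LinearMap.toMatrix d d (M.phiPow hf)).map (coeffFrobenius p k E).toRingEquiv.toRingHom := by
    ext i j
    rw [LinearMap.toMatrix_apply, Matrix.map_apply, LinearMap.toMatrix_apply, phiBasis_apply,
      hcomm]
    change coeffFrobenius p k E (d.equivFun (M.phi.symm (M.phi _)) i) = _
    rw [AddEquiv.symm_apply_apply]
    rfl
  conv_rhs => rw [trace_exteriorPower (M.phiBasis d), hmat, minorSum_map, ← trace_exteriorPower]
  rfl

end PhiNModule

namespace PhiNModule

variable [Module E D] [IsScalarTower E (E ⊗[ℚ_[p]] WittField p k) D]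

theorem component_smul {σ : WittField p k →ₐ[ℚ_[p]] E} {x : D} (hx : x ∈ component D σ)
    (y : E ⊗[ℚ_[p]] WittField p k) : y • x = coeffProj σ y • x := by
  induction y using TensorProduct.induction_on with
  | zero => simp
  | add y z hy hz => rw [add_smul, hy, hz, map_add, add_smul]
  | tmul e a =>
    have h4 : (e ⊗ₜ a : E ⊗[ℚ_[p]] WittField p k) = algebraMap E _ e * (1 ⊗ₜ a) := by simp
    rw [h4, mul_smul, hx a, algebraMap_smul, ← h4, coeffProj_tmul, mul_smul]

theorem idempotent_smul_mem {σ : WittField p k →ₐ[ℚ_[p]] E} {ε : E ⊗[ℚ_[p]] WittField p k}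
    (hε : ∀ x, x * ε = algebraMap E _ (coeffProj σ x) * ε) (x : D) : ε • x ∈ component D σ := by
  intro a
  rw [← mul_smul, hε, mul_smul, algebraMap_smul, coeffProj_tmul, one_mul]

/-- The basis of the component `D_σ` obtained from a basis of `D`. -/
noncomputable def componentBasis {n : ℕ} (d : Basis (Fin n) (E ⊗[ℚ_[p]] WittField p k) D)
    {σ : WittField p k →ₐ[ℚ_[p]] E} {ε : E ⊗[ℚ_[p]] WittField p k} (h1 : coeffProj σ ε = 1)
    (hε : ∀ x, x * ε = algebraMap E _ (coeffProj σ x) * ε) :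
    Basis (Fin n) E (component D σ) :=
  Basis.ofEquivFun
    { toFun := fun x i => coeffProj σ (d.equivFun x.1 i)
      map_add' := fun x y => by ext i; simp
      map_smul' := fun a x => by
        ext i
        change coeffProj σ (d.equivFun (a • x.1) i) = a * _
        rw [← algebraMap_smul (E ⊗[ℚ_[p]] WittField p k) a x.1, map_smul, Pi.smul_apply,
          smul_eq_mul, map_mul, AlgHom.commutes]
        rfl
      invFun := fun v => ⟨ε • d.equivFun.symm fun i => algebraMap E _ (v i),
        idempotent_smul_mem hε _⟩
      left_inv := fun x => by
        refine Subtype.ext ?_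
        change ε • d.equivFun.symm (fun i => algebraMap E _ (coeffProj σ (d.equivFun x.1 i))) = x.1
        have h2 : ε • x.1 = x.1 := by rw [component_smul x.2, h1, one_smul]
        rw [← map_smul]
        conv_rhs => rw [← h2, ← d.equivFun.symm_apply_apply x.1, ← map_smul]
        congr 1
        ext i
        simp only [Pi.smul_apply, smul_eq_mul]
        rw [mul_comm, ← hε, mul_comm]
      right_inv := fun v => by
        ext i
        change coeffProj σ (d.equivFun (ε • d.equivFun.symm _) i) = v i
        rw [map_smul, LinearEquiv.apply_symm_apply, Pi.smul_apply, smul_eq_mul, map_mul, h1,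
          one_mul, AlgHom.commutes]
        rfl }

/-- The basis of `D_σ` consists of the vectors `ε • d j`, and its coordinates are those of `D`
projected along `σ`. -/
theorem toMatrix_onComponent {n : ℕ} (d : Basis (Fin n) (E ⊗[ℚ_[p]] WittField p k) D)
    {σ : WittField p k →ₐ[ℚ_[p]] E} {ε : E ⊗[ℚ_[p]] WittField p k} (h1 : coeffProj σ ε = 1)
    (hε : ∀ x, x * ε = algebraMap E _ (coeffProj σ x) * ε)
    (T : D →ₗ[E ⊗[ℚ_[p]] WittField p k] D) :
    LinearMap.toMatrix (componentBasis d h1 hε) (componentBasis d h1 hε) (onComponent σ T) =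
      (LinearMap.toMatrix d d T).map (coeffProj σ).toRingHom := by
  have hb : ∀ j, (componentBasis d h1 hε j).1 = ε • d j := by
    intro j
    have h2 : componentBasis d h1 hε j = ⟨ε • d j, idempotent_smul_mem hε _⟩ := by
      apply (componentBasis d h1 hε).equivFun.injective
      ext i
      rw [Basis.equivFun_self]
      change _ = coeffProj σ (d.equivFun (ε • d j) i)
      rw [map_smul, Pi.smul_apply, Basis.equivFun_self, smul_eq_mul, map_mul, h1, one_mul]
      split_ifs <;> simp
    rw [h2]
  ext i j
  rw [LinearMap.toMatrix_apply, Matrix.map_apply, LinearMap.toMatrix_apply]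
  change coeffProj σ (d.equivFun (T (componentBasis d h1 hε j).1) i) = _
  rw [hb, map_smul, map_smul, Pi.smul_apply, smul_eq_mul, map_mul, h1, one_mul]
  rfl

end PhiNModule

end Component

/-! ### The trace as a symmetric function of eigenvalues -/

section Eigenvalues

variable {p : ℕ} [Fact p.Prime] {k : Type u} [Field k] [CharP k p] [PerfectRing k p] [Finite k]
  {E : Type u} [Field E] [Algebra ℚ_[p] E] [FiniteDimensional ℚ_[p] E]
  {D : Type*} [AddCommGroup D] [Module (E ⊗[ℚ_[p]] WittField p k) D]
  [Module E D] [IsScalarTower E (E ⊗[ℚ_[p]] WittField p k) D]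

/-- The trace of `⋀^r φ^f` lies in `E`, and it is the elementary symmetric function of the
eigenvalues of `φ^f` on a component `D_σ`. -/
theorem PhiNModule.exists_trace_eq_esymm (M : PhiNModule p k E D) {f : ℕ}
    (hf : Nat.card k = p ^ f) {n r : ℕ} (hr : r ≤ n)
    (d : Basis (Fin n) (E ⊗[ℚ_[p]] WittField p k) D) (σ : WittField p k →ₐ[ℚ_[p]] E)
    {C : Type*} [Field C] [Infinite C] [Algebra E C]
    {S : Module.End C (C ⊗[E] PhiNModule.component D σ)}
    (e : Basis (Fin n) C (C ⊗[E] PhiNModule.component D σ))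
    (hS : Commute S ((PhiNModule.onComponent σ (M.phiPow hf)).baseChange C))
    (hN : IsNilpotent ((PhiNModule.onComponent σ (M.phiPow hf)).baseChange C - S))
    {x : Fin n → C} (hx : ∀ j, S (e j) = x j • e j) :
    ∃ y : E, algebraMap E (E ⊗[ℚ_[p]] WittField p k) y =
        LinearMap.trace (E ⊗[ℚ_[p]] WittField p k) (⋀[E ⊗[ℚ_[p]] WittField p k]^r D)
          (exteriorPower.map r (M.phiPow hf)) ∧
      algebraMap E C y = ∑ s ∈ (Finset.univ : Finset (Fin n)).powersetCard r, ∏ i ∈ s, x i := by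
  obtain ⟨y, hy⟩ := M.exists_trace_eq hf d r
  refine ⟨y, hy, ?_⟩
  obtain ⟨ε, h1, hε⟩ := exists_coeffIdempotent σ
  let c := PhiNModule.componentBasis d h1 hε
  -- Projecting the trace along `σ` leaves `y` unchanged and turns the matrix of `φ^f` on `D` into
  -- the one on `D_σ`.
  have hy' : y = minorSum r (LinearMap.toMatrix c c
      (PhiNModule.onComponent σ (M.phiPow hf))) := by
    have h2 := congrArg (coeffProj σ) hy
    rw [AlgHom.commutes, trace_exteriorPower d] at h2
    refine h2.trans ?_
    rw [PhiNModule.toMatrix_onComponent, minorSum_map]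
    rfl
  have hfin : Module.Finite C (C ⊗[E] PhiNModule.component D σ) := Module.Finite.of_basis e
  have hch := charpoly_eq_of_isNilpotent_sub hS hN
  rw [← LinearMap.charpoly_toMatrix _ (Algebra.TensorProduct.basis C c),
    ← LinearMap.charpoly_toMatrix S e,
    LinearMap.toMatrix_baseChange] at hch
  have hdiag : LinearMap.toMatrix e e S = Matrix.diagonal x := by
    ext i j
    rw [LinearMap.toMatrix_apply, hx, map_smul, Basis.repr_self, Finsupp.smul_apply,
      Matrix.diagonal_apply, Finsupp.single_apply, smul_eq_mul]
    by_cases h : i = j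
    · simp [h]
    · simp [h, Ne.symm h]
  have hm := minorSum_eq_of_charpoly_eq hr hch
  rw [hdiag, minorSum_diagonal, minorSum_map, ← hy'] at hm
  exact hm

end Eigenvalues

/-! ### Descent of irreducibility -/

section Irreducible

/-- A nonzero invariant subspace of a representation that is irreducible after an extension of
scalars is the whole space. -/
theorem eq_top_of_isIrreducible_extendScalars {E C G V : Type*} [Field E] [Field C] [Algebra E C]
    [Group G] [AddCommGroup V] [Module E V] {ρ : Representation E G V}
    (h : (extendScalars C ρ).IsIrreducible) {W : Submodule E V} (hW : ∀ g, W ≤ W.comap (ρ g))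
    {v : V} (hv : v ∈ W) (hv0 : v ≠ 0) : W = ⊤ := by
  have hinj : ∀ w : V, (1 : C) ⊗ₜ[E] w = 0 → w = 0 := fun w hw =>
    (Module.FaithfullyFlat.tensorProduct_mk_injective (A := E) (B := C) V)
      (hw.trans (map_zero _).symm)
  let S : Subrepresentation (extendScalars C ρ) :=
    ⟨W.baseChange C, fun g w hw => by
      rw [Submodule.baseChange_eq_span] at hw ⊢
      induction hw using Submodule.span_induction with
      | mem w hw =>
        obtain ⟨w', hw', rfl⟩ := hw
        exact Submodule.subset_span ⟨ρ g w', hW g hw', rfl⟩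
      | zero => rw [map_zero]; exact Submodule.zero_mem _
      | add x y _ _ hx hy => rw [map_add]; exact Submodule.add_mem _ hx hy
      | smul c x _ hx => rw [map_smul]; exact Submodule.smul_mem _ c hx⟩
  have hS : S = ⊤ := by
    refine (eq_bot_or_eq_top S).resolve_left fun hbot => hv0 (hinj v ?_)
    have h1 : (1 : C) ⊗ₜ[E] v ∈ S := Submodule.tmul_mem_baseChange_of_mem 1 hv
    rw [hbot] at h1
    exact h1
  by_contra hne
  obtain ⟨x, hx⟩ : ∃ x, x ∉ W := by
    by_contra! hall
    exact hne (eq_top_iff.mpr fun x _ => hall x)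
  -- The base change of a linear form that vanishes on `W` but not at `x` shows that `1 ⊗ x` is
  -- outside the base change of `W`.
  obtain ⟨l, hlx, hl⟩ := Submodule.exists_le_ker_of_notMem hx
  have hker : W.baseChange C ≤ LinearMap.ker (l.baseChange C) := by
    rw [Submodule.baseChange_eq_span, Submodule.span_le]
    rintro _ ⟨w, hw, rfl⟩
    have h2 : l w = 0 := hl hw
    change l.baseChange C (1 ⊗ₜ w) = 0
    rw [LinearMap.baseChange_tmul, h2, TensorProduct.tmul_zero]
  have h3 : (1 : C) ⊗ₜ[E] x ∈ S := by
    rw [hS]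
    exact Submodule.mem_top (R := C)
  have h4 : (1 : C) ⊗ₜ[E] l x = 0 := hker h3
  exact hlx ((Module.FaithfullyFlat.tensorProduct_mk_injective (A := E) (B := C) E)
      (h4.trans (map_zero _).symm))

end Irreducible

/-! ### From generating vectors to the whole representation, and twists -/

section Scalar

variable {F : Type u} [Field F] [ValuativeRel F] [TopologicalSpace F]
  [IsNonarchimedeanLocalField F] {E : Type u} [Field E] {n : ℕ} {z : BernsteinCentre F E n}

/-- Since `z` commutes with `G`, a scalar action on Iwahori fixed generators propagates to their
translates. -/
theorem actsByScalar_of_span {V : Rep.{u} E (GL (Fin n) F)} {S : Set V}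
    (hS : ∀ v ∈ S, ∀ x ∈ iwahori F n, V.ρ x v = v)
    (hspan : Submodule.span E {w : V | ∃ (g : GL (Fin n) F), ∃ v ∈ S, w = V.ρ g v} = ⊤) {c : E}
    (hc : ∀ v ∈ S, ((heckeCoeff z).sum fun y a => a • V.ρ y.out v) = c • v) :
    ActsByScalar z V c := by
  have hV : iwahoriBlock F E n V := by
    refine iwahoriBlock_of_span (eq_top_iff.mpr (hspan.symm.le.trans (Submodule.span_mono ?_)))
    rintro w ⟨g, v, hv, rfl⟩
    exact ⟨g, v, hS v hv, rfl⟩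
  refine ⟨hV, fun w => ?_⟩
  have hw : w ∈ Submodule.span E {w : V | ∃ (g : GL (Fin n) F), ∃ v ∈ S, w = V.ρ g v} :=
    hspan ▸ Submodule.mem_top
  induction hw using Submodule.span_induction with
  | mem w hw =>
    obtain ⟨g, v, hv, rfl⟩ := hw
    rw [centreAct_rho, centreAct_eq_sum z hV (hS v hv), hc v hv, map_smul]
  | zero => simp
  | add x y _ _ hx hy => rw [map_add, hx, hy, smul_add]
  | smul a x _ hx => rw [map_smul, hx, smul_comm]

/-- The identity map from `V` to its twist. -/
noncomputable def toTwistDet (s : Eˣ) (V : Rep.{u} E (GL (Fin n) F)) : V →ₗ[E] twistDet s V :=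
  (LinearMap.id : V →ₗ[E] V)

theorem toTwistDet_surjective (s : Eˣ) (V : Rep.{u} E (GL (Fin n) F)) :
    Function.Surjective (toTwistDet s V) := fun v => ⟨v, rfl⟩

theorem twistDet_rho (s : Eˣ) (V : Rep.{u} E (GL (Fin n) F)) (g : GL (Fin n) F) (v : V) :
    (twistDet s V).ρ g (toTwistDet s V v) =
      ((unramChar (s⁻¹ ^ (n - 1)) (Matrix.GeneralLinearGroup.det g) : Eˣ) : E) •
        toTwistDet s V (V.ρ g v) := by
  rw [← map_smul]
  change ((((sqrtAbs s).comp Matrix.GeneralLinearGroup.det) ^ (n - 1)) g : Eˣ).val • V.ρ g v =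
    (_ : E) • V.ρ g v
  congr 2
  change (s⁻¹ ^ ord _) ^ (n - 1) = (s⁻¹ ^ (n - 1)) ^ ord _
  rw [← zpow_natCast, ← zpow_natCast, ← zpow_mul, ← zpow_mul, mul_comm]

theorem unramChar_det_maxCompact (m : Eˣ) {x : GL (Fin n) F} (hx : x ∈ maxCompact F n) :
    unramChar m (Matrix.GeneralLinearGroup.det x) = 1 := by
  have h1 : ord (Matrix.GeneralLinearGroup.det x) = 0 := by
    rw [ord_eq_vord]
    exact vord_det_maxCompact hx
  simp [unramChar, h1]

theorem actsByScalar_twistDet {V : Rep.{u} E (GL (Fin n) F)} {S : Set V} (s : Eˣ)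
    (hS : ∀ v ∈ S, ∀ x ∈ iwahori F n, V.ρ x v = v)
    (hspan : Submodule.span E {w : V | ∃ (g : GL (Fin n) F), ∃ v ∈ S, w = V.ρ g v} = ⊤) {c : E}
    (hc : ∀ v ∈ S, ((heckeCoeff z).sum fun y a => (a * (unramChar (s⁻¹ ^ (n - 1))
      (Matrix.GeneralLinearGroup.det y.out) : Eˣ)) • V.ρ y.out v) = c • v) :
    ActsByScalar z (twistDet s V) c := by
  refine actsByScalar_of_span (V := twistDet s V) (S := toTwistDet s V '' S) ?_ ?_ ?_
  · rintro _ ⟨v, hv, rfl⟩ x hx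
    rw [twistDet_rho, unramChar_det_maxCompact _ (iwahori_le_maxCompact hx), Units.val_one,
      one_smul, hS v hv x hx]
  · refine eq_top_iff.mpr fun w _ => ?_
    obtain ⟨v, rfl⟩ := toTwistDet_surjective s V w
    have hv : v ∈ Submodule.span E {w : V | ∃ (g : GL (Fin n) F), ∃ v ∈ S, w = V.ρ g v} :=
      hspan ▸ Submodule.mem_top
    induction hv using Submodule.span_induction with
    | mem w hw =>
      obtain ⟨g, v, hv, rfl⟩ := hw
      have h1 : toTwistDet s V (V.ρ g v) =
          (((unramChar (s⁻¹ ^ (n - 1)) (Matrix.GeneralLinearGroup.det g))⁻¹ : Eˣ) : E) •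
            (twistDet s V).ρ g (toTwistDet s V v) := by
        rw [twistDet_rho, smul_smul, Units.inv_mul, one_smul]
      rw [h1]
      exact Submodule.smul_mem _ _ (Submodule.subset_span ⟨g, _, ⟨v, hv, rfl⟩, rfl⟩)
    | zero => rw [map_zero]; exact Submodule.zero_mem _
    | add x y _ _ hx hy => rw [map_add]; exact Submodule.add_mem _ (hx trivial) (hy trivial)
    | smul a x _ hx => rw [map_smul]; exact Submodule.smul_mem _ a (hx trivial)
  · rintro _ ⟨v, hv, rfl⟩
    have h1 := congrArg (toTwistDet s V) (hc v hv)
    rw [map_smul, map_finsuppSum] at h1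
    refine Eq.trans (Finsupp.sum_congr fun y _ => ?_) h1
    rw [twistDet_rho, smul_smul, map_smul]

end Scalar

/-! ### The action on the twist of `η` -/

section Eta

variable {F : Type u} [Field F] [ValuativeRel F] [TopologicalSpace F]
  [IsNonarchimedeanLocalField F] {E : Type u} [Field E] {n r : ℕ} {z : BernsteinCentre F E n}
  {ϖ : Fˣ}

theorem ord_det_heckeElement (hϖ : ord ϖ = 1) (hr : r ≤ n) :
    ord (Matrix.GeneralLinearGroup.det (heckeElement n r ϖ : GL (Fin n) F)) = r := by
  have h : heckeElement n r ϖ = torusGL fun i : Fin n => if (i : ℕ) < r then ϖ else 1 := rfl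
  have h1 := sum_height (torusGL fun i : Fin n => if (i : ℕ) < r then ϖ else 1)
  rw [ord_eq_vord, h]
  refine h1.symm.trans ?_
  rw [height_of_borel (torusGL_mem _)]
  simp only [diagOrd_torusGL, apply_ite ord, hϖ, ord_one]
  rw [Finset.sum_boole, Fin.card_filter_val_lt]
  simp [hr]

theorem unramChar_det_out (m : Eˣ) (g : GL (Fin n) F) :
    unramChar m (Matrix.GeneralLinearGroup.det
      ((g : GL (Fin n) F ⧸ maxCompact F n).out : GL (Fin n) F)) =
      unramChar m (Matrix.GeneralLinearGroup.det g) := by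
  have h := apply_out (K := maxCompact F n)
    (φ := fun g => unramChar m (Matrix.GeneralLinearGroup.det g))
    (fun g k hk => by rw [map_mul, map_mul, unramChar_det_maxCompact m hk, mul_one]) 1 g
  simpa only [one_mul] using h

theorem unramChar_det_of_mem_heckeOrbit (hϖ : ord ϖ = 1) (hr : r ≤ n) (m : Eˣ)
    {y : GL (Fin n) F ⧸ maxCompact F n} (hy : y ∈ heckeOrbit n r ϖ) :
    unramChar m (Matrix.GeneralLinearGroup.det y.out) = m ^ r := by
  obtain ⟨k, rfl⟩ := (Set.Finite.mem_toFinset _).mp hy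
  refine (unramChar_det_out m (k.1 * heckeElement n r ϖ)).trans ?_
  rw [map_mul, map_mul, unramChar_det_maxCompact m k.2, one_mul]
  change m ^ ord _ = _
  rw [ord_det_heckeElement hϖ hr, zpow_natCast]

/-- The character of the determinant is trivial on `K`, so it can be evaluated after projection to
`G/K`. There only the double coset remains, on which it is constantly `m ^ r`. -/
theorem heckeCoeff_sum_single_twist (hϖ : ord ϖ = 1) (hr : r ≤ n)
    (hz : centreAct z (cInd F E n) cInd_mem = doubleCosetOp (heckeElement n r ϖ)) (m : Eˣ) :
    ((heckeCoeff z).sum fun y a => (a * (unramChar m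
      (Matrix.GeneralLinearGroup.det y.out) : Eˣ)) • cosetRep F E n y.out (baseCoset F E n)) =
      (m : E) ^ r • ∑ y ∈ heckeOrbit n r ϖ, (Finsupp.single y (1 : E) :
        (GL (Fin n) F ⧸ maxCompact F n) →₀ E) := by
  have h := congrArg (Finsupp.linearCombination E fun y : GL (Fin n) F ⧸ maxCompact F n =>
    ((unramChar m (Matrix.GeneralLinearGroup.det y.out) : Eˣ) : E) •
      (Finsupp.single y (1 : E) : (GL (Fin n) F ⧸ maxCompact F n) →₀ E))
    (heckeCoeff_sum_single hz)
  rw [map_finsuppSum, map_sum] at h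
  simp only [Finsupp.linearCombination_single, one_smul, unramChar_det_out] at h
  rw [Finset.smul_sum]
  refine Eq.trans (Finsupp.sum_congr fun y _ => ?_) (h.trans (Finset.sum_congr rfl fun y hy => ?_))
  · rw [cosetRep_baseCoset, smul_smul]
  · rw [unramChar_det_of_mem_heckeOrbit hϖ hr m hy, Units.val_pow_eq_pow_val]

/-- The quotient map from `c-Ind_K^G 1` to `η`. -/
noncomputable def etaMk (π : Rep.{u} E (GL (Fin n) F)) :
    ((GL (Fin n) F ⧸ maxCompact F n) →₀ E) →ₗ[E] eta π :=
  (etaKer π).mkQ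

theorem etaMk_rho (π : Rep.{u} E (GL (Fin n) F)) (g : GL (Fin n) F)
    (f : (GL (Fin n) F ⧸ maxCompact F n) →₀ E) :
    (eta π).ρ g (etaMk π f) = etaMk π (cosetRep F E n g f) := rfl

/-- If `z` acts on `π` by a scalar, then it acts on the twist of `η` by the twisted scalar. -/
theorem actsByScalar_twistDet_eta (hϖ : ord ϖ = 1) (hr : r ≤ n)
    (hz : centreAct z (cInd F E n) cInd_mem = doubleCosetOp (heckeElement n r ϖ)) (s : Eˣ)
    {π : Rep.{u} E (GL (Fin n) F)} {c : E} (hπ : ActsByScalar z π c) :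
    ActsByScalar z (twistDet s (eta π)) (((s⁻¹ ^ (n - 1) : Eˣ) : E) ^ r * c) := by
  refine actsByScalar_twistDet s (S := {etaMk π (baseCoset F E n)}) ?_ ?_ ?_
  · rintro _ rfl x hx
    rw [etaMk_rho, baseCoset_fixed x (iwahori_le_maxCompact hx)]
  · refine eq_top_iff.mpr fun w _ => ?_
    obtain ⟨f, rfl⟩ : ∃ f, etaMk π f = w := (etaKer π).mkQ_surjective w
    induction f using Finsupp.induction_linear with
    | zero => rw [map_zero]; exact Submodule.zero_mem _
    | add v w hv hw => rw [map_add]; exact Submodule.add_mem _ (hv trivial) (hw trivial)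
    | single x c =>
      induction x using QuotientGroup.induction_on with
      | H x =>
        have h1 : Finsupp.single (x : GL (Fin n) F ⧸ maxCompact F n) c =
            c • cosetRep F E n x (baseCoset F E n) := by
          rw [cosetRep_baseCoset, Finsupp.smul_single, smul_eq_mul, mul_one]
        rw [h1, map_smul, ← etaMk_rho]
        exact Submodule.smul_mem _ _ (Submodule.subset_span ⟨x, _, rfl, rfl⟩)
  · rintro _ rfl
    simp only [etaMk_rho]
    have h1 := congrArg (etaMk π) (heckeCoeff_sum_single_twist hϖ hr hz (s⁻¹ ^ (n - 1)))
    rw [map_finsuppSum] at h1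
    simp only [map_smul] at h1
    refine h1.trans ?_
    rw [mul_smul]
    congr 1
    -- What is left is `z f - c f` for the generator `f`, one of the elements that span `etaKer π`.
    rw [← map_smul, ← doubleCosetOp_single_one, ← hz]
    refine (Submodule.Quotient.eq (etaKer π)).mpr (Submodule.subset_span ⟨z, c, _, hπ, rfl⟩)

end Eta

/-! ### Satake parameters of segments and the proof of the theorem -/

section Conclusion

variable {F : Type u} [Field F] [ValuativeRel F] [TopologicalSpace F]
  [IsNonarchimedeanLocalField F] {n r t : ℕ} {ϖ : Fˣ}

theorem card_subtype_lt_fin (j : Fin n) : Fintype.card {j' : Fin n // j' < j} = j := by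
  rw [Fintype.card_subtype, ← Fin.card_Iio]
  congr 1
  ext; simp

theorem card_subtype_gt_fin (j : Fin n) : Fintype.card {j' : Fin n // j < j'} = n - 1 - j := by
  rw [Fintype.card_subtype, ← Fin.card_Ioi]
  congr 1
  ext; simp

/-- The Satake parameters of the twist by `|det|^{(n-1)/2}` of the representation attached to a
family of segments. -/
theorem satake_segParam {C : Type u} [Field C] (hϖ : ord ϖ = 1) (hr : r ≤ n) {s : Cˣ}
    (hs : (s : C) ^ 2 = resCard F) (b : Fin n → Fin t) (a : Fin t → Cˣ) :
    satake r ϖ (fun j => s⁻¹ ^ (n - 1) * segParam s b a j) =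
      (resCard F : C) ^ ((r : ℤ) * (1 - r) / 2) *
        ∑ J ∈ (Finset.univ : Finset (Fin n)).powersetCard r, ∏ j ∈ J,
          ((a (b j) * (s ^ 2)⁻¹ ^ Fintype.card {j' // j' < j ∧ b j' = b j} : Cˣ) : C) := by
  rw [← satake_eq_esymm hϖ hr (q := s ^ 2) (by rw [Units.val_pow_eq_pow_val, hs])]
  -- The twist contributes the exponent `n - 1` of `s⁻¹` and the modulus character `n - 1 - 2 j`.
  -- Together they give `2 (n - 1 - j)`, the power of `q⁻¹` absorbed in `satake_eq_esymm`.
  congr 1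
  ext1 j
  rw [segParam, ← mul_assoc]
  congr 1
  have hj : (j : ℕ) + 1 ≤ n := j.2
  rw [card_subtype_lt_fin, card_subtype_gt_fin, ← zpow_natCast, ← zpow_add, ← inv_pow, ← pow_mul,
    ← zpow_natCast]
  congr 1
  zify [show 1 ≤ n by omega, show (j : ℕ) ≤ n - 1 by omega]
  ring

variable {E : Type u} [Field E] {C : Type u} [Field C] [CharZero C] [Algebra E C]
  {z : BernsteinCentre F E n}

/-- If a quotient of a representation induced from segments is obtained from `π` by an extension
of scalars, then `z` acts on the Iwahori fixed vectors of `π` through the Satake parameters. -/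
theorem heckeCoeff_sum_smul (hϖ : ord ϖ = 1)
    (hz : centreAct z (cInd F E n) cInd_mem = doubleCosetOp (heckeElement n r ϖ))
    {s : Cˣ} {b : Fin n → Fin t} (hb : Monotone b) {a : Fin t → Cˣ}
    {τ : ∀ i : Fin t, Rep.{u} C (GL {j // b j = i} F)}
    (hτ : ∀ i, IsSegmentQuotient s (a i) (τ i).ρ) {V : Type u} [AddCommGroup V] [Module E V]
    {ρ : Representation E (GL (Fin n) F) V}
    (hρ : IsQuotientOf (extendScalars C ρ) (parabolicInd s b τ)) (m : Eˣ) {c : E}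
    (hc : satake r ϖ (fun j => Units.map (algebraMap E C).toMonoidHom m * segParam s b a j) =
      algebraMap E C c) {v : V} (hv : ∀ x ∈ iwahori F n, ρ x v = v) :
    ((heckeCoeff z).sum fun y e => (e * (unramChar m
      (Matrix.GeneralLinearGroup.det y.out) : Eˣ)) • ρ y.out v) = c • v := by
  have hinj := Module.FaithfullyFlat.tensorProduct_mk_injective (A := E) (B := C) V
  apply hinj
  have h := hecke_eigen_parabolic hϖ hz hb hτ hρ (Units.map (algebraMap E C).toMonoidHom m)
    (v := (1 : C) ⊗ₜ[E] v) (fun x hx => by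
      change (1 : C) ⊗ₜ[E] ρ x v = _
      rw [hv x hx])
  rw [hc, algebraMap_smul] at h
  rw [map_smul]
  refine Eq.trans ?_ h
  rw [map_finsuppSum]
  refine Finsupp.sum_congr fun y _ => ?_
  have h2 : ((unramChar (Units.map (algebraMap E C).toMonoidHom m)
      (Matrix.GeneralLinearGroup.det y.out) : Cˣ) : C) =
      algebraMap E C (unramChar m (Matrix.GeneralLinearGroup.det y.out) : Eˣ) := by
    change ((Units.map (algebraMap E C).toMonoidHom m ^ ord _ : Cˣ) : C) =
      algebraMap E C (m ^ ord _ : Eˣ)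
    rw [← map_zpow]
    rfl
  rw [h2, ← map_mul, algebraMap_smul, map_smul]
  rfl

/-- If `π` becomes, after an extension of scalars, an irreducible quotient of the representation
induced from a family of segments, then `z` acts on the twists of `π` and `η` by the elementary
symmetric function of the eigenvalues attached to the segments. -/
theorem actsByScalar_of_segments (hϖ : ord ϖ = 1) (hr : r ≤ n)
    (hz : centreAct z (cInd F E n) cInd_mem = doubleCosetOp (heckeElement n r ϖ))
    {s : Eˣ} (hs : (s : E) ^ 2 = resCard F) {s' : Cˣ}
    (hs' : s' = Units.map (algebraMap E C).toMonoidHom s) {b : Fin n → Fin t} (hb : Monotone b)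
    {a : Fin t → Cˣ} {τ : ∀ i : Fin t, Rep.{u} C (GL {j // b j = i} F)}
    (hτ : ∀ i, IsSegmentQuotient s' (a i) (τ i).ρ) {π : Rep.{u} E (GL (Fin n) F)}
    (hI : ∃ v : π, v ≠ 0 ∧ ∀ x ∈ iwahori F n, π.ρ x v = v)
    (hirr : (extendScalars C π.ρ).IsIrreducible)
    (hquot : IsQuotientOf (extendScalars C π.ρ) (parabolicInd s' b τ)) {y : E}
    (hy : algebraMap E C y = ∑ J ∈ (Finset.univ : Finset (Fin n)).powersetCard r, ∏ j ∈ J,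
      ((a (b j) * (s' ^ 2)⁻¹ ^ Fintype.card {j' // j' < j ∧ b j' = b j} : Cˣ) : C)) :
    ActsByScalar z (twistDet s (eta π)) ((resCard F : E) ^ ((r : ℤ) * (1 - r) / 2) * y) ∧
      ActsByScalar z (twistDet s π) ((resCard F : E) ^ ((r : ℤ) * (1 - r) / 2) * y) := by
  have hsC : (s' : C) ^ 2 = resCard F := by
    have h := congrArg (algebraMap E C) hs
    rw [map_pow, map_natCast] at h
    rw [hs']
    exact h
  set m : Eˣ := s⁻¹ ^ (n - 1) with hm
  set c : E := (resCard F : E) ^ ((r : ℤ) * (1 - r) / 2) * y with hc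
  have hsat : satake r ϖ (fun j => Units.map (algebraMap E C).toMonoidHom m *
      segParam s' b a j) = algebraMap E C c := by
    rw [hc, map_mul, map_zpow₀, map_natCast, hy, ← satake_segParam hϖ hr hsC, hm, map_pow, map_inv,
      ← hs']
  -- The Satake value is homogeneous of degree `r`, so the eigenvalue on `π` itself is the twisted
  -- one divided by `m ^ r`. It is needed for `η`, which is defined through the untwisted `π`.
  have hsat1 : satake r ϖ (fun j => Units.map (algebraMap E C).toMonoidHom 1 *
      segParam s' b a j) = algebraMap E C (((m ^ r)⁻¹ : Eˣ) * c) := by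
    rw [satake_smul hϖ hr] at hsat ⊢
    rw [map_mul, ← hsat, ← mul_assoc]
    congr 1
    rw [map_one, Units.val_one, one_pow]
    change _ = algebraMap E C _ * algebraMap E C _ ^ r
    rw [← map_pow, ← map_mul, ← Units.val_pow_eq_pow_val, Units.inv_mul, map_one]
  obtain ⟨v₀, hv₀, hfix⟩ := hI
  -- The Iwahori fixed vectors generate a nonzero subrepresentation, which is all of `π` by
  -- irreducibility over the algebraic closure.
  have hspan : Submodule.span E {w : π | ∃ (g : GL (Fin n) F),
      ∃ v ∈ {v : π | ∀ x ∈ iwahori F n, π.ρ x v = v}, w = π.ρ g v} = ⊤ :=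
    eq_top_of_isIrreducible_extendScalars hirr (genSub_le π.ρ) (mem_genSub hfix) hv₀
  have hπ : ActsByScalar z π (((m ^ r)⁻¹ : Eˣ) * c) := by
    refine actsByScalar_of_span (fun v hv => hv) hspan fun v hv => ?_
    refine Eq.trans (Finsupp.sum_congr fun y _ => ?_)
      (heckeCoeff_sum_smul hϖ hz hb hτ hquot 1 hsat1 hv)
    simp [unramChar]
  constructor
  · have h := actsByScalar_twistDet_eta hϖ hr hz s hπ
    rwa [← hm, ← mul_assoc, ← Units.val_pow_eq_pow_val, Units.mul_inv, one_mul] at h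
  · exact actsByScalar_twistDet s (fun v hv => hv) hspan fun v hv =>
      heckeCoeff_sum_smul hϖ hz hb hτ hquot m hsat hv

end Conclusion

end IwahoriLL

set_option maxHeartbeats 800000 in
theorem proposition4p3
    (p : ℕ) [Fact p.Prime]
    -- `F` is a finite extension of `ℚ_p`, with `q = p ^ f` elements in the residue field
    (F : Type u) [Field F] [ValuativeRel F] [TopologicalSpace F] [IsNonarchimedeanLocalField F]
    [CharZero F] [CharP 𝓀[F] p]
    (f : ℕ) (hf : Nat.card 𝓀[F] = p ^ f)
    (ϖ : Fˣ) (hϖ : IwahoriLL.ord ϖ = 1)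
    -- the coefficient field, with an embedding of `F₀ = W(k_F)[1/p]` and a square root of `q`
    (E : Type u) [Field E] [Algebra ℚ_[p] E] [FiniteDimensional ℚ_[p] E]
    (σ : IwahoriLL.WittField p 𝓀[F] →ₐ[ℚ_[p]] E)
    (s : Eˣ) (hs : (s : E) ^ 2 = IwahoriLL.resCard F)
    (n r : ℕ) (hr : 1 ≤ r) (hrn : r ≤ n)
    -- the `(φ, N)`-module, free of rank `n` over `F₀ ⊗ E`
    (D : Type u) [AddCommGroup D] [Module E D] [Module (E ⊗[ℚ_[p]] IwahoriLL.WittField p 𝓀[F]) D]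
    [IsScalarTower E (E ⊗[ℚ_[p]] IwahoriLL.WittField p 𝓀[F]) D]
    [Module.Free (E ⊗[ℚ_[p]] IwahoriLL.WittField p 𝓀[F]) D]
    [Module.Finite (E ⊗[ℚ_[p]] IwahoriLL.WittField p 𝓀[F]) D]
    (hD : Module.finrank (E ⊗[ℚ_[p]] IwahoriLL.WittField p 𝓀[F]) D = n)
    (M : IwahoriLL.PhiNModule p 𝓀[F] E D)
    -- the generic smooth representation with Iwahori fixed vectors attached to `WD(D)`
    (π : Rep.{u} E (GL (Fin n) F))
    (hsmooth : IwahoriLL.IsSmooth π.ρ)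
    (hIwahori : ∃ v : π, v ≠ 0 ∧ ∀ x ∈ IwahoriLL.iwahori F n, π.ρ x v = v)
    (hgeneric : IwahoriLL.HasWhittakerFunctional
      (IwahoriLL.extendScalars (AlgebraicClosure E) π.ρ))
    (hLanglands : IwahoriLL.LocalLanglands (Units.map (algebraMap E (AlgebraicClosure E)) s)
      ((IwahoriLL.PhiNModule.onComponent σ (M.phiPow hf)).baseChange (AlgebraicClosure E))
      ((IwahoriLL.PhiNModule.onComponent σ M.N).baseChange (AlgebraicClosure E))
      (IwahoriLL.extendScalars (AlgebraicClosure E) π.ρ)) :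
    ∃ c : E,
      algebraMap E (E ⊗[ℚ_[p]] IwahoriLL.WittField p 𝓀[F]) c =
        algebraMap E (E ⊗[ℚ_[p]] IwahoriLL.WittField p 𝓀[F])
          ((IwahoriLL.resCard F : E) ^ ((r : ℤ) * (1 - r) / 2)) *
        LinearMap.trace (E ⊗[ℚ_[p]] IwahoriLL.WittField p 𝓀[F])
          (⋀[E ⊗[ℚ_[p]] IwahoriLL.WittField p 𝓀[F]]^r D) (exteriorPower.map r (M.phiPow hf)) ∧
      -- `z` is the element of the Bernstein centre that corresponds to `θ_r`
      ∀ z : IwahoriLL.BernsteinCentre F E n,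
        IwahoriLL.centreAct z (IwahoriLL.cInd F E n) IwahoriLL.cInd_mem =
          IwahoriLL.doubleCosetOp (IwahoriLL.heckeElement n r ϖ) →
        IwahoriLL.ActsByScalar z (IwahoriLL.twistDet s (IwahoriLL.eta π)) c ∧
        IwahoriLL.ActsByScalar z (IwahoriLL.twistDet s π) c := by
  have : CharZero E := charZero_of_injective_algebraMap (algebraMap ℚ_[p] E).injective
  have : CharZero (AlgebraicClosure E) :=
    charZero_of_injective_algebraMap (algebraMap E (AlgebraicClosure E)).injective
  obtain ⟨t, b, a, hb, -, -, ⟨S, e, hS, hnil, hSe, -, -⟩, τ, hτ, hirr, hquot⟩ := hLanglands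
  obtain ⟨y, hy, hyC⟩ := M.exists_trace_eq_esymm hf hrn (Module.finBasisOfFinrankEq _ D hD) σ e hS
    hnil hSe
  exact ⟨(IwahoriLL.resCard F : E) ^ ((r : ℤ) * (1 - r) / 2) * y,
    (map_mul (algebraMap E _) _ y).trans (congrArg _ hy), fun z hz =>
    IwahoriLL.actsByScalar_of_segments hϖ hrn hz hs rfl hb hτ hIwahori hirr hquot hyC⟩
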